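/- **Notation.** For $R>0$ let $B_R$ be the Banach space of complex sequences $\boldsymbol x=(x_1,x_2,\dots)$ with norm $\sup_n R^{-n}|x_n|<\infty$. Write $[w]=(w,w^2/2,w^3/3,\dots)$, $\xi(\boldsymbol x,k)=\sum_{n\ge1}x_nk^n$, and $D^k f\cdot g(x)=\frac{d^k}{dh^k}f(x+h)g(x-h)|_{h=0}$ ($D=D^1$). *Modified KP hierarchy.* Let $U\subset B_R$ be open and $\tau_n:U\to\mathbb C$ $(n\in\mathbb Z)$ holomorphic. They solve the modified KP hierarchy, $\sum_{i+j=-2}X_i^-\tau_n\otimes X_j^+\tau_{n+1}=0$ with $\sum_n X_n^\pm k^n=e^{\pm\xi(\boldsymbol x,k)}e^{\mp\xi(\tilde\partial_{\boldsymbol x},k^{-1})}$, $\tilde\partial_{\boldsymbol x}=(\partial_{x_1},\frac12\partial_{x_2},\dots)$, if $$\oint_{|z|=r} z\,e^{\xi(\boldsymbol x-\boldsymbol x',z)}\,\tau_n(\boldsymbol x'+[z^{-1}])\,\tau_{n+1}(\boldsymbol x-[z^{-1}])\,dz=0$$ for all $n,\boldsymbol x,\boldsymbol x'$ and all $r>1/R$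 such that $\xi(\boldsymbol x-\boldsymbol x',\cdot)$ has radius of convergence $>r$ and $\boldsymbol x'+[w],\boldsymbol x-[w]\in U$ for $|w|\le 1/r$. (If $U=B_R$ the $\tau_n$ are entire.) The solution is $\ell$-periodic if $\tau_{n+\ell}=\tau_n$, and homogeneous with $d_n\in\mathbb C$ if $\sum_k kx_k\,\partial\tau_n/\partial x_k=d_n\tau_n$ at all points of $U$ that lie in some $B_\rho$, $\rho<R$. Put $\alpha_n=d_{n-1}-2d_n+d_{n+1}+1$. *Modified UC hierarchy.* Let $W\subset B_R\times B_S$ be open and $\tau_{m,n}:W\to\mathbb C$ $(m,n\in\mathbb Z)$ holomorphic in $(\boldsymbol x,\boldsymbol y)$. Let $X^\pm(k)=\sum X^\pm_nk^n=e^{\pm\xi(\boldsymbol x-\tilde\partial_{\boldsymbol y},k)}e^{\mp\xi(\tilde\partial_{\boldsymbol x},k^{-1})}$, $Y^\pm(k^{-1})=\sum Y_n^\pm k^{-n}=e^{\pm\xi(\boldsymbol y-\tilde\partial_{\boldsymbol x},k^{-1})}e^{\mp\xi(\tilde\partial_{\boldsymbol y},k)}$. By a solution we mean functions that satisfy, for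 all $m,n$, the bilinear equations $$\sum_{i+j=-2}X_i^-\tau_{m,n}\otimes X_j^+\tau_{m+1,n}=\sum_{i+j=-1}Y_i^-\tau_{m,n}\otimes Y_j^+\tau_{m+1,n}=0,$$ $$\tau_{m,n}\otimes\tau_{m+1,n+1}-\sum_{i+j=0}X_i^-\tau_{m+1,n}\otimes X_j^+\tau_{m,n+1}=\sum_{i+j=-2}Y_i^-\tau_{m+1,n}\otimes Y_j^+\tau_{m,n+1}=0,$$ where $F\otimes G=F(\boldsymbol x',\boldsymbol y')G(\boldsymbol x,\boldsymbol y)$, $$\sum_{i+j=-1-p}X_i^-F\otimes X_j^+G=\frac1{2\pi i}\oint_{|z|=r} z^pe^{\xi(\boldsymbol x-\boldsymbol x',z)}F(\boldsymbol x'+[z^{-1}],\boldsymbol y'+[z])\,G(\boldsymbol x-[z^{-1}],\boldsymbol y-[z])\,dz,$$ and the $Y$-sums are obtained by exchanging the roles of the first and second arguments. The $X$-equations are required for all arguments and all $1/R<r<S$ such that $\xi(\boldsymbol x-\boldsymbol x',\cdot)$ has radius of convergence $>r$ and $(\boldsymbol x'+[w_1],\boldsymbol y'+[w_2])$, $(\boldsymbol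 x-[w_1],\boldsymbol y-[w_2])\in W$ for $|w_1|\le1/r$, $|w_2|\le r$; the $Y$-equations under the conditions with the roles exchanged. $(\ell,\ell)$-periodic means $\tau_{m+\ell,n}=\tau_{m,n+\ell}=\tau_{m,n}$; homogeneous means $\sum_k(kx_k\partial_{x_k}-ky_k\partial_{y_k})\tau_{m,n}=d_{m,n}\tau_{m,n}$, $d_{m,n}\in\mathbb C$, at all points of $W$ lying in some $B_\rho\times B_{\rho'}$, $\rho<R$, $\rho'<S$. *Equations.* The Darboux chain with period $N$ is $(w_n+w_{n-1})'=w_n^2-w_{n-1}^2+\alpha_n$ $(n\in\mathbb Z/N\mathbb Z)$, normalized by $\sum_n\alpha_n=N$, $\sum_nw_n=Nx/2$. The equation $P(A_{N-1}^{(1)})$, $N\ge 3$, is, for $N=2g+1$, $$f_n'=f_n\Big(\sum_{i=1}^gf_{n+2i-1}-\sum_{i=1}^gf_{n+2i}\Big)+\alpha_n,$$ and, for $N=2g+2$, $$\tfrac{Nx}2f_n'=f_n\Big(\sum_{1\le i\le j\le g}f_{n+2i-1}f_{n+2j}-\sum_{1\le i\le j\le g}f_{n+2i}f_{n+2j+1}\Big)+\Big(\tfrac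 N2-\sum_{i=1}^g\alpha_{n+2i}\Big)f_n+\alpha_n\sum_{i=1}^gf_{n+2i}.$$ **Theorem 1.1.** The following statements hold at every point at which the stated conditions are satisfied. (1) ($P_{\rm II}$.) Let $\tau_n$ be a homogeneous 2-periodic solution of the modified KP hierarchy on an open $U\subset B_R$, $R>0$. Put $\sigma_n(x)=\tau_n(\boldsymbol x)$ with $x_1=x$, $x_3=-\frac43$, $x_n=0$ $(n\ne1,3)$. Where $\boldsymbol x\in U$ and all $\sigma_n\neq0$, the functions $q=\frac{D\sigma_0\cdot\sigma_1}{\sigma_0\sigma_1}$ and $f_n=\frac x2-\frac{D^2\sigma_{n+1}\cdot\sigma_{n+1}}{\sigma_{n+1}^2}$ satisfy $q'=\frac{f_0-f_1}2$, $f_0'=2f_0q+\frac{\alpha_0}2$, $f_1'=-2f_1q+\frac{\alpha_1}2$, $f_0+f_1-2q^2=x$, and $q$ solves $P_{\rm II}$: $q''=2q^3+xq+\frac{\alpha_0-1}2$. (2) ($P(A_{\ell-1}^{(1)})$.) Let $\ell\ge3$ and let $\tau_n$ be a homogeneous $\ell$-periodic solution of the modified KP hierarchy on an open $U\subset B_R$,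 $R>0$. Put $\sigma_n(x)=\tau_n(\boldsymbol x)$ with $x_1=x$, $x_2=-\frac12$, $x_n=0$ $(n\ge3)$. Where $\boldsymbol x\in U$ and all $\sigma_n\ne0$, the functions $w_n=\frac x2+\frac{D\sigma_n\cdot\sigma_{n+1}}{\sigma_n\sigma_{n+1}}$ satisfy the Darboux chain with period $\ell$ and parameters $\alpha_n$, and $f_n=w_n+w_{n-1}$ satisfy $P(A_{\ell-1}^{(1)})$. (3) ($P_{\rm III}$-chain.) Let $\ell\ge2$, $R>1$, and let $\tau_n$ be a homogeneous $\ell$-periodic solution of the modified KP hierarchy on an open $U\subset B_R$. Put $\sigma_n(a,s)=\tau_n(\boldsymbol x(a,s))$ with $x_1=s+a$, $x_n=a/n$ $(n\ge2)$. Let $a,s\in\mathbb C$ be such that $\boldsymbol x(a-1,s)+[w]$, $\boldsymbol x(a,s)\pm[w]$, $\boldsymbol x(a+1,s)-[w]\in U$ for $|w|\le1$ and $\sigma_n(a,s)\sigma_n(a-1,s)\neq0$ for all $n$. Then $$f_n=\frac{\sigma_{n-1}(a,s)\sigma_n(a-1,s)}{\sigma_{n-1}(a-1,s)\sigma_n(a,s)},\qquad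 g_n=\frac{\sigma_{n-1}(a-1,s)\sigma_n(a+1,s)}{\sigma_{n-1}(a,s)\sigma_n(a,s)}$$ satisfy the $P_{\rm III}$-chain of order $2\ell-2$, indices in $\mathbb Z/\ell\mathbb Z$: $$s\frac{df_n}{ds}=\big(s(f_{n+1}-f_n)+a(g_n-g_{n+1})+\alpha_n-1\big)f_n,\quad\frac{dg_n}{ds}=f_ng_n-f_{n-1}g_{n-1},\quad\prod_{n=1}^\ell f_n=1,\quad\sum_{n=1}^\ell g_n=\ell.$$ (4) ($P(A_{2\ell-1}^{(1)})$.) Let $\ell\ge2$, $R,S>1$, and let $\tau_{m,n}$ be a homogeneous $(\ell,\ell)$-periodic solution of the modified UC hierarchy on an open $W\subset B_R\times B_S$. Put $\sigma_{m,n}(a,s)=\tau_{m,n}(P(a,s))$, where $P(a,s)$ is the point $x_n=s+\frac an$, $y_n=-s+\frac an$. Let $a\in\mathbb C$, $x\in\mathbb C\setminus\{0\}$, $s=-x^2/2$ be such that, for $|w_1|,|w_2|\le1$, the points $P(a-1,s)+([w_1],[w_2])$, $P(a,s)+([w_1],[w_2])$, $P(a+1,s)-([w_1],[w_2])$, $P(a+2,s)-([w_1],[w_2])$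 lie in $W$, and $\sigma_{i,-i}(a,s)\,\sigma_{i+1,-i}(a+1,s)\ne0$ for all $i$. With $D$ taken in $s$, put $$u_{m,n}=\frac{D\sigma_{m,n}(a,s)\cdot\sigma_{m+1,n}(a+1,s)}{\sigma_{m,n}(a,s)\,\sigma_{m+1,n}(a+1,s)},\qquad v_{m,n}=-\frac{D\sigma_{m,n}(a,s)\cdot\sigma_{m,n+1}(a+1,s)}{\sigma_{m,n}(a,s)\,\sigma_{m,n+1}(a+1,s)}.$$ Then, as functions of $x$, $$w_{2i}=-x\,u_{i,-i}-\frac{s+a+\frac12}{x},\qquad w_{2i-1}=-x\,v_{i,-i}-\frac{s-a-\frac12}{x}\qquad(s=-x^2/2)$$ satisfy the Darboux chain with period $2\ell$ and parameters $\alpha_{2i}=2(d_{i+1,-i}-d_{i,-i+1}+a+1)$, $\alpha_{2i-1}=2(d_{i-1,-i+1}-d_{i,-i}-a)$, and $f_n=w_n+w_{n-1}$ satisfy $P(A_{2\ell-1}^{(1)})$. (5) ($P_{\rm VI}$-chain.) Let $\ell\ge2$, $R,S>1$, and let $\tau_{m,n}$ be a homogeneous $(\ell,\ell)$-periodic solution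 of the modified UC hierarchy on an open $W\subset B_R\times B_S$. Put $\sigma_{m,n}(a,b,t)=\tau_{m,n}(P(a,b,t))$, where $P(a,b,t)$ is the point $x_n=\frac{a+bt^n}n$, $y_n=\frac{a+bt^{-n}}n$. Let $a,b,t\in\mathbb C$ with $t\ne0$, $t^\ell\ne1$, $|t|<R$, $|t|^{-1}<S$ be such that $P(a+i,b+j,t)\pm([w_1],[w_2])\in W$ for $i,j\in\{-1,0,1\}$, $|w_1|\le\max(1,|t|)$, $|w_2|\le\max(1,|t|^{-1})$, and $\sigma_{m,n}(a,b,t)$, $\sigma_{m,n}(a+1,b,t)$, $\sigma_{m,n}(a,b+1,t)$ are nonzero for all $m,n$. Write $\overline\sigma,\underline\sigma$ for the shifts $a\mapsto a\pm1$ and $\sigma^{+},\sigma^{-}$ for the shifts $b\mapsto b\pm1$. Then the $(\ell,\ell)$-periodic functions $$f^{(0)}_{m,n}=\frac{\overline\sigma_{m,n-1}\sigma_{m-1,n-1}}{\overline\sigma_{m-1,n}\sigma_{m,n-2}},\quad f^{(1)}_{m,n}=\frac{\sigma^{+}_{m,n-1}\sigma_{m-1,n-1}}{\sigma^{+}_{m-1,n}\sigma_{m,n-2}},\quad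 g^{(0)}_{m,n}=a\frac{\underline\sigma_{m-1,n-1}\overline\sigma_{m,n}}{\sigma_{m-1,n}\sigma_{m,n-1}},\quad g^{(1)}_{m,n}=b\frac{\sigma^{-}_{m-1,n-1}\sigma^{+}_{m,n}}{\sigma_{m-1,n}\sigma_{m,n-1}}$$ satisfy the $P_{\rm VI}$-chain of order $2\ell-2$: $$t\tfrac{d}{dt}f^{(1)}_{m,n}=\big(\alpha_{m,n}-g^{(1)}_{m,n-1}+U^{(0,1)}_{m-1,n}-V^{(0,1)}_{m,n-1}\big)f^{(1)}_{m,n},\qquad t\tfrac{d}{dt}f^{(0)}_{m,n}=\big(-g^{(1)}_{m,n-1}-U^{(1,0)}_{m-1,n}+V^{(1,0)}_{m,n-1}\big)f^{(0)}_{m,n},$$ $$t\tfrac{d}{dt}g^{(1)}_{m,n}=-U^{(1,0)}_{m,n}g^{(0)}_{m,n}-V^{(0,1)}_{m,n}g^{(1)}_{m,n},\qquad t\tfrac{d}{dt}g^{(0)}_{m,n}=U^{(0,1)}_{m,n}g^{(1)}_{m,n}+V^{(1,0)}_{m,n}g^{(0)}_{m,n},$$ with $\alpha_{m,n}=a+b+d_{m,n-1}-d_{m-1,n}=g^{(0)}_{m,n}+g^{(1)}_{m,n}$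 and, for $(t_0,t_1)=(1,t)$, $$U^{(i,j)}_{m,n}=\frac1{(t_i/t_j)^\ell-1}\sum_{\alpha=1}^\ell g^{(i)}_{m-\alpha+1,n+\alpha-1}\prod_{\beta=1}^{\alpha-1}\frac{t_if^{(i)}_{m-\beta+1,n+\beta}}{t_jf^{(j)}_{m-\beta+1,n+\beta}},\qquad V^{(i,j)}_{m,n}=\frac1{(t_i/t_j)^\ell-1}\sum_{\alpha=1}^\ell g^{(i)}_{m-\alpha,n+\alpha}\prod_{\beta=0}^{\alpha-1}\frac{t_if^{(i)}_{m-\beta,n+\beta+1}}{t_jf^{(j)}_{m-\beta,n+\beta+1}};$$ moreover $\prod_{j=1}^\ell f^{(i)}_{m+j,n-j}=1$ $(i=0,1)$, $\sum_{j=1}^\ell g^{(0)}_{m+j,n-j}=\ell a$ and $\sum_{j=1}^\ell g^{(1)}_{m+j,n-j}=\ell b$. -/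

import Mathlib

open Filter Topology

noncomputable section

namespace PainleveReduction

/-! ### Time variables -/

/-- Infinitely many time variables `x = (x₁, x₂, x₃, …)`. -/
abbrev Times := ℕ+ → ℂ

/-- `[w] = (w, w² / 2, w³ / 3, …)`. -/
def bracket (w : ℂ) : Times := fun n => w ^ (n : ℕ) / (n : ℂ)

/-- `ξ(x, k) = ∑ₙ xₙ kⁿ`. -/
def xi (x : Times) (k : ℂ) : ℂ := ∑' n : ℕ+, x n * k ^ (n : ℕ)

/-- The coordinates of the Banach space `B_R` of all sequences `x` such that `R⁻ⁿ |xₙ|` is bounded,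
with norm `sup R⁻ⁿ |xₙ|`: the bounded sequence `v` is sent to `xₙ = Rⁿ vₙ`. -/
def coords (R : ℝ) (v : lp (fun _ : ℕ+ => ℂ) ⊤) : Times := fun n => (R : ℂ) ^ (n : ℕ) * v n

/-- `xₙ = O(ρⁿ)` for some `0 ≤ ρ < R`; equivalently, the radius of convergence of `ξ(x, ·)` is
larger than `1 / R`. -/
def GrowthBelow (R : ℝ) (x : Times) : Prop :=
  ∃ ρ C : ℝ, 0 ≤ ρ ∧ ρ < R ∧ ∀ n : ℕ+, ‖x n‖ ≤ C * ρ ^ (n : ℕ)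

/-- The partial derivative `∂F / ∂xₙ` at `x`. -/
def partialDeriv (n : ℕ+) (F : Times → ℂ) (x : Times) : ℂ :=
  deriv (fun h => F (Function.update x n h)) (x n)

/-- The Hirota derivative `D^k f · g`, that is, `(d/dh)^k f (x + h) g (x - h)` at `h = 0`. -/
def hirota (k : ℕ) (f g : ℂ → ℂ) (x : ℂ) : ℂ :=
  iteratedDeriv k (fun h => f (x + h) * g (x - h)) 0

/-! ### The modified KP hierarchy -/

/-- `U` is an open subset of `B_R`. -/
def IsDomain (R : ℝ) (U : Set Times) : Prop :=
  U ⊆ Set.range (coords R) ∧ IsOpen (coords R ⁻¹' U)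

/-- `F` is holomorphic on the open subset `U` of `B_R`. -/
def IsHolomorphic (R : ℝ) (U : Set Times) (F : Times → ℂ) : Prop :=
  AnalyticOnNhd ℂ (fun v => F (coords R v)) (coords R ⁻¹' U)

/-- The modified KP hierarchy on `U`, i.e. `∑_{i + j = -2} X⁻ᵢ τₙ ⊗ X⁺ⱼ τₙ₊₁ = 0`, written as
`∮ z e^{ξ(x - y, z)} τₙ(y + [z⁻¹]) τₙ₊₁(x - [z⁻¹]) dz = 0`.  Here `x`, `y` and the circle `|z| = r`
are arbitrary such that the expansions of the vertex operators converge on the circle: `ξ(x - y, ·)`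
converges on a neighbourhood of `|z| ≤ r`, and the expansions in powers of `w = z⁻¹` take place in
`U`. -/
def IsModifiedKP (R : ℝ) (U : Set Times) (τ : ℤ → Times → ℂ) : Prop :=
  ∀ (n : ℤ) (x y : Times) (r : ℝ), 0 < r → r⁻¹ < R → GrowthBelow r⁻¹ (x - y) →
    (∀ w : ℂ, ‖w‖ ≤ r⁻¹ → y + bracket w ∈ U ∧ x - bracket w ∈ U) →
    (∮ z in C(0, r), z * Complex.exp (xi (x - y) z) *
      τ n (y + bracket z⁻¹) * τ (n + 1) (x - bracket z⁻¹)) = 0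

/-- `E F = d F` on `U`, with the Euler operator `E = ∑ₙ n xₙ ∂/∂xₙ`.  (The series is considered at
the points where `n xₙ` is again the sequence of coordinates of a vector of `B_R`.) -/
def IsHomogeneous (R : ℝ) (U : Set Times) (F : Times → ℂ) (d : ℂ) : Prop :=
  ∀ x ∈ U, GrowthBelow R x →
    HasSum (fun n : ℕ+ => (n : ℂ) * x n * partialDeriv n F x) (d * F x)

/-- A holomorphic solution on `U` of the modified KP hierarchy that is homogeneous and
`ℓ`-periodic. -/
structure IsKPSimilarity (ℓ : ℕ) (R : ℝ) (U : Set Times) (τ : ℤ → Times → ℂ) (d : ℤ → ℂ) :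
    Prop where
  pos : 0 < R
  domain : IsDomain R U
  holomorphic : ∀ n, IsHolomorphic R U (τ n)
  hierarchy : IsModifiedKP R U τ
  homogeneous : ∀ n, IsHomogeneous R U (τ n) (d n)
  periodic : ∀ n, ∀ x ∈ U, τ (n + ℓ) x = τ n x

/-- `αₙ = dₙ₋₁ - 2 dₙ + dₙ₊₁ + 1`. -/
def rootKP (d : ℤ → ℂ) (n : ℤ) : ℂ := d (n - 1) - 2 * d n + d (n + 1) + 1

/-! ### The modified UC hierarchy -/

/-- Two sets of time variables `(x, y)`. -/
abbrev Times₂ := Times × Times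

/-- `([w₁], [w₂])`. -/
def bracket₂ (w₁ w₂ : ℂ) : Times₂ := (bracket w₁, bracket w₂)

/-- The coordinates of `B_R × B_S`. -/
def coords₂ (R S : ℝ) (p : lp (fun _ : ℕ+ => ℂ) ⊤ × lp (fun _ : ℕ+ => ℂ) ⊤) : Times₂ :=
  (coords R p.1, coords S p.2)

/-- `W` is an open subset of `B_R × B_S`. -/
def IsDomain₂ (R S : ℝ) (W : Set Times₂) : Prop :=
  W ⊆ Set.range (coords₂ R S) ∧ IsOpen (coords₂ R S ⁻¹' W)

/-- `F` is holomorphic on the open subset `W` of `B_R × B_S`. -/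
def IsHolomorphic₂ (R S : ℝ) (W : Set Times₂) (F : Times₂ → ℂ) : Prop :=
  AnalyticOnNhd ℂ (fun p => F (coords₂ R S p)) (coords₂ R S ⁻¹' W)

/-- `∑_{i + j = -1 - p} X⁻ᵢ F ⊗ X⁺ⱼ G` at `P = (x, y)` (second factor) and `Q = (x', y')` (first
factor), as `(2πi)⁻¹ ∮ z^p e^{ξ(x - x', z)} F(x' + [z⁻¹], y' + [z]) G(x - [z⁻¹], y - [z]) dz` over
`|z| = r`. -/
def bilinearX (p : ℤ) (F G : Times₂ → ℂ) (P Q : Times₂) (r : ℝ) : ℂ :=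
  (2 * Real.pi * Complex.I)⁻¹ * ∮ z in C(0, r), z ^ p * Complex.exp (xi (P.1 - Q.1) z) *
    F (Q + bracket₂ z⁻¹ z) * G (P - bracket₂ z⁻¹ z)

/-- `∑_{i + j = -1 - p} Y⁻ᵢ F ⊗ Y⁺ⱼ G` at `P = (x, y)` (second factor) and `Q = (x', y')` (first
factor), as `(2πi)⁻¹ ∮ w^p e^{ξ(y - y', w)} F(x' + [w], y' + [w⁻¹]) G(x - [w], y - [w⁻¹]) dw` over
`|w| = r`. -/
def bilinearY (p : ℤ) (F G : Times₂ → ℂ) (P Q : Times₂) (r : ℝ) : ℂ :=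
  (2 * Real.pi * Complex.I)⁻¹ * ∮ w in C(0, r), w ^ p * Complex.exp (xi (P.2 - Q.2) w) *
    F (Q + bracket₂ w w⁻¹) * G (P - bracket₂ w w⁻¹)

/-- The expansions of the vertex operators `X^±(z)` in `bilinearX` converge on `|z| = r`. -/
def AdmissibleX (R S : ℝ) (W : Set Times₂) (P Q : Times₂) (r : ℝ) : Prop :=
  0 < r ∧ r⁻¹ < R ∧ r < S ∧ GrowthBelow r⁻¹ (P.1 - Q.1) ∧
    ∀ w₁ w₂ : ℂ, ‖w₁‖ ≤ r⁻¹ → ‖w₂‖ ≤ r → Q + bracket₂ w₁ w₂ ∈ W ∧ P - bracket₂ w₁ w₂ ∈ W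

/-- The expansions of the vertex operators `Y^±(w)` in `bilinearY` converge on `|w| = r`. -/
def AdmissibleY (R S : ℝ) (W : Set Times₂) (P Q : Times₂) (r : ℝ) : Prop :=
  0 < r ∧ r < R ∧ r⁻¹ < S ∧ GrowthBelow r⁻¹ (P.2 - Q.2) ∧
    ∀ w₁ w₂ : ℂ, ‖w₁‖ ≤ r → ‖w₂‖ ≤ r⁻¹ → Q + bracket₂ w₁ w₂ ∈ W ∧ P - bracket₂ w₁ w₂ ∈ W

/-- The bilinear equations of the modified UC hierarchy on `W`:
`∑_{i + j = -2} X⁻ᵢ τₘₙ ⊗ X⁺ⱼ τₘ₊₁,ₙ = ∑_{i + j = -1} Y⁻ᵢ τₘₙ ⊗ Y⁺ⱼ τₘ₊₁,ₙ = 0` and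
`τₘₙ ⊗ τₘ₊₁,ₙ₊₁ - ∑_{i + j = 0} X⁻ᵢ τₘ₊₁,ₙ ⊗ X⁺ⱼ τₘ,ₙ₊₁ = ∑_{i + j = -2} Y⁻ᵢ τₘ₊₁,ₙ ⊗ Y⁺ⱼ τₘ,ₙ₊₁
= 0`. -/
structure IsModifiedUC (R S : ℝ) (W : Set Times₂) (τ : ℤ → ℤ → Times₂ → ℂ) : Prop where
  eqX₁ : ∀ m n P Q r, AdmissibleX R S W P Q r → bilinearX 1 (τ m n) (τ (m + 1) n) P Q r = 0
  eqY₁ : ∀ m n P Q r, AdmissibleY R S W P Q r → bilinearY 0 (τ m n) (τ (m + 1) n) P Q r = 0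
  eqX₂ : ∀ m n P Q r, AdmissibleX R S W P Q r →
    τ m n Q * τ (m + 1) (n + 1) P - bilinearX (-1) (τ (m + 1) n) (τ m (n + 1)) P Q r = 0
  eqY₂ : ∀ m n P Q r, AdmissibleY R S W P Q r →
    bilinearY 1 (τ (m + 1) n) (τ m (n + 1)) P Q r = 0

/-- `E F = d F` on `W`, with `E = ∑ₙ (n xₙ ∂/∂xₙ - n yₙ ∂/∂yₙ)`. -/
def IsHomogeneous₂ (R S : ℝ) (W : Set Times₂) (F : Times₂ → ℂ) (d : ℂ) : Prop :=
  ∀ P ∈ W, GrowthBelow R P.1 → GrowthBelow S P.2 →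
    HasSum (fun n : ℕ+ => (n : ℂ) * P.1 n * partialDeriv n (fun x => F (x, P.2)) P.1 -
      (n : ℂ) * P.2 n * partialDeriv n (fun y => F (P.1, y)) P.2) (d * F P)

/-- A holomorphic solution on `W` of the modified UC hierarchy that is homogeneous and
`(ℓ, ℓ)`-periodic. -/
structure IsUCSimilarity (ℓ : ℕ) (R S : ℝ) (W : Set Times₂) (τ : ℤ → ℤ → Times₂ → ℂ)
    (d : ℤ → ℤ → ℂ) : Prop where
  posR : 0 < R
  posS : 0 < S
  domain : IsDomain₂ R S W
  holomorphic : ∀ m n, IsHolomorphic₂ R S W (τ m n)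
  hierarchy : IsModifiedUC R S W τ
  homogeneous : ∀ m n, IsHomogeneous₂ R S W (τ m n) (d m n)
  periodic₁ : ∀ m n, ∀ P ∈ W, τ (m + ℓ) n P = τ m n P
  periodic₂ : ∀ m n, ∀ P ∈ W, τ m (n + ℓ) P = τ m n P

/-! ### The second Painlevé equation -/

/-- The specialization `x₁ = x`, `x₃ = -4/3`, and `xₙ = 0` otherwise. -/
def timesII (x : ℂ) : Times := fun n => if n = 1 then x else if n = 3 then -4 / 3 else 0

/-- `q = (D σ₀ · σ₁) / (σ₀ σ₁)`. -/
def qII (σ : ℤ → ℂ → ℂ) (x : ℂ) : ℂ := hirota 1 (σ 0) (σ 1) x / (σ 0 x * σ 1 x)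

/-- `fₙ = x / 2 - (D² σₙ₊₁ · σₙ₊₁) / σₙ₊₁²`. -/
def fII (σ : ℤ → ℂ → ℂ) (n : ℤ) (x : ℂ) : ℂ :=
  x / 2 - hirota 2 (σ (n + 1)) (σ (n + 1)) x / σ (n + 1) x ^ 2

/-- The symmetric form of the second Painlevé equation, at the point `x`. -/
def IsSymmetricPIIAt (α : ℤ → ℂ) (q : ℂ → ℂ) (f : ℤ → ℂ → ℂ) (x : ℂ) : Prop :=
  HasDerivAt q ((f 0 x - f 1 x) / 2) x ∧
  HasDerivAt (f 0) (2 * f 0 x * q x + α 0 / 2) x ∧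
  HasDerivAt (f 1) (-2 * f 1 x * q x + α 1 / 2) x ∧
  f 0 x + f 1 x - 2 * q x ^ 2 = x

/-- The second Painlevé equation `q'' = 2 q³ + x q + c`, at the point `x`. -/
def IsPIIAt (c : ℂ) (q : ℂ → ℂ) (x : ℂ) : Prop :=
  ∃ q₁ : ℂ → ℂ, (∀ᶠ y in 𝓝 x, HasDerivAt q (q₁ y) y) ∧
    HasDerivAt q₁ (2 * q x ^ 3 + x * q x + c) x

/-! ### Darboux chains and the higher order Painlevé equations of type `A` -/

/-- The Darboux chain with period `N`,
`(wₙ + wₙ₋₁)' = wₙ² - wₙ₋₁² + αₙ` (`n ∈ ℤ/Nℤ`), at the point `x`, normalized by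
`∑ αₙ = N` and `∑ wₙ = N x / 2`. -/
def IsDarbouxChainAt (N : ℕ) (α : ℤ → ℂ) (w : ℤ → ℂ → ℂ) (x : ℂ) : Prop :=
  (∀ n, α (n + N) = α n) ∧ (∀ n, w (n + N) x = w n x) ∧
  (∑ n ∈ Finset.range N, α n = N) ∧ (∑ n ∈ Finset.range N, w n x = N * x / 2) ∧
  (∀ n, DifferentiableAt ℂ (w n) x) ∧
  ∀ n, HasDerivAt (fun y => w n y + w (n - 1) y) (w n x ^ 2 - w (n - 1) x ^ 2 + α n) x

/-- The higher order Painlevé equation of type `A_{N-1}^{(1)}` (`N ≥ 3`), at the point `x`; the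
first clause is the case `N = 2 g + 1`, the second one the case `N = 2 g + 2`. -/
def IsPAAt (N : ℕ) (α : ℤ → ℂ) (f : ℤ → ℂ → ℂ) (x : ℂ) : Prop :=
  (∀ g : ℕ, 1 ≤ g → N = 2 * g + 1 → ∀ n : ℤ,
    HasDerivAt (f n)
      (f n x * (∑ i ∈ Finset.Icc 1 g, f (n + 2 * i - 1) x -
        ∑ i ∈ Finset.Icc 1 g, f (n + 2 * i) x) + α n) x) ∧
  (∀ g : ℕ, 1 ≤ g → N = 2 * g + 2 → ∀ n : ℤ, ∃ f₁ : ℂ, HasDerivAt (f n) f₁ x ∧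
    N * x / 2 * f₁ =
      f n x * (∑ i ∈ Finset.Icc 1 g, ∑ j ∈ Finset.Icc i g,
          f (n + 2 * i - 1) x * f (n + 2 * j) x -
        ∑ i ∈ Finset.Icc 1 g, ∑ j ∈ Finset.Icc i g,
          f (n + 2 * i) x * f (n + 2 * j + 1) x) +
      (N / 2 - ∑ i ∈ Finset.Icc 1 g, α (n + 2 * i)) * f n x +
      α n * ∑ i ∈ Finset.Icc 1 g, f (n + 2 * i) x)

/-- The specialization `x₁ = x`, `x₂ = -1/2`, and `xₙ = 0` for `n ≥ 3`. -/
def timesA (x : ℂ) : Times := fun n => if n = 1 then x else if n = 2 then -1 / 2 else 0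

/-- `wₙ = x / 2 + (D σₙ · σₙ₊₁) / (σₙ σₙ₊₁)`. -/
def wKP (σ : ℤ → ℂ → ℂ) (n : ℤ) (x : ℂ) : ℂ :=
  x / 2 + hirota 1 (σ n) (σ (n + 1)) x / (σ n x * σ (n + 1) x)

/-- The specialization `xₙ = s + a / n`, `yₙ = -s + a / n`. -/
def timesV (a s : ℂ) : Times₂ := (fun n => s + a / (n : ℂ), fun n => -s + a / (n : ℂ))

/-- `uₘₙ = (D σₘₙ(a) · σₘ₊₁,ₙ(a + 1)) / (σₘₙ(a) σₘ₊₁,ₙ(a + 1))`, where `σₘₙ = σₘₙ(a, s)` and `D` is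
with respect to `s`. -/
def uV (σ : ℤ → ℤ → ℂ → ℂ → ℂ) (a : ℂ) (m n : ℤ) (s : ℂ) : ℂ :=
  hirota 1 (σ m n a) (σ (m + 1) n (a + 1)) s / (σ m n a s * σ (m + 1) n (a + 1) s)

/-- `vₘₙ = -(D σₘₙ(a) · σₘ,ₙ₊₁(a + 1)) / (σₘₙ(a) σₘ,ₙ₊₁(a + 1))`. -/
def vV (σ : ℤ → ℤ → ℂ → ℂ → ℂ) (a : ℂ) (m n : ℤ) (s : ℂ) : ℂ :=
  -(hirota 1 (σ m n a) (σ m (n + 1) (a + 1)) s / (σ m n a s * σ m (n + 1) (a + 1) s))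

/-- With `s = -x² / 2` (so that `x = -√(-2s)`):
`w_{2i} = √(-2s) u_{i,-i} + (s + a + 1/2) / √(-2s)` and
`w_{2i-1} = √(-2s) v_{i,-i} + (s - a - 1/2) / √(-2s)`.  Note `(k + 1) / 2 = i` for both
`k = 2i` and `k = 2i - 1`. -/
def wUC (σ : ℤ → ℤ → ℂ → ℂ → ℂ) (a : ℂ) (k : ℤ) (x : ℂ) : ℂ :=
  if Even k then
    -x * uV σ a ((k + 1) / 2) (-((k + 1) / 2)) (-x ^ 2 / 2) + (-x ^ 2 / 2 + a + 1 / 2) / (-x)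
  else
    -x * vV σ a ((k + 1) / 2) (-((k + 1) / 2)) (-x ^ 2 / 2) + (-x ^ 2 / 2 - a - 1 / 2) / (-x)

/-- `α_{2i} = 2 (d_{i+1,-i} - d_{i,-i+1} + a + 1)` and
`α_{2i-1} = 2 (d_{i-1,-i+1} - d_{i,-i} - a)`. -/
def rootUC (d : ℤ → ℤ → ℂ) (a : ℂ) (k : ℤ) : ℂ :=
  if Even k then
    2 * (d ((k + 1) / 2 + 1) (-((k + 1) / 2)) - d ((k + 1) / 2) (-((k + 1) / 2) + 1) + a + 1)
  else
    2 * (d ((k + 1) / 2 - 1) (-((k + 1) / 2) + 1) - d ((k + 1) / 2) (-((k + 1) / 2)) - a)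

/-! ### The `P_III`-chain -/

/-- The specialization `x₁ = s + a`, `xₙ = a / n` for `n ≥ 2`. -/
def timesIII (a s : ℂ) : Times := fun n => (if n = 1 then s else 0) + a / (n : ℂ)

/-- `fₙ = σₙ₋₁(a) σₙ(a - 1) / (σₙ₋₁(a - 1) σₙ(a))`, where `σₙ = σₙ(a, s)`. -/
def fIII (σ : ℤ → ℂ → ℂ → ℂ) (a : ℂ) (n : ℤ) (s : ℂ) : ℂ :=
  σ (n - 1) a s * σ n (a - 1) s / (σ (n - 1) (a - 1) s * σ n a s)

/-- `gₙ = σₙ₋₁(a - 1) σₙ(a + 1) / (σₙ₋₁(a) σₙ(a))`. -/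
def gIII (σ : ℤ → ℂ → ℂ → ℂ) (a : ℂ) (n : ℤ) (s : ℂ) : ℂ :=
  σ (n - 1) (a - 1) s * σ n (a + 1) s / (σ (n - 1) a s * σ n a s)

/-- The `P_III`-chain of order `2 ℓ - 2` at the point `s`: the system of `2 ℓ` differential
equations together with the values `∏ fₙ = 1` and `∑ gₙ = ℓ` of its two conserved quantities. -/
def IsPIIIChainAt (ℓ : ℕ) (a : ℂ) (α : ℤ → ℂ) (f g : ℤ → ℂ → ℂ) (s : ℂ) : Prop :=
  (∀ n, α (n + ℓ) = α n) ∧ (∀ n, f (n + ℓ) s = f n s) ∧ (∀ n, g (n + ℓ) s = g n s) ∧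
  (∏ n ∈ Finset.Icc 1 ℓ, f n s = 1) ∧ (∑ n ∈ Finset.Icc 1 ℓ, g n s = ℓ) ∧
  (∀ n, ∃ f₁ : ℂ, HasDerivAt (f n) f₁ s ∧
    s * f₁ = (s * (f (n + 1) s - f n s) + a * (g n s - g (n + 1) s) + α n - 1) * f n s) ∧
  (∀ n, HasDerivAt (g n) (f n s * g n s - f (n - 1) s * g (n - 1) s) s)

/-! ### The `P_VI`-chain -/

/-- The specialization `xₙ = (a + b tⁿ) / n`, `yₙ = (a + b t⁻ⁿ) / n`. -/
def timesVI (a b t : ℂ) : Times₂ :=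
  (fun n => (a + b * t ^ (n : ℕ)) / (n : ℂ), fun n => (a + b * t⁻¹ ^ (n : ℕ)) / (n : ℂ))

section
variable (σ : ℤ → ℤ → ℂ → ℂ → ℂ → ℂ) (a b : ℂ) (m n : ℤ) (t : ℂ)

/-- `f⁽⁰⁾ₘₙ = σₘ,ₙ₋₁(a + 1, b) σₘ₋₁,ₙ₋₁(a, b) / (σₘ₋₁,ₙ(a + 1, b) σₘ,ₙ₋₂(a, b))`, where
`σₘₙ = σₘₙ(a, b, t)`. -/
def fVI₀ : ℂ :=
  σ m (n - 1) (a + 1) b t * σ (m - 1) (n - 1) a b t / (σ (m - 1) n (a + 1) b t * σ m (n - 2) a b t)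

/-- `f⁽¹⁾ₘₙ = σₘ,ₙ₋₁(a, b + 1) σₘ₋₁,ₙ₋₁(a, b) / (σₘ₋₁,ₙ(a, b + 1) σₘ,ₙ₋₂(a, b))`. -/
def fVI₁ : ℂ :=
  σ m (n - 1) a (b + 1) t * σ (m - 1) (n - 1) a b t / (σ (m - 1) n a (b + 1) t * σ m (n - 2) a b t)

/-- `g⁽⁰⁾ₘₙ = a σₘ₋₁,ₙ₋₁(a - 1, b) σₘₙ(a + 1, b) / (σₘ₋₁,ₙ(a, b) σₘ,ₙ₋₁(a, b))`. -/
def gVI₀ : ℂ :=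
  a * (σ (m - 1) (n - 1) (a - 1) b t * σ m n (a + 1) b t / (σ (m - 1) n a b t * σ m (n - 1) a b t))

/-- `g⁽¹⁾ₘₙ = b σₘ₋₁,ₙ₋₁(a, b - 1) σₘₙ(a, b + 1) / (σₘ₋₁,ₙ(a, b) σₘ,ₙ₋₁(a, b))`. -/
def gVI₁ : ℂ :=
  b * (σ (m - 1) (n - 1) a (b - 1) t * σ m n a (b + 1) t / (σ (m - 1) n a b t * σ m (n - 1) a b t))

end

/-- The coefficient `U⁽ⁱʲ⁾ₘₙ` of the `P_VI`-chain as a function of the dependent variables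
`F = f⁽ⁱ⁾`, `F' = f⁽ʲ⁾`, `G = g⁽ⁱ⁾`, with `q = tᵢ / tⱼ`. -/
def coeffU (ℓ : ℕ) (q : ℂ) (F F' G : ℤ → ℤ → ℂ) (m n : ℤ) : ℂ :=
  1 / (q ^ ℓ - 1) * ∑ α ∈ Finset.Icc 1 ℓ, G (m - α + 1) (n + α - 1) *
    ∏ β ∈ Finset.Icc 1 (α - 1), q * F (m - β + 1) (n + β) / F' (m - β + 1) (n + β)

/-- The coefficient `V⁽ⁱʲ⁾ₘₙ` of the `P_VI`-chain. -/
def coeffV (ℓ : ℕ) (q : ℂ) (F F' G : ℤ → ℤ → ℂ) (m n : ℤ) : ℂ :=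
  1 / (q ^ ℓ - 1) * ∑ α ∈ Finset.Icc 1 ℓ, G (m - α) (n + α) *
    ∏ β ∈ Finset.range α, q * F (m - β) (n + β + 1) / F' (m - β) (n + β + 1)

/-- The `P_VI`-chain of order `2 ℓ - 2` at the point `t`, with `(t₀, t₁) = (1, t)`: the differential
equations for `f⁽⁰⁾`, `f⁽¹⁾`, `g⁽⁰⁾`, `g⁽¹⁾` together with the values of the conserved quantities
`∏ f⁽ⁱ⁾`, `∑ g⁽ⁱ⁾` along every antidiagonal of indices and `g⁽⁰⁾ + g⁽¹⁾ = α`. -/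
def IsPVIChainAt (ℓ : ℕ) (a b : ℂ) (α : ℤ → ℤ → ℂ) (f₀ f₁ g₀ g₁ : ℤ → ℤ → ℂ → ℂ) (t : ℂ) : Prop :=
  (∀ h ∈ ({f₀, f₁, g₀, g₁} : Set (ℤ → ℤ → ℂ → ℂ)), ∀ m n,
    h (m + ℓ) n t = h m n t ∧ h m (n + ℓ) t = h m n t) ∧
  (∀ m n, α (m + ℓ) n = α m n ∧ α m (n + ℓ) = α m n) ∧
  (∀ m n, ∏ j ∈ Finset.Icc 1 ℓ, f₀ (m + j) (n - j) t = 1) ∧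
  (∀ m n, ∏ j ∈ Finset.Icc 1 ℓ, f₁ (m + j) (n - j) t = 1) ∧
  (∀ m n, ∑ j ∈ Finset.Icc 1 ℓ, g₀ (m + j) (n - j) t = ℓ * a) ∧
  (∀ m n, ∑ j ∈ Finset.Icc 1 ℓ, g₁ (m + j) (n - j) t = ℓ * b) ∧
  (∀ m n, g₀ m n t + g₁ m n t = α m n) ∧
  ∃ U₀₁ U₁₀ V₀₁ V₁₀ : ℤ → ℤ → ℂ,
    U₀₁ = coeffU ℓ (1 / t) (f₀ · · t) (f₁ · · t) (g₀ · · t) ∧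
    U₁₀ = coeffU ℓ t (f₁ · · t) (f₀ · · t) (g₁ · · t) ∧
    V₀₁ = coeffV ℓ (1 / t) (f₀ · · t) (f₁ · · t) (g₀ · · t) ∧
    V₁₀ = coeffV ℓ t (f₁ · · t) (f₀ · · t) (g₁ · · t) ∧
    (∀ m n, ∃ D : ℂ, HasDerivAt (f₁ m n) D t ∧
      t * D = (α m n - g₁ m (n - 1) t + U₀₁ (m - 1) n - V₀₁ m (n - 1)) * f₁ m n t) ∧
    (∀ m n, ∃ D : ℂ, HasDerivAt (f₀ m n) D t ∧
      t * D = (-g₁ m (n - 1) t - U₁₀ (m - 1) n + V₁₀ m (n - 1)) * f₀ m n t) ∧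
    (∀ m n, ∃ D : ℂ, HasDerivAt (g₁ m n) D t ∧
      t * D = -U₁₀ m n * g₀ m n t - V₀₁ m n * g₁ m n t) ∧
    (∀ m n, ∃ D : ℂ, HasDerivAt (g₀ m n) D t ∧
      t * D = U₀₁ m n * g₁ m n t + V₁₀ m n * g₀ m n t)

end PainleveReduction

end

/-!
The bilinear identities of the two hierarchies are contour integrals over a circle `|z| = r` whose
integrand contains `e^{ξ(x - x', z)}`. If the difference of the arguments is a sum of two or three
brackets `[p]`, this exponential is a product of factors `(1 - p z)⁻¹`, and the residue theorem turns
the identity into a discrete equation of Hirota–Miwa type: `hirotaMiwa_KP` for the modified KP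
hierarchy, `hirotaMiwa_UC_diagonal` and `hirotaMiwa_UC_row` for the modified UC hierarchy. In the
latter case neither integral can be evaluated alone, because the tau functions are evaluated at
`([w], [w⁻¹])` and are only known to be holomorphic on an annulus; but the substitution `w = z⁻¹`
makes the integrands of the `X`- and the `Y`-equation proportional, and Cauchy's formula in the
annulus evaluates the difference (`annulus_cauchy`).

The discrete equations are differentiated. By a tube lemma (`discIn_eventually`,
`polydiscIn_eventually`) they hold near every admissible point and choice of parameters, and since
the curve `w ↦ [w]` is holomorphic with values in the Banach space, the parameters may be expanded
at `0` or made to coincide. This gives the differential and differential-difference bilinear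
equations on which everything rests: `weight_two_three`, `firstOrder_KP` and `diagonal_derivative_KP`
for the modified KP hierarchy, `diagonal_derivative_UC` and `IsUCSimilarity.bilinear_VI_row` for the
modified UC hierarchy.

Homogeneity says that the derivative of a tau function along the Euler vector field is a multiple of
the function (`IsHomogeneous.fderiv_euler`, `IsHomogeneous₂.fderiv_euler`). On each specialization of
the times the Euler vector field is a combination of the direction of the independent variable and
one further direction, namely that of `x₂`, that of `x₃`, or a derivative of the curve `w ↦ [w]` or
`w ↦ ([w], [w⁻¹])`. The same direction occurs in the bilinear equations, and eliminating it leaves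
ordinary differential equations in the independent variable. They are the equations asserted, written
in terms of logarithmic derivatives of tau functions: `darbouxChain_of_bilinear`,
`symmetricPII_of_bilinear`, `pIIIChain_of_bilinear`, `darbouxChain_of_bilinear₂` and
`pVIChain_of_bilinear`. Conserved quantities are telescoping sums and products over a period.

Finally, the equation of type `A_{N-1}^{(1)}` follows from the Darboux chain of period `N` by algebra
(`isPAAt_of_darbouxChain`), and the coefficients `U`, `V` of the `P_VI`-chain, which are sums of
products over a period, are identified with ratios of tau functions because both solve the same first
order recurrence with periodic solutions (`coeffU_eq`, `coeffU_eq_tau`).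
-/

noncomputable section

namespace PainleveReduction

/-! ### The sequence space -/

section

/-- The Banach space of bounded sequences, which `coords R` identifies with `B_R`. -/
abbrev BddSeq := lp (fun _ : ℕ+ => ℂ) ⊤

theorem coords_apply (R : ℝ) (v : BddSeq) (n : ℕ+) : coords R v n = (R : ℂ) ^ (n : ℕ) * v n := rfl

theorem coords_add (R : ℝ) (u v : BddSeq) : coords R (u + v) = coords R u + coords R v := by
  ext n; simp [coords, mul_add]

theorem coords_sub (R : ℝ) (u v : BddSeq) : coords R (u - v) = coords R u - coords R v := by
  ext n; simp [coords, mul_sub]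

theorem coords_smul (R : ℝ) (c : ℂ) (v : BddSeq) : coords R (c • v) = c • coords R v := by
  ext n; simp [coords, mul_left_comm]

theorem coords_injective {R : ℝ} (hR : 0 < R) : Function.Injective (coords R) := by
  intro u v h
  ext n
  have h1 := congrFun h n
  have hR' : (R : ℂ) ^ (n : ℕ) ≠ 0 := pow_ne_zero _ (by exact_mod_cast hR.ne')
  exact mul_left_cancel₀ hR' h1

/-- The element of the sequence space with coordinates `x`; meaningful if `GrowthBelow R x`. -/
def vec (R : ℝ) (x : Times) : BddSeq :=
  ∑' n : ℕ+, lp.single ⊤ n (x n / (R : ℂ) ^ (n : ℕ))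

theorem summable_pnat_geometric {q : ℝ} (h0 : 0 ≤ q) (h1 : q < 1) :
    Summable fun n : ℕ+ => q ^ (n : ℕ) :=
  (summable_geometric_of_lt_one h0 h1).comp_injective PNat.coe_injective

theorem norm_div_pow_le {R ρ C : ℝ} {x : Times} (hR : 0 < R)
    (h : ∀ n : ℕ+, ‖x n‖ ≤ C * ρ ^ (n : ℕ)) (n : ℕ+) :
    ‖x n / (R : ℂ) ^ (n : ℕ)‖ ≤ C * (ρ / R) ^ (n : ℕ) := by
  rw [norm_div, norm_pow, Complex.norm_real, Real.norm_of_nonneg hR.le, div_pow, ← mul_div_assoc]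
  gcongr
  exact h n

/-- The finitely supported sequences approximate a sequence of growth below `R` in the norm; this is
what turns the series in the definition of homogeneity into a Fréchet derivative. -/
theorem hasSum_vec {R : ℝ} (hR : 0 < R) {x : Times} (hx : GrowthBelow R x) :
    HasSum (fun n : ℕ+ => (lp.single ⊤ n (x n / (R : ℂ) ^ (n : ℕ)) : BddSeq)) (vec R x) := by
  obtain ⟨ρ, C, h0, h1, h⟩ := hx
  refine Summable.hasSum (Summable.of_norm_bounded (g := fun n : ℕ+ => C * (ρ / R) ^ (n : ℕ))
    ((summable_pnat_geometric (by positivity) ((div_lt_one hR).2 h1)).mul_left C) fun n => ?_)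
  rw [lp.norm_single (by simp)]
  exact norm_div_pow_le hR h n

/-- The `n`-th coordinate as a continuous linear functional. -/
def coordCLM (R : ℝ) (n : ℕ+) : BddSeq →L[ℂ] ℂ :=
  ((R : ℂ) ^ (n : ℕ)) • lp.evalCLM ℂ (fun _ : ℕ+ => ℂ) ⊤ n

theorem coordCLM_apply (R : ℝ) (n : ℕ+) (v : BddSeq) : coordCLM R n v = coords R v n := rfl

theorem coords_single {R : ℝ} (hR : 0 < R) (n : ℕ+) (a : ℂ) :
    coords R (lp.single ⊤ n (a / (R : ℂ) ^ (n : ℕ)) : BddSeq) = Pi.single n a := by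
  have hR' : (R : ℂ) ≠ 0 := by exact_mod_cast hR.ne'
  ext k
  rw [coords_apply, lp.single_apply]
  by_cases hk : k = n
  · subst hk; simp; field_simp
  · simp [hk]

/-- Every sequence of growth below `R` is the sequence of coordinates of a vector of the space. -/
theorem coords_vec {R : ℝ} (hR : 0 < R) {x : Times} (hx : GrowthBelow R x) :
    coords R (vec R x) = x := by
  ext n
  have h := (coordCLM R n).hasSum (hasSum_vec hR hx)
  simp only [coordCLM_apply, coords_single hR] at h
  refine h.unique ?_
  have := hasSum_single (f := fun k : ℕ+ => (Pi.single k (x k) : Times) n) n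
    (fun k hk => Pi.single_eq_of_ne (Ne.symm hk) _)
  simpa using this

theorem eq_vec {R : ℝ} (hR : 0 < R) {x : Times} (hx : GrowthBelow R x) {v : BddSeq}
    (h : coords R v = x) : v = vec R x :=
  coords_injective hR (by rw [h, coords_vec hR hx])

theorem GrowthBelow.add {R : ℝ} {x y : Times} (hx : GrowthBelow R x) (hy : GrowthBelow R y) :
    GrowthBelow R (x + y) := by
  obtain ⟨ρ, C, h0, h1, h⟩ := hx
  obtain ⟨ρ', C', h0', h1', h'⟩ := hy
  refine ⟨max ρ ρ', |C| + |C'|, le_max_of_le_left h0, max_lt h1 h1', fun n => ?_⟩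
  rw [add_mul]
  refine (norm_add_le _ _).trans (add_le_add ((h n).trans ?_) ((h' n).trans ?_))
  · gcongr; exacts [le_abs_self C, le_max_left _ _]
  · gcongr; exacts [le_abs_self C', le_max_right _ _]

theorem GrowthBelow.smul {R : ℝ} {x : Times} (hx : GrowthBelow R x) (c : ℂ) :
    GrowthBelow R (c • x) := by
  obtain ⟨ρ, C, h0, h1, h⟩ := hx
  refine ⟨ρ, ‖c‖ * C, h0, h1, fun n => ?_⟩
  rw [Pi.smul_apply, smul_eq_mul, norm_mul, mul_assoc]
  gcongr; exact h n

theorem growthBelow_pow {R : ℝ} {w : ℂ} (hw : ‖w‖ < R) : GrowthBelow R fun n : ℕ+ => w ^ (n : ℕ) :=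
  ⟨‖w‖, 1, norm_nonneg _, hw, fun n => by simp⟩

theorem growthBelow_bracket {R : ℝ} {w : ℂ} (hw : ‖w‖ < R) : GrowthBelow R (bracket w) := by
  refine ⟨‖w‖, 1, norm_nonneg _, hw, fun n => ?_⟩
  have : (1 : ℝ) ≤ n := by exact_mod_cast n.pos
  rw [bracket, norm_div, norm_pow, Complex.norm_natCast, one_mul]
  exact div_le_self (by positivity) this

/-- The Euler operator acts on sequences by `xₙ ↦ n xₙ`. -/
theorem GrowthBelow.euler {R : ℝ} {x : Times} (hx : GrowthBelow R x) :
    GrowthBelow R fun n => (n : ℂ) * x n := by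
  obtain ⟨ρ, C, h0, h1, h⟩ := hx
  obtain ⟨ρ', h2, h3⟩ := exists_between h1
  have hρ' : 0 < ρ' := h0.trans_lt h2
  have hsum : Summable fun n : ℕ => (n : ℝ) ^ 1 * (ρ / ρ') ^ n :=
    summable_pow_mul_geometric_of_norm_lt_one 1 (by
      rw [Real.norm_of_nonneg (by positivity)]; exact (div_lt_one hρ').2 h2)
  obtain ⟨M, hM⟩ := hsum.tendsto_atTop_zero.bddAbove_range
  refine ⟨ρ', |C| * M, hρ'.le, h3, fun n => ?_⟩
  have h4 : (n : ℝ) ^ 1 * (ρ / ρ') ^ (n : ℕ) ≤ M := hM ⟨(n : ℕ), rfl⟩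
  rw [pow_one, div_pow, ← mul_div_assoc, div_le_iff₀ (by positivity)] at h4
  rw [norm_mul, Complex.norm_natCast]
  calc (n : ℝ) * ‖x n‖ ≤ n * (|C| * ρ ^ (n : ℕ)) := by
        gcongr; exact (h n).trans (by gcongr; exact le_abs_self C)
    _ = |C| * (n * ρ ^ (n : ℕ)) := by ring
    _ ≤ |C| * (M * ρ' ^ (n : ℕ)) := by gcongr
    _ = _ := by ring

/-- A finitely supported sequence. -/
theorem growthBelow_of_eventually_zero {R : ℝ} (hR : 0 < R) {x : Times} (N : ℕ)
    (h : ∀ n : ℕ+, N < n → x n = 0) : GrowthBelow R x := by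
  have h2 : 0 < R / 2 := by linarith
  refine ⟨R / 2, ∑ k ∈ Finset.range (N + 1), ‖x k.toPNat'‖ / (R / 2) ^ k, h2.le, by linarith,
    fun n => ?_⟩
  rw [← div_le_iff₀ (by positivity)]
  by_cases hn : N < n
  · rw [h n hn]
    simp only [norm_zero, zero_div]
    positivity
  · refine le_trans (le_of_eq ?_) (Finset.single_le_sum (f := fun k : ℕ => ‖x k.toPNat'‖ /
      (R / 2) ^ k) (fun k _ => by positivity)
      (Finset.mem_range.2 (by omega : (n : ℕ) < N + 1)))
    simp only [PNat.coe_toPNat']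

/-- The curve `w ↦ [w]` in the sequence space. -/
def bvec (R : ℝ) (w : ℂ) : BddSeq := vec R (bracket w)

theorem coords_bvec {R : ℝ} {w : ℂ} (hw : ‖w‖ < R) : coords R (bvec R w) = bracket w :=
  coords_vec ((norm_nonneg w).trans_lt hw) (growthBelow_bracket hw)

theorem bvec_zero (R : ℝ) : bvec R 0 = 0 := by
  have : ∀ n : ℕ+, (lp.single ⊤ n (bracket 0 n / (R : ℂ) ^ (n : ℕ)) : BddSeq) = 0 := fun n => by
    simp [bracket]
  simp [bvec, vec, this]

/-- The curve `w ↦ [w]` is holomorphic, because the series of its coordinate vectors converges locally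
uniformly in norm. -/
theorem analyticOnNhd_bvec (R : ℝ) : AnalyticOnNhd ℂ (bvec R) (Metric.ball 0 R) := by
  refine DifferentiableOn.analyticOnNhd (fun w hw => ?_) Metric.isOpen_ball
  have hwR : ‖w‖ < R := by simpa using hw
  obtain ⟨ρ, h2, h3⟩ := exists_between hwR
  have hR : 0 < R := (norm_nonneg w).trans_lt hwR
  have hρ : 0 < ρ := (norm_nonneg w).trans_lt h2
  have key : DifferentiableOn ℂ (fun w : ℂ => ∑' n : ℕ+,
      (lp.single ⊤ n (bracket w n / (R : ℂ) ^ (n : ℕ)) : BddSeq)) (Metric.ball 0 ρ) := by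
    refine Complex.differentiableOn_tsum_of_summable_norm (u := fun n : ℕ+ => (ρ / R) ^ (n : ℕ))
      (summable_pnat_geometric (by positivity) ((div_lt_one hR).2 h3)) (fun n => ?_)
      Metric.isOpen_ball (fun n z hz => ?_)
    · have : Differentiable ℂ fun w : ℂ => bracket w n / (R : ℂ) ^ (n : ℕ) := by
        unfold bracket; fun_prop
      exact ((lp.singleContinuousLinearMap ℂ (fun _ : ℕ+ => ℂ) ⊤ n).differentiable.comp
        this).differentiableOn
    · rw [lp.norm_single (by simp)]
      have hz' : ‖z‖ < ρ := by simpa using hz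
      refine (norm_div_pow_le (ρ := ρ) (C := 1) hR (fun k => ?_) n).trans (by simp)
      have hk : (1 : ℝ) ≤ k := by exact_mod_cast k.pos
      rw [bracket, norm_div, norm_pow, Complex.norm_natCast, one_mul]
      exact (div_le_self (by positivity) hk).trans (by gcongr)
  exact ((key w (by simpa using h2)).differentiableAt
    (Metric.isOpen_ball.mem_nhds (by simpa using h2))).differentiableWithinAt

theorem analyticAt_bvec {R : ℝ} {w : ℂ} (hw : ‖w‖ < R) : AnalyticAt ℂ (bvec R) w :=
  analyticOnNhd_bvec R w (by simpa using hw)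

/-- Coordinates of the derivative of a curve are the derivatives of the coordinates. -/
theorem coords_deriv {R : ℝ} {c : ℂ → BddSeq} {w : ℂ} (hc : DifferentiableAt ℂ c w) {φ : ℂ → Times}
    (h : ∀ᶠ z in 𝓝 w, coords R (c z) = φ z) (n : ℕ+) :
    coords R (deriv c w) n = deriv (fun z => φ z n) w := by
  have h1 := (coordCLM R n).hasFDerivAt.comp_hasDerivAt w hc.hasDerivAt
  have h2 : HasDerivAt (fun z => φ z n) (coords R (deriv c w) n) w :=
    h1.congr_of_eventuallyEq (h.mono fun z hz => by simp [coordCLM_apply, hz])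
  exact h2.deriv.symm

theorem coords_deriv_bvec {R : ℝ} {w : ℂ} (hw : ‖w‖ < R) :
    coords R (deriv (bvec R) w) = fun n : ℕ+ => w ^ ((n : ℕ) - 1) := by
  ext n
  have hev : ∀ᶠ z : ℂ in 𝓝 w, coords R (bvec R z) = bracket z :=
    (continuous_norm.continuousAt.eventually_lt continuousAt_const hw).mono
      fun z hz => coords_bvec hz
  rw [coords_deriv (analyticAt_bvec hw).differentiableAt hev]
  have hn : (n : ℂ) ≠ 0 := by exact_mod_cast n.ne_zero
  simp only [bracket, deriv_div_const, deriv_pow_field]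
  field_simp

theorem coords_deriv2_bvec {R : ℝ} {w : ℂ} (hw : ‖w‖ < R) :
    coords R (deriv (deriv (bvec R)) w) =
      fun n : ℕ+ => (((n : ℕ) - 1 : ℕ) : ℂ) * w ^ ((n : ℕ) - 1 - 1) := by
  ext n
  have hev : ∀ᶠ z : ℂ in 𝓝 w, coords R (deriv (bvec R) z) = fun n : ℕ+ => z ^ ((n : ℕ) - 1) :=
    (continuous_norm.continuousAt.eventually_lt continuousAt_const hw).mono
      fun z hz => coords_deriv_bvec hz
  rw [coords_deriv (analyticAt_bvec hw).deriv.differentiableAt hev]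
  simp

theorem coords_deriv3_bvec {R : ℝ} {w : ℂ} (hw : ‖w‖ < R) :
    coords R (deriv (deriv (deriv (bvec R))) w) = fun n : ℕ+ =>
      (((n : ℕ) - 1 : ℕ) : ℂ) * ((((n : ℕ) - 1 - 1 : ℕ) : ℂ) * w ^ ((n : ℕ) - 1 - 1 - 1)) := by
  ext n
  have hev : ∀ᶠ z : ℂ in 𝓝 w, coords R (deriv (deriv (bvec R)) z) =
      fun n : ℕ+ => (((n : ℕ) - 1 : ℕ) : ℂ) * z ^ ((n : ℕ) - 1 - 1) :=
    (continuous_norm.continuousAt.eventually_lt continuousAt_const hw).mono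
      fun z hz => coords_deriv2_bvec hz
  rw [coords_deriv (analyticAt_bvec hw).deriv.deriv.differentiableAt hev]
  simp

end

/-! ### Contour integrals and the exponential factor -/

section

open Complex Metric

/-- The substitution `z = w⁻¹` in a contour integral over a circle around the origin. -/
theorem circleIntegral_inv {r : ℝ} (hr : 0 < r) (f : ℂ → ℂ) :
    (∮ z in C(0, r), f z) = ∮ w in C(0, r⁻¹), (w ^ 2)⁻¹ * f w⁻¹ := by
  have hr' : (r : ℂ) ≠ 0 := by exact_mod_cast hr.ne'
  set G : ℝ → ℂ := fun θ => deriv (circleMap 0 r) θ • f (circleMap 0 r θ) with hG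
  have hper : Function.Periodic G (2 * Real.pi) := fun θ => by
    simp only [hG, deriv_circleMap, periodic_circleMap 0 r θ]
  have h1 : (∮ w in C(0, r⁻¹), (w ^ 2)⁻¹ * f w⁻¹) = ∫ θ in (0 : ℝ)..2 * Real.pi, G (-θ) := by
    unfold circleIntegral
    refine intervalIntegral.integral_congr fun θ _ => ?_
    have h2 : (circleMap 0 r⁻¹ θ)⁻¹ = circleMap 0 r (-θ) := by
      simp [circleMap, exp_neg, mul_comm]
    simp only [hG, deriv_circleMap, smul_eq_mul, h2]
    rw [← inv_pow, h2]
    have h3 : circleMap 0 r⁻¹ θ * circleMap 0 r (-θ) = 1 := by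
      rw [← h2]; exact mul_inv_cancel₀ (circleMap_ne_center (inv_ne_zero hr.ne'))
    linear_combination (circleMap 0 r (-θ)) * I * f (circleMap 0 r (-θ)) * h3
  rw [h1, intervalIntegral.integral_comp_neg, neg_zero]
  have := hper.intervalIntegral_add_eq (-(2 * Real.pi)) 0
  simp only [neg_add_cancel, zero_add] at this
  rw [this]
  rfl

/-- Cauchy's formula in an annulus. -/
theorem annulus_cauchy {f : ℂ → ℂ} {r R : ℝ} (hr : 0 < r) {z₀ : ℂ} (h1 : r < ‖z₀‖) (h2 : ‖z₀‖ < R)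
    (hf : ∀ z : ℂ, r ≤ ‖z‖ → ‖z‖ ≤ R → DifferentiableAt ℂ f z) :
    (∮ z in C(0, R), (z - z₀)⁻¹ * f z) - (∮ z in C(0, r), (z - z₀)⁻¹ * f z) =
      2 * Real.pi * I * f z₀ := by
  have hR : 0 < R := hr.trans (h1.trans h2)
  have hfz := hf z₀ h1.le h2.le
  have hne : ∀ z : ℂ, ‖z‖ ≠ ‖z₀‖ → z - z₀ ≠ 0 := fun z hz h => hz (by rw [sub_eq_zero.1 h])
  -- The divided difference of `f` at `z₀` is holomorphic on the annulus.
  have hd : (∮ z in C(0, R), dslope f z₀ z) = ∮ z in C(0, r), dslope f z₀ z := by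
    refine circleIntegral_eq_of_differentiable_on_annulus_off_countable hr (h1.trans h2).le
      (Set.countable_singleton z₀) (fun z hz => ?_) (fun z hz => ?_)
    · have hz' : DifferentiableAt ℂ f z := hf z (by simpa using hz.2) (by simpa using hz.1)
      by_cases h : z = z₀
      · subst h; exact (continuousAt_dslope_same.2 hz').continuousWithinAt
      · exact ((continuousAt_dslope_of_ne h).2 hz'.continuousAt).continuousWithinAt
    · have hz1 : ‖z‖ < R := by simpa using hz.1.1
      have hz2 : r < ‖z‖ := by simpa using hz.1.2
      exact (differentiableAt_dslope_of_ne hz.2).2 (hf z hz2.le hz1.le)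
  have hsplit : ∀ s : ℝ, 0 < s → s ≠ ‖z₀‖ → r ≤ s → s ≤ R →
      (∮ z in C(0, s), (z - z₀)⁻¹ * f z) =
        (∮ z in C(0, s), dslope f z₀ z) + (∮ z in C(0, s), (z - z₀)⁻¹) * f z₀ := by
    intro s hs hsz hrs hsR
    have hnorm : ∀ z ∈ sphere (0 : ℂ) s, ‖z‖ = s := fun z hz => by simpa using hz
    have hci : ContinuousOn (fun z : ℂ => (z - z₀)⁻¹) (sphere 0 s) := fun z hz =>
      ((continuousAt_id.sub continuousAt_const).inv₀
        (hne z (by rw [hnorm z hz]; exact hsz))).continuousWithinAt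
    have hcf : ContinuousOn f (sphere 0 s) := fun z hz =>
      (hf z (by rw [hnorm z hz]; exact hrs)
        (by rw [hnorm z hz]; exact hsR)).continuousAt.continuousWithinAt
    have e1 : (∮ z in C(0, s), dslope f z₀ z) =
        ∮ z in C(0, s), ((z - z₀)⁻¹ * f z - (z - z₀)⁻¹ * f z₀) := by
      refine circleIntegral.integral_congr hs.le fun z hz => ?_
      have : z ≠ z₀ := fun h => hsz (by rw [← hnorm z hz, h])
      simp only [dslope_of_ne f this, slope_def_field]
      ring
    have i1 : CircleIntegrable (fun z => (z - z₀)⁻¹ * f z) 0 s :=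
      (hci.mul hcf).circleIntegrable hs.le
    have i2 : CircleIntegrable (fun z => (z - z₀)⁻¹ * f z₀) 0 s :=
      (hci.mul continuousOn_const).circleIntegrable hs.le
    rw [e1, circleIntegral.integral_sub i1 i2]
    have i3 : (∮ z in C(0, s), (z - z₀)⁻¹ * f z₀) = (∮ z in C(0, s), (z - z₀)⁻¹) * f z₀ :=
      circleIntegral.integral_smul_const (fun z => (z - z₀)⁻¹) (f z₀) 0 s
    rw [i3]
    ring
  rw [hsplit R hR h2.ne' (h1.trans h2).le le_rfl, hsplit r hr h1.ne le_rfl (h1.trans h2).le, hd,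
    circleIntegral.integral_sub_inv_of_mem_ball (by simpa using h2)]
  have h0 : (∮ z in C(0, r), (z - z₀)⁻¹) = 0 := by
    refine circleIntegral_eq_zero_of_differentiable_on_off_countable hr.le
      Set.countable_empty (fun z hz => ?_) (fun z hz => ?_)
    · have hz' : ‖z‖ ≤ r := by simpa using hz
      exact ((continuousAt_id.sub continuousAt_const).inv₀
        (hne z (hz'.trans_lt h1).ne)).continuousWithinAt
    · have hz' : ‖z‖ < r := by simpa using hz.1
      exact (differentiableAt_id.sub_const _).inv (hne z (hz'.trans h1).ne)
  rw [h0]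
  ring

theorem hasSum_xi_bracket {p z : ℂ} (h : ‖p * z‖ < 1) :
    HasSum (fun n : ℕ+ => bracket p n * z ^ (n : ℕ)) (-log (1 - p * z)) := by
  have h1 := hasSum_taylorSeries_neg_log h
  have h2 : HasSum (fun n : ℕ+ => (p * z) ^ (n : ℕ) / (n : ℕ)) (-log (1 - p * z)) := by
    refine (Function.Injective.hasSum_iff PNat.coe_injective (fun k hk => ?_)).2 h1
    have : k = 0 := by
      by_contra h
      exact hk ⟨⟨k, Nat.pos_of_ne_zero h⟩, rfl⟩
    simp [this]
  refine h2.congr_fun fun n => ?_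
  simp only [bracket, mul_pow]
  ring

theorem one_sub_ne_zero_of_norm_lt {u : ℂ} (h : ‖u‖ < 1) : 1 - u ≠ 0 := fun h0 => by
  rw [← sub_eq_zero.1 h0] at h; simp at h

theorem exp_neg_log_one_sub {u : ℂ} (h : ‖u‖ < 1) : exp (-log (1 - u)) = (1 - u)⁻¹ := by
  rw [exp_neg, exp_log (one_sub_ne_zero_of_norm_lt h)]

/-- On a difference of times of the form `[p] + [q]` the exponential factor of the bilinear identity is
rational. -/
theorem exp_xi_bracket_two {p q z : ℂ} (hp : ‖p * z‖ < 1) (hq : ‖q * z‖ < 1) :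
    exp (xi (bracket p + bracket q) z) = (1 - p * z)⁻¹ * (1 - q * z)⁻¹ := by
  have h := (hasSum_xi_bracket hp).add (hasSum_xi_bracket hq)
  have h2 : xi (bracket p + bracket q) z = -log (1 - p * z) + -log (1 - q * z) := by
    rw [xi, ← h.tsum_eq]
    exact tsum_congr fun n => by simp [add_mul]
  rw [h2, exp_add, exp_neg_log_one_sub hp, exp_neg_log_one_sub hq]

theorem exp_xi_bracket_three {p q u z : ℂ} (hp : ‖p * z‖ < 1) (hq : ‖q * z‖ < 1)
    (hu : ‖u * z‖ < 1) :
    exp (xi (bracket p + bracket q + bracket u) z) =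
      (1 - p * z)⁻¹ * (1 - q * z)⁻¹ * (1 - u * z)⁻¹ := by
  have h := ((hasSum_xi_bracket hp).add (hasSum_xi_bracket hq)).add (hasSum_xi_bracket hu)
  have h2 : xi (bracket p + bracket q + bracket u) z =
      -log (1 - p * z) + -log (1 - q * z) + -log (1 - u * z) := by
    rw [xi, ← h.tsum_eq]
    exact tsum_congr fun n => by simp [add_mul]
  rw [h2, exp_add, exp_add, exp_neg_log_one_sub hp, exp_neg_log_one_sub hq,
    exp_neg_log_one_sub hu]

end

/-! ### The Hirota–Miwa equation of the modified KP hierarchy -/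

section

open Complex Metric

theorem circleIntegrable_inv_sub_mul {φ : ℂ → ℂ} {ρ : ℝ} (hρ : 0 < ρ)
    (hφ : ∀ w : ℂ, ‖w‖ = ρ → DifferentiableAt ℂ φ w) {p : ℂ} (hp : ‖p‖ ≠ ρ) (c : ℂ) :
    CircleIntegrable (fun w => c * ((w - p)⁻¹ * φ w)) 0 ρ := by
  refine ContinuousOn.circleIntegrable hρ.le fun w hw => ?_
  have hw' : ‖w‖ = ρ := by simpa using hw
  have : w - p ≠ 0 := fun h => hp (by rw [← sub_eq_zero.1 h, hw'])
  exact (continuousAt_const.mul (((continuousAt_id.sub continuousAt_const).inv₀ this).mul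
    (hφ w hw').continuousAt)).continuousWithinAt

/-- The contour integral of a combination of simple fractions. -/
theorem circleIntegral_three {φ : ℂ → ℂ} {ρ : ℝ} (hρ : 0 < ρ)
    (hφ : ∀ w : ℂ, ‖w‖ = ρ → DifferentiableAt ℂ φ w) {p q u : ℂ} (hp : ‖p‖ ≠ ρ) (hq : ‖q‖ ≠ ρ)
    (hu : ‖u‖ ≠ ρ) (a b c : ℂ) :
    (∮ w in C(0, ρ), (a * ((w - p)⁻¹ * φ w) + b * ((w - q)⁻¹ * φ w) + c * ((w - u)⁻¹ * φ w))) =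
      a * (∮ w in C(0, ρ), (w - p)⁻¹ * φ w) + b * (∮ w in C(0, ρ), (w - q)⁻¹ * φ w) +
        c * (∮ w in C(0, ρ), (w - u)⁻¹ * φ w) := by
  have i1 := circleIntegrable_inv_sub_mul hρ hφ hp a
  have i2 := circleIntegrable_inv_sub_mul hρ hφ hq b
  have i3 := circleIntegrable_inv_sub_mul hρ hφ hu c
  have i12 : CircleIntegrable
      (fun w => a * ((w - p)⁻¹ * φ w) + b * ((w - q)⁻¹ * φ w)) 0 ρ := i1.add i2
  rw [circleIntegral.integral_add i12 i3, circleIntegral.integral_add i1 i2]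
  simp only [circleIntegral.integral_const_mul]

theorem differentiableAt_lift {E : Type*} [NormedAddCommGroup E] [NormedSpace ℂ E] {V : Set E}
    {f : E → ℂ} (hf : AnalyticOnNhd ℂ f V) {c : ℂ → E} {w : ℂ} (hc : DifferentiableAt ℂ c w)
    (h : c w ∈ V) : DifferentiableAt ℂ (fun w => f (c w)) w :=
  (hf _ h).differentiableAt.comp w hc

theorem mul_lt_one_of_norm {ρ : ℝ} (hρ : 0 < ρ) {p z : ℂ} (hp : ‖p‖ < ρ) (hz : ‖z‖ = ρ⁻¹) :
    ‖p * z‖ < 1 := by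
  rw [norm_mul, hz, ← div_eq_mul_inv, div_lt_one hρ]; exact hp

/-- The Hirota–Miwa equation: the residues at `w = 0, p, q` of the bilinear identity with
`x - y = [p] + [q]`, in the coordinate `w = z⁻¹`. -/
theorem hirotaMiwa_KP {R : ℝ} {U : Set Times} {τ : ℤ → Times → ℂ}
    (hol : ∀ n, IsHolomorphic R U (τ n)) (hier : IsModifiedKP R U τ) (n : ℤ) {y : BddSeq}
    {p q : ℂ} {ρ : ℝ} (hρ : 0 < ρ) (hρR : ρ < R) (hp : ‖p‖ < ρ) (hq : ‖q‖ < ρ)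
    (h : ∀ w : ℂ, ‖w‖ ≤ ρ → coords R (y + bvec R w) ∈ U ∧
      coords R (y + bvec R p + bvec R q - bvec R w) ∈ U) :
    (p - q) * (τ n (coords R y) * τ (n + 1) (coords R (y + bvec R p + bvec R q))) +
      q * (τ n (coords R (y + bvec R p)) * τ (n + 1) (coords R (y + bvec R q))) -
      p * (τ n (coords R (y + bvec R q)) * τ (n + 1) (coords R (y + bvec R p))) = 0 := by
  set φ : ℂ → ℂ := fun w : ℂ => τ n (coords R (y + bvec R w)) *
    τ (n + 1) (coords R (y + bvec R p + bvec R q - bvec R w)) with hφdef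
  have hφ : ∀ w : ℂ, ‖w‖ ≤ ρ → DifferentiableAt ℂ φ w := fun w hw => by
    have hb := (analyticAt_bvec (hw.trans_lt hρR)).differentiableAt
    exact (differentiableAt_lift (c := fun w => y + bvec R w) (hol n) (hb.const_add y)
      (h w hw).1).mul (differentiableAt_lift (c := fun w => y + bvec R p + bvec R q - bvec R w)
      (hol (n + 1)) (hb.const_sub _) (h w hw).2)
  have hφ' : DifferentiableOn ℂ φ (closedBall 0 ρ) := fun w hw =>
    (hφ w (by simpa using hw)).differentiableWithinAt
  have key := hier n (coords R (y + bvec R p + bvec R q)) (coords R y) ρ⁻¹ (inv_pos.2 hρ)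
    (by rwa [inv_inv]) ?_ ?_
  · have e0 : coords R (y + bvec R p + bvec R q) - coords R y = bracket p + bracket q := by
      rw [← coords_sub, add_assoc, add_sub_cancel_left, coords_add, coords_bvec (hp.trans hρR),
        coords_bvec (hq.trans hρR)]
    rw [e0, circleIntegral_inv (inv_pos.2 hρ), inv_inv] at key
    -- The kernel `1 / (w (w - p) (w - q))` is decomposed into partial fractions.
    have e1 : (∮ w in C(0, ρ), ((p - q) * ((w - 0)⁻¹ * φ w) + q * ((w - p)⁻¹ * φ w) +
        (-p) * ((w - q)⁻¹ * φ w))) = 0 := by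
      refine Eq.trans ?_ ((circleIntegral.integral_const_mul ((p - q) * p * q) _ _ _).trans
        ((congrArg _ key).trans (mul_zero _)))
      refine circleIntegral.integral_congr hρ.le fun w hw => ?_
      have hw' : ‖w‖ = ρ := by simpa using hw
      have hw0 : w ≠ 0 := fun h => by rw [h, norm_zero] at hw'; exact hρ.ne hw'
      have hwp : w - p ≠ 0 := fun h => hp.ne (by rw [← sub_eq_zero.1 h, hw'])
      have hwq : w - q ≠ 0 := fun h => hq.ne (by rw [← sub_eq_zero.1 h, hw'])
      have hz : ‖w⁻¹‖ = ρ⁻¹ := by rw [norm_inv, hw']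
      have e2 : coords R y + bracket w = coords R (y + bvec R w) := by
        rw [coords_add, coords_bvec (by rwa [hw'])]
      have e3 : coords R (y + bvec R p + bvec R q) - bracket w =
          coords R (y + bvec R p + bvec R q - bvec R w) := by
        rw [coords_sub _ _ (bvec R w), coords_bvec (by rwa [hw'])]
      simp only [inv_inv, e2, e3]
      rw [exp_xi_bracket_two (mul_lt_one_of_norm hρ hp hz) (mul_lt_one_of_norm hρ hq hz)]
      have f1 : (1 - p * w⁻¹)⁻¹ = w * (w - p)⁻¹ := by field_simp
      have f2 : (1 - q * w⁻¹)⁻¹ = w * (w - q)⁻¹ := by field_simp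
      rw [f1, f2, hφdef]
      field_simp
      ring
    rw [circleIntegral_three hρ (fun w hw => hφ w hw.le)
      (p := 0) (by simpa using hρ.ne) hp.ne hq.ne] at e1
    have cauchy : ∀ u : ℂ, ‖u‖ < ρ → (∮ w in C(0, ρ), (w - u)⁻¹ * φ w) = 2 * Real.pi * I * φ u :=
      fun u hu => hφ'.circleIntegral_sub_inv_smul (by simpa using hu)
    rw [cauchy 0 (by simpa using hρ), cauchy p hp, cauchy q hq] at e1
    have e4 : 2 * (Real.pi : ℂ) * I ≠ 0 := two_pi_I_ne_zero
    have e5 : (p - q) * φ 0 + q * φ p - p * φ q = 0 := by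
      refine (mul_eq_zero.1 ?_).resolve_left e4
      linear_combination e1
    simp only [hφdef, bvec_zero, add_zero, sub_zero] at e5
    have g1 : y + bvec R p + bvec R q - bvec R p = y + bvec R q := by abel
    have g2 : y + bvec R p + bvec R q - bvec R q = y + bvec R p := by abel
    rw [g1, g2] at e5
    linear_combination e5
  · rw [inv_inv, ← coords_sub, add_assoc, add_sub_cancel_left, coords_add,
      coords_bvec (hp.trans hρR), coords_bvec (hq.trans hρR)]
    exact (growthBelow_bracket hp).add (growthBelow_bracket hq)
  · intro w hw
    rw [inv_inv] at hw
    have := h w hw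
    rwa [coords_add, coords_sub _ _ (bvec R w), coords_bvec (hw.trans_lt hρR)] at this

end

/-! ### Discrete equations of the modified UC hierarchy -/

section

open Complex Metric

/-- The difference of the contour integrals of a combination of simple fractions over the two boundary
circles of an annulus. -/
theorem annulus_three {φ : ℂ → ℂ} {r R : ℝ} (hr : 0 < r)
    (hφ : ∀ z : ℂ, r ≤ ‖z‖ → ‖z‖ ≤ R → DifferentiableAt ℂ φ z) {p q u : ℂ}
    (hp : r < ‖p‖ ∧ ‖p‖ < R) (hq : r < ‖q‖ ∧ ‖q‖ < R) (hu : r < ‖u‖ ∧ ‖u‖ < R) (a b c : ℂ) :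
    (∮ w in C(0, R), (a * ((w - p)⁻¹ * φ w) + b * ((w - q)⁻¹ * φ w) + c * ((w - u)⁻¹ * φ w))) -
      (∮ w in C(0, r), (a * ((w - p)⁻¹ * φ w) + b * ((w - q)⁻¹ * φ w) + c * ((w - u)⁻¹ * φ w))) =
      2 * Real.pi * I * (a * φ p + b * φ q + c * φ u) := by
  have hrR : r < R := hp.1.trans hp.2
  rw [circleIntegral_three hr (fun w hw => hφ w hw.ge (hw.trans_le hrR.le)) hp.1.ne' hq.1.ne'
    hu.1.ne', circleIntegral_three (hr.trans hrR) (fun w hw => hφ w (hrR.le.trans hw.ge) hw.le)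
    hp.2.ne hq.2.ne hu.2.ne]
  have h1 := annulus_cauchy hr hp.1 hp.2 hφ
  have h2 := annulus_cauchy hr hq.1 hq.2 hφ
  have h3 := annulus_cauchy hr hu.1 hu.2 hφ
  linear_combination a * h1 + b * h2 + c * h3

/-- The Banach space underlying `B_R × B_S`. -/
abbrev BddSeq₂ := BddSeq × BddSeq

theorem coords₂_add (R S : ℝ) (u v : BddSeq₂) :
    coords₂ R S (u + v) = coords₂ R S u + coords₂ R S v := by
  ext : 1 <;> simp [coords₂, coords_add]

theorem coords₂_sub (R S : ℝ) (u v : BddSeq₂) :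
    coords₂ R S (u - v) = coords₂ R S u - coords₂ R S v := by
  ext : 1 <;> simp [coords₂, coords_sub]

/-- The curve `w ↦ ([w], [w⁻¹])`. -/
def bvec₂ (R S : ℝ) (w : ℂ) : BddSeq₂ := (bvec R w, bvec S w⁻¹)

theorem coords₂_pair {R S : ℝ} {w₁ w₂ : ℂ} (h1 : ‖w₁‖ < R) (h2 : ‖w₂‖ < S) :
    coords₂ R S (bvec R w₁, bvec S w₂) = bracket₂ w₁ w₂ := by
  simp [coords₂, bracket₂, coords_bvec h1, coords_bvec h2]

theorem coords₂_bvec₂ {R S : ℝ} {w : ℂ} (h1 : ‖w‖ < R) (h2 : ‖w⁻¹‖ < S) :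
    coords₂ R S (bvec₂ R S w) = bracket₂ w w⁻¹ := coords₂_pair h1 h2

theorem analyticAt_bvec₂ {R S : ℝ} {w : ℂ} (h0 : w ≠ 0) (h1 : ‖w‖ < R) (h2 : ‖w⁻¹‖ < S) :
    AnalyticAt ℂ (bvec₂ R S) w := by
  have h := (analyticAt_bvec (R := S) h2).comp (f := fun w : ℂ => w⁻¹) (x := w)
    (analyticAt_id.inv h0)
  exact (analyticAt_bvec h1).prod h

theorem IsHolomorphic₂.differentiableAt_mul {R S : ℝ} {W : Set Times₂} {F G : Times₂ → ℂ}
    (hF : IsHolomorphic₂ R S W F) (hG : IsHolomorphic₂ R S W G) {P Q : BddSeq₂} {w : ℂ}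
    (h0 : w ≠ 0) (h1 : ‖w‖ < R) (h2 : ‖w⁻¹‖ < S) (hQ : coords₂ R S (Q + bvec₂ R S w) ∈ W)
    (hP : coords₂ R S (P - bvec₂ R S w) ∈ W) :
    DifferentiableAt ℂ (fun w => F (coords₂ R S (Q + bvec₂ R S w)) *
      G (coords₂ R S (P - bvec₂ R S w))) w := by
  have hb := (analyticAt_bvec₂ h0 h1 h2).differentiableAt
  exact (differentiableAt_lift (c := fun w => Q + bvec₂ R S w) hF (hb.const_add Q) hQ).mul
    (differentiableAt_lift (c := fun w => P - bvec₂ R S w) hG (hb.const_sub P) hP)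

/-- The points `Q + ([w₁], [w₂])` and `P - ([w₁], [w₂])` lie in `W` for `(w₁, w₂)` in a
polydisc. -/
def PolydiscIn (R S : ℝ) (W : Set Times₂) (ρ₁ ρ₂ : ℝ) (P Q : BddSeq₂) : Prop :=
  ∀ w₁ w₂ : ℂ, ‖w₁‖ ≤ ρ₁ → ‖w₂‖ ≤ ρ₂ → coords₂ R S (Q + (bvec R w₁, bvec S w₂)) ∈ W ∧
    coords₂ R S (P - (bvec R w₁, bvec S w₂)) ∈ W

/-- `p` lies in the annulus `ρ₂⁻¹ < |p| < ρ₁`. -/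
def InAnnulus (ρ₁ ρ₂ : ℝ) (p : ℂ) : Prop := p ≠ 0 ∧ ‖p‖ < ρ₁ ∧ ‖p⁻¹‖ < ρ₂

section
variable {R S : ℝ} {W : Set Times₂} {ρ₁ ρ₂ : ℝ} {P Q : BddSeq₂} {p q u : ℂ}

theorem InAnnulus.inv_lt (hp : InAnnulus ρ₁ ρ₂ p) : ρ₂⁻¹ < ‖p‖ := by
  obtain ⟨h0, -, h2⟩ := hp
  rw [norm_inv] at h2
  exact inv_lt_of_inv_lt₀ (norm_pos_iff.2 h0) h2

/-- The `X`-equations are used on the outer circle `|w| = ρ₁`, with `w = z⁻¹`. -/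
theorem admissibleX_of_polydiscIn (h : PolydiscIn R S W ρ₁ ρ₂ P Q) (hρ₁ : ρ₁ < R) (hρ₂ : ρ₂ < S)
    (hp : InAnnulus ρ₁ ρ₂ p)
    (hg : GrowthBelow ρ₁ (coords₂ R S P - coords₂ R S Q).1) :
    AdmissibleX R S W (coords₂ R S P) (coords₂ R S Q) ρ₁⁻¹ := by
  have h1 : 0 < ρ₁ := (norm_nonneg _).trans_lt hp.2.1
  have h2 : 0 < ρ₂ := (norm_nonneg _).trans_lt hp.2.2
  have h3 : ρ₁⁻¹ < ρ₂ := inv_lt_of_inv_lt₀ ((norm_nonneg _).trans_lt hp.2.2) (hp.inv_lt.trans hp.2.1)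
  refine ⟨inv_pos.2 h1, by rwa [inv_inv], h3.trans hρ₂, by rwa [inv_inv], fun w₁ w₂ hw₁ hw₂ => ?_⟩
  rw [inv_inv] at hw₁
  have := h w₁ w₂ hw₁ (hw₂.trans h3.le)
  rwa [coords₂_add, coords₂_sub, coords₂_pair (hw₁.trans_lt hρ₁)
    (hw₂.trans_lt (h3.trans hρ₂))] at this

/-- The `Y`-equations are used on the inner circle `|w| = ρ₂⁻¹`. -/
theorem admissibleY_of_polydiscIn (h : PolydiscIn R S W ρ₁ ρ₂ P Q) (hρ₁ : ρ₁ < R) (hρ₂ : ρ₂ < S)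
    (hp : InAnnulus ρ₁ ρ₂ p)
    (hg : GrowthBelow ρ₂ (coords₂ R S P - coords₂ R S Q).2) :
    AdmissibleY R S W (coords₂ R S P) (coords₂ R S Q) ρ₂⁻¹ := by
  have h2 : 0 < ρ₂ := (norm_nonneg _).trans_lt hp.2.2
  have h3 : ρ₂⁻¹ < ρ₁ := hp.inv_lt.trans hp.2.1
  refine ⟨inv_pos.2 h2, h3.trans hρ₁, by rwa [inv_inv], by rwa [inv_inv], fun w₁ w₂ hw₁ hw₂ => ?_⟩
  rw [inv_inv] at hw₂
  have := h w₁ w₂ (hw₁.trans h3.le) hw₂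
  rwa [coords₂_add, coords₂_sub, coords₂_pair (hw₁.trans_lt (h3.trans hρ₁))
    (hw₂.trans_lt hρ₂)] at this

theorem coords₂_bvec₂_add (h : PolydiscIn R S W ρ₁ ρ₂ P Q) (hρ₁ : ρ₁ < R) (hρ₂ : ρ₂ < S) {w : ℂ}
    (h1 : ‖w‖ ≤ ρ₁) (h2 : ‖w⁻¹‖ ≤ ρ₂) :
    coords₂ R S Q + bracket₂ w w⁻¹ = coords₂ R S (Q + bvec₂ R S w) ∧
    coords₂ R S P - bracket₂ w w⁻¹ = coords₂ R S (P - bvec₂ R S w) ∧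
    coords₂ R S (Q + bvec₂ R S w) ∈ W ∧ coords₂ R S (P - bvec₂ R S w) ∈ W := by
  refine ⟨?_, ?_, h w w⁻¹ h1 h2⟩
  · rw [coords₂_add, coords₂_bvec₂ (h1.trans_lt hρ₁) (h2.trans_lt hρ₂)]
  · rw [coords₂_sub, coords₂_bvec₂ (h1.trans_lt hρ₁) (h2.trans_lt hρ₂)]

theorem inv_one_sub_mul_inv {w p : ℂ} (hw : w ≠ 0) : (1 - p * w⁻¹)⁻¹ = w * (w - p)⁻¹ := by
  have h : 1 - p * w⁻¹ = w⁻¹ * (w - p) := by field_simp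
  rw [h, mul_inv, inv_inv]

theorem inv_one_sub_inv_mul {w p : ℂ} (hp : p ≠ 0) : (1 - p⁻¹ * w)⁻¹ = -p * (w - p)⁻¹ := by
  have h : 1 - p⁻¹ * w = (-p)⁻¹ * (w - p) := by field_simp; ring
  rw [h, mul_inv, inv_inv]

theorem differentiableAt_annulus (h : PolydiscIn R S W ρ₁ ρ₂ P Q) (hρ₁ : ρ₁ < R) (hρ₂ : ρ₂ < S)
    (hp : InAnnulus ρ₁ ρ₂ p) {F G : Times₂ → ℂ}
    (hF : IsHolomorphic₂ R S W F) (hG : IsHolomorphic₂ R S W G) :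
    ∀ w : ℂ, ρ₂⁻¹ ≤ ‖w‖ → ‖w‖ ≤ ρ₁ → DifferentiableAt ℂ
      (fun w => F (coords₂ R S (Q + bvec₂ R S w)) * G (coords₂ R S (P - bvec₂ R S w))) w := by
  intro w hw1 hw2
  have h2 : 0 < ρ₂ := (norm_nonneg _).trans_lt hp.2.2
  have hw0 : w ≠ 0 := norm_pos_iff.1 ((inv_pos.2 h2).trans_le hw1)
  have hw3 : ‖w⁻¹‖ ≤ ρ₂ := by rw [norm_inv]; exact inv_le_of_inv_le₀ h2 hw1
  have := h w w⁻¹ hw2 hw3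
  exact hF.differentiableAt_mul hG hw0 (hw2.trans_lt hρ₁) (hw3.trans_lt hρ₂) this.1 this.2

variable {τ : ℤ → ℤ → Times₂ → ℂ}

/-- The discrete equation that relates `τₘₙ τₘ₊₁,ₙ₊₁` and `τₘ₊₁,ₙ τₘ,ₙ₊₁`.  For
`P - Q = ([p], [p⁻¹]) + ([q], [q⁻¹])` the integrands of the `X`- and of the `Y`-equation are the
same rational multiple of the same function on an annulus, and the difference of the two integrals
is the sum of the residues at `p` and `q`. -/
theorem hirotaMiwa_UC_diagonal (hol : ∀ m n, IsHolomorphic₂ R S W (τ m n))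
    (hier : IsModifiedUC R S W τ) (m n : ℤ) (hρ₁ : ρ₁ < R) (hρ₂ : ρ₂ < S)
    (hp : InAnnulus ρ₁ ρ₂ p) (hq : InAnnulus ρ₁ ρ₂ q)
    (h : PolydiscIn R S W ρ₁ ρ₂ (Q + bvec₂ R S p + bvec₂ R S q) Q) :
    (p - q) * (τ m n (coords₂ R S Q) *
        τ (m + 1) (n + 1) (coords₂ R S (Q + bvec₂ R S p + bvec₂ R S q))) =
      p * (τ (m + 1) n (coords₂ R S (Q + bvec₂ R S p)) *
        τ m (n + 1) (coords₂ R S (Q + bvec₂ R S q))) -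
      q * (τ (m + 1) n (coords₂ R S (Q + bvec₂ R S q)) *
        τ m (n + 1) (coords₂ R S (Q + bvec₂ R S p))) := by
  set P : BddSeq₂ := Q + bvec₂ R S p + bvec₂ R S q with hP
  set φ : ℂ → ℂ := fun w => τ (m + 1) n (coords₂ R S (Q + bvec₂ R S w)) *
    τ m (n + 1) (coords₂ R S (P - bvec₂ R S w)) with hφdef
  have h1 : 0 < ρ₁ := (norm_nonneg _).trans_lt hp.2.1
  have h2 : 0 < ρ₂ := (norm_nonneg _).trans_lt hp.2.2
  have hφ := differentiableAt_annulus h hρ₁ hρ₂ hp (hol (m + 1) n) (hol m (n + 1))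
  have hdiff : coords₂ R S P - coords₂ R S Q =
      (bracket p + bracket q, bracket p⁻¹ + bracket q⁻¹) := by
    rw [← coords₂_sub, hP, add_assoc, add_sub_cancel_left, coords₂_add,
      coords₂_bvec₂ (hp.2.1.trans hρ₁) (hp.2.2.trans hρ₂),
      coords₂_bvec₂ (hq.2.1.trans hρ₁) (hq.2.2.trans hρ₂)]
    rfl
  have hdiff1 : (coords₂ R S P).1 - (coords₂ R S Q).1 = bracket p + bracket q := by
    rw [← Prod.fst_sub, hdiff]
  have hdiff2 : (coords₂ R S P).2 - (coords₂ R S Q).2 = bracket p⁻¹ + bracket q⁻¹ := by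
    rw [← Prod.snd_sub, hdiff]
  have hX := hier.eqX₂ m n _ _ _ (admissibleX_of_polydiscIn h hρ₁ hρ₂ hp (by
    rw [hdiff]; exact (growthBelow_bracket hp.2.1).add (growthBelow_bracket hq.2.1)))
  have hY := hier.eqY₂ m n _ _ _ (admissibleY_of_polydiscIn h hρ₁ hρ₂ hp (by
    rw [hdiff]; exact (growthBelow_bracket hp.2.2).add (growthBelow_bracket hq.2.2)))
  have hpi : (2 * (Real.pi : ℂ) * I) ≠ 0 := two_pi_I_ne_zero
  rw [bilinearX, hdiff1, circleIntegral_inv (inv_pos.2 h1), inv_inv, sub_eq_zero,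
    eq_inv_mul_iff_mul_eq₀ hpi] at hX
  rw [bilinearY, hdiff2, mul_eq_zero, or_iff_right (inv_ne_zero hpi)] at hY
  have key := annulus_three (inv_pos.2 h2) hφ ⟨hp.inv_lt, hp.2.1⟩ ⟨hq.inv_lt, hq.2.1⟩
    ⟨hp.inv_lt, hp.2.1⟩ p (-q) 0
  have eX : (∮ w in C(0, ρ₁), (p * ((w - p)⁻¹ * φ w) + (-q) * ((w - q)⁻¹ * φ w) +
      0 * ((w - p)⁻¹ * φ w))) = (p - q) * (2 * Real.pi * I *
        (τ m n (coords₂ R S Q) * τ (m + 1) (n + 1) (coords₂ R S P))) := by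
    refine Eq.trans ?_ ((circleIntegral.integral_const_mul (p - q) _ _ _).trans
      (congrArg _ hX.symm))
    refine circleIntegral.integral_congr h1.le fun w hw => ?_
    have hw' : ‖w‖ = ρ₁ := by simpa using hw
    have hw0 : w ≠ 0 := norm_pos_iff.1 (by rw [hw']; exact h1)
    have hwp : w - p ≠ 0 := fun h => hp.2.1.ne (by rw [← sub_eq_zero.1 h, hw'])
    have hwq : w - q ≠ 0 := fun h => hq.2.1.ne (by rw [← sub_eq_zero.1 h, hw'])
    have hz : ‖w⁻¹‖ = ρ₁⁻¹ := by rw [norm_inv, hw']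
    have hz2 : ‖w⁻¹‖ ≤ ρ₂ := by
      rw [hz]; exact (inv_lt_of_inv_lt₀ ((norm_nonneg _).trans_lt hp.2.2) (hp.inv_lt.trans hp.2.1)).le
    obtain ⟨e2, e3, -⟩ := coords₂_bvec₂_add h hρ₁ hρ₂ hw'.le hz2
    simp only [inv_inv, e2, e3]
    rw [exp_xi_bracket_two (mul_lt_one_of_norm h1 hp.2.1 hz) (mul_lt_one_of_norm h1 hq.2.1 hz),
      inv_one_sub_mul_inv hw0, inv_one_sub_mul_inv hw0, hφdef]
    field_simp
    ring
  have eY : (∮ w in C(0, ρ₂⁻¹), (p * ((w - p)⁻¹ * φ w) + (-q) * ((w - q)⁻¹ * φ w) +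
      0 * ((w - p)⁻¹ * φ w))) = 0 := by
    refine Eq.trans ?_ ((circleIntegral.integral_const_mul ((p - q) * p⁻¹ * q⁻¹) _ _ _).trans
      ((congrArg _ hY).trans (mul_zero _)))
    refine circleIntegral.integral_congr (inv_pos.2 h2).le fun w hw => ?_
    have hw' : ‖w‖ = ρ₂⁻¹ := by simpa using hw
    have hwp : w - p ≠ 0 := fun h => hp.inv_lt.ne' (by rw [← sub_eq_zero.1 h, hw'])
    have hwq : w - q ≠ 0 := fun h => hq.inv_lt.ne' (by rw [← sub_eq_zero.1 h, hw'])
    have hz2 : ‖w⁻¹‖ = ρ₂ := by rw [norm_inv, hw', inv_inv]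
    obtain ⟨e2, e3, -⟩ := coords₂_bvec₂_add h hρ₁ hρ₂
      (hw'.trans_lt (hp.inv_lt.trans hp.2.1)).le hz2.le
    have hp0 := hp.1
    have hq0 := hq.1
    simp only [e2, e3]
    rw [exp_xi_bracket_two (mul_lt_one_of_norm h2 hp.2.2 hw') (mul_lt_one_of_norm h2 hq.2.2 hw'),
      inv_one_sub_inv_mul hp0, inv_one_sub_inv_mul hq0, hφdef]
    field_simp
    ring
  rw [eX, eY, sub_zero] at key
  have g1 : P - bvec₂ R S p = Q + bvec₂ R S q := by rw [hP]; abel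
  have g2 : P - bvec₂ R S q = Q + bvec₂ R S p := by rw [hP]; abel
  rw [g1, g2] at key
  refine mul_left_cancel₀ hpi ?_
  linear_combination key

/-- The Hirota–Miwa equation of the modified UC hierarchy in the first index. -/
theorem hirotaMiwa_UC_row (hol : ∀ m n, IsHolomorphic₂ R S W (τ m n))
    (hier : IsModifiedUC R S W τ) (m n : ℤ) (hρ₁ : ρ₁ < R) (hρ₂ : ρ₂ < S)
    (hp : InAnnulus ρ₁ ρ₂ p) (hq : InAnnulus ρ₁ ρ₂ q) (hu : InAnnulus ρ₁ ρ₂ u)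
    (h : PolydiscIn R S W ρ₁ ρ₂ (Q + bvec₂ R S p + bvec₂ R S q + bvec₂ R S u) Q) :
    (q - u) * (τ m n (coords₂ R S (Q + bvec₂ R S p)) *
        τ (m + 1) n (coords₂ R S (Q + bvec₂ R S q + bvec₂ R S u))) -
      (p - u) * (τ m n (coords₂ R S (Q + bvec₂ R S q)) *
        τ (m + 1) n (coords₂ R S (Q + bvec₂ R S p + bvec₂ R S u))) +
      (p - q) * (τ m n (coords₂ R S (Q + bvec₂ R S u)) *
        τ (m + 1) n (coords₂ R S (Q + bvec₂ R S p + bvec₂ R S q))) = 0 := by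
  set P : BddSeq₂ := Q + bvec₂ R S p + bvec₂ R S q + bvec₂ R S u with hP
  set φ : ℂ → ℂ := fun w => τ m n (coords₂ R S (Q + bvec₂ R S w)) *
    τ (m + 1) n (coords₂ R S (P - bvec₂ R S w)) with hφdef
  have h1 : 0 < ρ₁ := (norm_nonneg _).trans_lt hp.2.1
  have h2 : 0 < ρ₂ := (norm_nonneg _).trans_lt hp.2.2
  have hφ := differentiableAt_annulus h hρ₁ hρ₂ hp (hol m n) (hol (m + 1) n)
  have hdiff : coords₂ R S P - coords₂ R S Q =
      (bracket p + bracket q + bracket u, bracket p⁻¹ + bracket q⁻¹ + bracket u⁻¹) := by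
    have : P = Q + (bvec₂ R S p + bvec₂ R S q + bvec₂ R S u) := by rw [hP]; abel
    rw [← coords₂_sub, this, add_sub_cancel_left, coords₂_add, coords₂_add,
      coords₂_bvec₂ (hp.2.1.trans hρ₁) (hp.2.2.trans hρ₂),
      coords₂_bvec₂ (hq.2.1.trans hρ₁) (hq.2.2.trans hρ₂),
      coords₂_bvec₂ (hu.2.1.trans hρ₁) (hu.2.2.trans hρ₂)]
    rfl
  have hdiff1 : (coords₂ R S P).1 - (coords₂ R S Q).1 = bracket p + bracket q + bracket u := by
    rw [← Prod.fst_sub, hdiff]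
  have hdiff2 : (coords₂ R S P).2 - (coords₂ R S Q).2 =
      bracket p⁻¹ + bracket q⁻¹ + bracket u⁻¹ := by
    rw [← Prod.snd_sub, hdiff]
  have hX := hier.eqX₁ m n _ _ _ (admissibleX_of_polydiscIn h hρ₁ hρ₂ hp (by
    rw [hdiff]; exact ((growthBelow_bracket hp.2.1).add (growthBelow_bracket hq.2.1)).add
      (growthBelow_bracket hu.2.1)))
  have hY := hier.eqY₁ m n _ _ _ (admissibleY_of_polydiscIn h hρ₁ hρ₂ hp (by
    rw [hdiff]; exact ((growthBelow_bracket hp.2.2).add (growthBelow_bracket hq.2.2)).add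
      (growthBelow_bracket hu.2.2)))
  have hpi : (2 * (Real.pi : ℂ) * I) ≠ 0 := two_pi_I_ne_zero
  rw [bilinearX, hdiff1, circleIntegral_inv (inv_pos.2 h1), inv_inv,
    mul_eq_zero, or_iff_right (inv_ne_zero hpi)] at hX
  rw [bilinearY, hdiff2, mul_eq_zero, or_iff_right (inv_ne_zero hpi)] at hY
  have key := annulus_three (inv_pos.2 h2) hφ ⟨hp.inv_lt, hp.2.1⟩ ⟨hq.inv_lt, hq.2.1⟩
    ⟨hu.inv_lt, hu.2.1⟩ (q - u) (-(p - u)) (p - q)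
  have eX : (∮ w in C(0, ρ₁), ((q - u) * ((w - p)⁻¹ * φ w) + (-(p - u)) * ((w - q)⁻¹ * φ w) +
      (p - q) * ((w - u)⁻¹ * φ w))) = 0 := by
    refine Eq.trans ?_ ((circleIntegral.integral_const_mul ((q - u) * (p - u) * (p - q)) _ _
      _).trans ((congrArg _ hX).trans (mul_zero _)))
    refine circleIntegral.integral_congr h1.le fun w hw => ?_
    have hw' : ‖w‖ = ρ₁ := by simpa using hw
    have hw0 : w ≠ 0 := norm_pos_iff.1 (by rw [hw']; exact h1)
    have hwp : w - p ≠ 0 := fun h => hp.2.1.ne (by rw [← sub_eq_zero.1 h, hw'])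
    have hwq : w - q ≠ 0 := fun h => hq.2.1.ne (by rw [← sub_eq_zero.1 h, hw'])
    have hwu : w - u ≠ 0 := fun h => hu.2.1.ne (by rw [← sub_eq_zero.1 h, hw'])
    have hz : ‖w⁻¹‖ = ρ₁⁻¹ := by rw [norm_inv, hw']
    have hz2 : ‖w⁻¹‖ ≤ ρ₂ := by
      rw [hz]; exact (inv_lt_of_inv_lt₀ ((norm_nonneg _).trans_lt hp.2.2) (hp.inv_lt.trans hp.2.1)).le
    obtain ⟨e2, e3, -⟩ := coords₂_bvec₂_add h hρ₁ hρ₂ hw'.le hz2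
    simp only [inv_inv, e2, e3]
    rw [exp_xi_bracket_three (mul_lt_one_of_norm h1 hp.2.1 hz) (mul_lt_one_of_norm h1 hq.2.1 hz)
      (mul_lt_one_of_norm h1 hu.2.1 hz),
      inv_one_sub_mul_inv hw0, inv_one_sub_mul_inv hw0, inv_one_sub_mul_inv hw0, hφdef]
    field_simp
    ring
  have eY : (∮ w in C(0, ρ₂⁻¹), ((q - u) * ((w - p)⁻¹ * φ w) + (-(p - u)) * ((w - q)⁻¹ * φ w) +
      (p - q) * ((w - u)⁻¹ * φ w))) = 0 := by
    refine Eq.trans ?_ ((circleIntegral.integral_const_mul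
      (-((q - u) * (p - u) * (p - q) * p⁻¹ * q⁻¹ * u⁻¹)) _ _ _).trans
      ((congrArg _ hY).trans (mul_zero _)))
    refine circleIntegral.integral_congr (inv_pos.2 h2).le fun w hw => ?_
    have hw' : ‖w‖ = ρ₂⁻¹ := by simpa using hw
    have hwp : w - p ≠ 0 := fun h => hp.inv_lt.ne' (by rw [← sub_eq_zero.1 h, hw'])
    have hwq : w - q ≠ 0 := fun h => hq.inv_lt.ne' (by rw [← sub_eq_zero.1 h, hw'])
    have hwu : w - u ≠ 0 := fun h => hu.inv_lt.ne' (by rw [← sub_eq_zero.1 h, hw'])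
    have hz2 : ‖w⁻¹‖ = ρ₂ := by rw [norm_inv, hw', inv_inv]
    obtain ⟨e2, e3, -⟩ := coords₂_bvec₂_add h hρ₁ hρ₂
      (hw'.trans_lt (hp.inv_lt.trans hp.2.1)).le hz2.le
    have hp0 := hp.1
    have hq0 := hq.1
    have hu0 := hu.1
    simp only [e2, e3]
    rw [exp_xi_bracket_three (mul_lt_one_of_norm h2 hp.2.2 hw')
      (mul_lt_one_of_norm h2 hq.2.2 hw') (mul_lt_one_of_norm h2 hu.2.2 hw'),
      inv_one_sub_inv_mul hp0, inv_one_sub_inv_mul hq0, inv_one_sub_inv_mul hu0, hφdef]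
    field_simp
    ring
  rw [eX, eY, sub_zero] at key
  have g1 : P - bvec₂ R S p = Q + bvec₂ R S q + bvec₂ R S u := by rw [hP]; abel
  have g2 : P - bvec₂ R S q = Q + bvec₂ R S p + bvec₂ R S u := by rw [hP]; abel
  have g3 : P - bvec₂ R S u = Q + bvec₂ R S p + bvec₂ R S q := by rw [hP]; abel
  rw [g1, g2, g3] at key
  refine mul_left_cancel₀ hpi ?_
  linear_combination -key

end

end

/-! ### The discrete equations near a point -/

section

open Complex Metric

theorem exists_closedBall_subset {v : Set ℂ} (hv : IsOpen v) {ρ R : ℝ} (h0 : 0 ≤ ρ) (hR : ρ < R)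
    (h : closedBall 0 ρ ⊆ v) : ∃ ρ', ρ < ρ' ∧ ρ' < R ∧ closedBall 0 ρ' ⊆ v := by
  obtain ⟨δ, hδ, hsub⟩ := (isCompact_closedBall (0 : ℂ) ρ).exists_cthickening_subset_open hv h
  rw [cthickening_closedBall hδ.le h0] at hsub
  obtain ⟨ρ', h1, h2⟩ := exists_between (lt_min hR (lt_add_of_pos_left ρ hδ))
  exact ⟨ρ', h1, h2.trans_le (min_le_left _ _),
    (closedBall_subset_closedBall (h2.le.trans (min_le_right _ _))).trans hsub⟩

theorem continuousAt_bvec_comp {α : Type*} [TopologicalSpace α] {R : ℝ} {f : α → ℂ} {a : α}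
    (hf : ContinuousAt f a) (h : ‖f a‖ < R) : ContinuousAt (fun s => bvec R (f s)) a :=
  ContinuousAt.comp (g := bvec R) (analyticAt_bvec h).continuousAt hf

theorem continuousAt_bvec₂_comp {α : Type*} [TopologicalSpace α] {R S : ℝ} {f : α → ℂ} {a : α}
    (hf : ContinuousAt f a) (h0 : f a ≠ 0) (h1 : ‖f a‖ < R) (h2 : ‖(f a)⁻¹‖ < S) :
    ContinuousAt (fun s => bvec₂ R S (f s)) a :=
  ContinuousAt.comp (g := bvec₂ R S) (analyticAt_bvec₂ h0 h1 h2).continuousAt hf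

/-- The points `y + [w]` and `x - [w]` lie in `U` for `w` in a disc. -/
def DiscIn (R : ℝ) (U : Set Times) (ρ : ℝ) (x y : BddSeq) : Prop :=
  ∀ w : ℂ, ‖w‖ ≤ ρ → coords R (y + bvec R w) ∈ U ∧ coords R (x - bvec R w) ∈ U

/-- Tube lemma: by compactness the condition `DiscIn` persists under small changes of the two points,
and the radius can be enlarged. -/
theorem discIn_eventually {R : ℝ} {U : Set Times} (hU : IsDomain R U) {α : Type*}
    [TopologicalSpace α] {x y : α → BddSeq} {a : α} (hx : ContinuousAt x a) (hy : ContinuousAt y a)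
    {ρ : ℝ} (h0 : 0 ≤ ρ) (hρ : ρ < R) (h : DiscIn R U ρ (x a) (y a)) :
    ∃ ρ', ρ < ρ' ∧ ρ' < R ∧ ∀ᶠ b in 𝓝 a, DiscIn R U ρ' (x b) (y b) := by
  let N : Set ((BddSeq × BddSeq) × ℂ) := {s | ‖s.2‖ < R ∧
    s.1.2 + bvec R s.2 ∈ coords R ⁻¹' U ∧ s.1.1 - bvec R s.2 ∈ coords R ⁻¹' U}
  have hN : IsOpen N := isOpen_iff_mem_nhds.2 fun s ⟨h1, h2, h3⟩ => by
    have c0 : ContinuousAt (fun s : (BddSeq × BddSeq) × ℂ => bvec R s.2) s :=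
      continuousAt_bvec_comp continuous_snd.continuousAt h1
    have c1 : ContinuousAt (fun s : (BddSeq × BddSeq) × ℂ => s.1.2 + bvec R s.2) s :=
      (by fun_prop : Continuous fun s : (BddSeq × BddSeq) × ℂ => s.1.2).continuousAt.add c0
    have c2 : ContinuousAt (fun s : (BddSeq × BddSeq) × ℂ => s.1.1 - bvec R s.2) s :=
      (by fun_prop : Continuous fun s : (BddSeq × BddSeq) × ℂ => s.1.1).continuousAt.sub c0
    filter_upwards [(continuous_norm.comp continuous_snd).continuousAt.eventually_lt
      continuousAt_const h1, c1.eventually (hU.2.mem_nhds h2),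
      c2.eventually (hU.2.mem_nhds h3)] with t t1 t2 t3
    exact ⟨t1, t2, t3⟩
  obtain ⟨u, v, hu, hv, hau, hKv, huv⟩ := generalized_tube_lemma (isCompact_singleton
    (x := (x a, y a))) (isCompact_closedBall (0 : ℂ) ρ) hN (by
      rintro ⟨s, w⟩ ⟨hs, hw⟩
      obtain rfl : s = (x a, y a) := hs
      have hw' : ‖w‖ ≤ ρ := by simpa using hw
      exact ⟨hw'.trans_lt hρ, h w hw'⟩)
  obtain ⟨ρ', h1, h2, h3⟩ := exists_closedBall_subset hv h0 hρ hKv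
  refine ⟨ρ', h1, h2, ?_⟩
  filter_upwards [(hx.prodMk hy).eventually (hu.mem_nhds (hau rfl))] with b hb w hw
  exact (huv (Set.mk_mem_prod hb (h3 (by simpa using hw)))).2

/-- Tube lemma for polydiscs: by compactness the condition `PolydiscIn` persists under small changes of
the two points, and both radii can be enlarged. -/
theorem polydiscIn_eventually {R S : ℝ} {W : Set Times₂} (hW : IsDomain₂ R S W) {α : Type*}
    [TopologicalSpace α] {P Q : α → BddSeq₂} {a : α} (hP : ContinuousAt P a)
    (hQ : ContinuousAt Q a) {ρ₁ ρ₂ : ℝ} (h1 : 0 ≤ ρ₁) (hρ₁ : ρ₁ < R) (h2 : 0 ≤ ρ₂) (hρ₂ : ρ₂ < S)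
    (h : PolydiscIn R S W ρ₁ ρ₂ (P a) (Q a)) :
    ∃ ρ₁' ρ₂', ρ₁ < ρ₁' ∧ ρ₁' < R ∧ ρ₂ < ρ₂' ∧ ρ₂' < S ∧
      ∀ᶠ b in 𝓝 a, PolydiscIn R S W ρ₁' ρ₂' (P b) (Q b) := by
  let N : Set ((BddSeq₂ × BddSeq₂) × (ℂ × ℂ)) := {s | ‖s.2.1‖ < R ∧ ‖s.2.2‖ < S ∧
    s.1.2 + (bvec R s.2.1, bvec S s.2.2) ∈ coords₂ R S ⁻¹' W ∧
    s.1.1 - (bvec R s.2.1, bvec S s.2.2) ∈ coords₂ R S ⁻¹' W}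
  have hN : IsOpen N := isOpen_iff_mem_nhds.2 fun s ⟨h1, h1', h2, h3⟩ => by
    have c0 : ContinuousAt
        (fun s : (BddSeq₂ × BddSeq₂) × (ℂ × ℂ) => (bvec R s.2.1, bvec S s.2.2)) s :=
      (continuousAt_bvec_comp (f := fun s : (BddSeq₂ × BddSeq₂) × (ℂ × ℂ) => s.2.1)
        (by fun_prop) h1).prodMk
      (continuousAt_bvec_comp (f := fun s : (BddSeq₂ × BddSeq₂) × (ℂ × ℂ) => s.2.2)
        (by fun_prop) h1')
    have c1 : ContinuousAt (fun s : (BddSeq₂ × BddSeq₂) × (ℂ × ℂ) =>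
        s.1.2 + (bvec R s.2.1, bvec S s.2.2)) s :=
      (by fun_prop : Continuous fun s : (BddSeq₂ × BddSeq₂) × (ℂ × ℂ) =>
        s.1.2).continuousAt.add c0
    have c2 : ContinuousAt (fun s : (BddSeq₂ × BddSeq₂) × (ℂ × ℂ) =>
        s.1.1 - (bvec R s.2.1, bvec S s.2.2)) s :=
      (by fun_prop : Continuous fun s : (BddSeq₂ × BddSeq₂) × (ℂ × ℂ) =>
        s.1.1).continuousAt.sub c0
    have n1 : Continuous fun s : (BddSeq₂ × BddSeq₂) × (ℂ × ℂ) => ‖s.2.1‖ := by fun_prop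
    have n2 : Continuous fun s : (BddSeq₂ × BddSeq₂) × (ℂ × ℂ) => ‖s.2.2‖ := by fun_prop
    filter_upwards [n1.continuousAt.eventually_lt continuousAt_const h1,
      n2.continuousAt.eventually_lt continuousAt_const h1', c1.eventually (hW.2.mem_nhds h2),
      c2.eventually (hW.2.mem_nhds h3)] with t t1 t1' t2 t3
    exact ⟨t1, t1', t2, t3⟩
  obtain ⟨u, v, hu, hv, hau, hKv, huv⟩ := generalized_tube_lemma (isCompact_singleton
    (x := (P a, Q a))) ((isCompact_closedBall (0 : ℂ) ρ₁).prod (isCompact_closedBall (0 : ℂ) ρ₂))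
    hN (by
      rintro ⟨s, w₁, w₂⟩ ⟨hs, hw1, hw2⟩
      obtain rfl : s = (P a, Q a) := hs
      have hw1' : ‖w₁‖ ≤ ρ₁ := by simpa using hw1
      have hw2' : ‖w₂‖ ≤ ρ₂ := by simpa using hw2
      exact ⟨hw1'.trans_lt hρ₁, hw2'.trans_lt hρ₂, h w₁ w₂ hw1' hw2'⟩)
  obtain ⟨v₁, v₂, hv₁, hv₂, hK₁, hK₂, hvv⟩ := generalized_tube_lemma
    (isCompact_closedBall (0 : ℂ) ρ₁) (isCompact_closedBall (0 : ℂ) ρ₂) hv hKv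
  obtain ⟨ρ₁', a1, a2, a3⟩ := exists_closedBall_subset hv₁ h1 hρ₁ hK₁
  obtain ⟨ρ₂', b1, b2, b3⟩ := exists_closedBall_subset hv₂ h2 hρ₂ hK₂
  refine ⟨ρ₁', ρ₂', a1, a2, b1, b2, ?_⟩
  filter_upwards [(hP.prodMk hQ).eventually (hu.mem_nhds (hau rfl))] with b hb w₁ w₂ hw₁ hw₂
  exact (huv (Set.mk_mem_prod hb
    (hvv (Set.mk_mem_prod (a3 (by simpa using hw₁)) (b3 (by simpa using hw₂)))))).2.2

section KP
variable {R : ℝ} {U : Set Times} {τ : ℤ → Times → ℂ}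

/-- The Hirota–Miwa equation near a point where it makes sense. -/
theorem hirotaMiwa_KP_eventually (hU : IsDomain R U) (hol : ∀ n, IsHolomorphic R U (τ n))
    (hier : IsModifiedKP R U τ) (n : ℤ) {y : BddSeq} {p q : ℂ} {ρ : ℝ} (hρ : 0 ≤ ρ) (hρR : ρ < R)
    (hp : ‖p‖ ≤ ρ) (hq : ‖q‖ ≤ ρ) (h : DiscIn R U ρ (y + bvec R p + bvec R q) y) :
    ∀ᶠ s : BddSeq × ℂ × ℂ in 𝓝 (y, p, q),
      (s.2.1 - s.2.2) * (τ n (coords R s.1) *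
        τ (n + 1) (coords R (s.1 + bvec R s.2.1 + bvec R s.2.2))) +
      s.2.2 * (τ n (coords R (s.1 + bvec R s.2.1)) *
        τ (n + 1) (coords R (s.1 + bvec R s.2.2))) -
      s.2.1 * (τ n (coords R (s.1 + bvec R s.2.2)) *
        τ (n + 1) (coords R (s.1 + bvec R s.2.1))) = 0 := by
  have cp : ContinuousAt (fun s : BddSeq × ℂ × ℂ => bvec R s.2.1) (y, p, q) :=
    continuousAt_bvec_comp (f := fun s : BddSeq × ℂ × ℂ => s.2.1) (by fun_prop)
      (hp.trans_lt hρR)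
  have cq : ContinuousAt (fun s : BddSeq × ℂ × ℂ => bvec R s.2.2) (y, p, q) :=
    continuousAt_bvec_comp (f := fun s : BddSeq × ℂ × ℂ => s.2.2) (by fun_prop)
      (hq.trans_lt hρR)
  obtain ⟨ρ', h1, h2, h3⟩ := discIn_eventually (α := BddSeq × ℂ × ℂ) (a := (y, p, q))
    (x := fun s => s.1 + bvec R s.2.1 + bvec R s.2.2) (y := fun s => s.1) hU
    ((continuous_fst.continuousAt.add cp).add cq) continuous_fst.continuousAt hρ hρR h
  have n1 : Continuous fun s : BddSeq × ℂ × ℂ => ‖s.2.1‖ := by fun_prop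
  have n2 : Continuous fun s : BddSeq × ℂ × ℂ => ‖s.2.2‖ := by fun_prop
  filter_upwards [h3, n1.continuousAt.eventually_lt continuousAt_const (hp.trans_lt h1),
    n2.continuousAt.eventually_lt continuousAt_const (hq.trans_lt h1)] with s s1 s2 s3
  exact hirotaMiwa_KP hol hier n (hρ.trans_lt h1) h2 s2 s3 s1

end KP

section UC
variable {R S : ℝ} {W : Set Times₂} {τ : ℤ → ℤ → Times₂ → ℂ}

theorem inAnnulus_eventually {α : Type*} [TopologicalSpace α] {ρ₁ ρ₂ ρ₁' ρ₂' : ℝ} {f : α → ℂ}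
    {a : α} (hf : ContinuousAt f a) (h1 : ρ₁ < ρ₁') (h2 : ρ₂ < ρ₂') (h0 : f a ≠ 0)
    (ha1 : ‖f a‖ ≤ ρ₁) (ha2 : ‖(f a)⁻¹‖ ≤ ρ₂) : ∀ᶠ b in 𝓝 a, InAnnulus ρ₁' ρ₂' (f b) := by
  filter_upwards [hf.eventually_ne h0, hf.norm.eventually_lt continuousAt_const
    (ha1.trans_lt h1), (hf.inv₀ h0).norm.eventually_lt continuousAt_const
    (ha2.trans_lt h2)] with b b1 b2 b3
  exact ⟨b1, b2, b3⟩

/-- The equation `hirotaMiwa_UC_diagonal` holds near a point where it makes sense, so that it can be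
differentiated.  The radii are only required to bound `p` and `q` weakly; the strict inequalities
needed for the contour integrals come from the enlarged polydisc. -/
theorem hirotaMiwa_UC_diagonal_eventually (hW : IsDomain₂ R S W)
    (hol : ∀ m n, IsHolomorphic₂ R S W (τ m n)) (hier : IsModifiedUC R S W τ) (m n : ℤ)
    {Q : BddSeq₂} {p q : ℂ} {ρ₁ ρ₂ : ℝ} (hρ₁ : ρ₁ < R) (hρ₂ : ρ₂ < S)
    (hp0 : p ≠ 0) (hp1 : ‖p‖ ≤ ρ₁) (hp2 : ‖p⁻¹‖ ≤ ρ₂)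
    (hq0 : q ≠ 0) (hq1 : ‖q‖ ≤ ρ₁) (hq2 : ‖q⁻¹‖ ≤ ρ₂)
    (h : PolydiscIn R S W ρ₁ ρ₂ (Q + bvec₂ R S p + bvec₂ R S q) Q) :
    ∀ᶠ s : BddSeq₂ × ℂ in 𝓝 (Q, p),
      (s.2 - q) * (τ m n (coords₂ R S s.1) *
          τ (m + 1) (n + 1) (coords₂ R S (s.1 + bvec₂ R S s.2 + bvec₂ R S q))) =
        s.2 * (τ (m + 1) n (coords₂ R S (s.1 + bvec₂ R S s.2)) *
          τ m (n + 1) (coords₂ R S (s.1 + bvec₂ R S q))) -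
        q * (τ (m + 1) n (coords₂ R S (s.1 + bvec₂ R S q)) *
          τ m (n + 1) (coords₂ R S (s.1 + bvec₂ R S s.2))) := by
  have cp : ContinuousAt (fun s : BddSeq₂ × ℂ => bvec₂ R S s.2) (Q, p) :=
    continuousAt_bvec₂_comp (f := fun s : BddSeq₂ × ℂ => s.2) (by fun_prop) hp0
      (hp1.trans_lt hρ₁) (hp2.trans_lt hρ₂)
  obtain ⟨ρ₁', ρ₂', a1, a2, b1, b2, h3⟩ := polydiscIn_eventually (α := BddSeq₂ × ℂ) (a := (Q, p))
    (P := fun s => s.1 + bvec₂ R S s.2 + bvec₂ R S q) (Q := fun s => s.1) hW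
    ((continuous_fst.continuousAt.add cp).add continuousAt_const) continuous_fst.continuousAt
    ((norm_nonneg _).trans hp1) hρ₁ ((norm_nonneg _).trans hp2) hρ₂ h
  filter_upwards [h3, inAnnulus_eventually (f := fun s : BddSeq₂ × ℂ => s.2) (a := (Q, p))
    continuous_snd.continuousAt a1 b1 hp0 hp1 hp2] with s s1 s2
  exact hirotaMiwa_UC_diagonal hol hier m n a2 b2 s2
    ⟨hq0, hq1.trans_lt a1, hq2.trans_lt b1⟩ s1

/-- The equation `hirotaMiwa_UC_row` for all values of one of its parameters near a given one. -/
theorem hirotaMiwa_UC_row_eventually (hW : IsDomain₂ R S W)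
    (hol : ∀ m n, IsHolomorphic₂ R S W (τ m n)) (hier : IsModifiedUC R S W τ) (m n : ℤ)
    {Q : BddSeq₂} {p q u : ℂ} {ρ₁ ρ₂ : ℝ} (hρ₁ : ρ₁ < R) (hρ₂ : ρ₂ < S)
    (hp0 : p ≠ 0) (hp1 : ‖p‖ ≤ ρ₁) (hp2 : ‖p⁻¹‖ ≤ ρ₂)
    (hq0 : q ≠ 0) (hq1 : ‖q‖ ≤ ρ₁) (hq2 : ‖q⁻¹‖ ≤ ρ₂)
    (hu0 : u ≠ 0) (hu1 : ‖u‖ ≤ ρ₁) (hu2 : ‖u⁻¹‖ ≤ ρ₂)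
    (h : PolydiscIn R S W ρ₁ ρ₂ (Q + bvec₂ R S p + bvec₂ R S q + bvec₂ R S u) Q) :
    ∀ᶠ r : ℂ in 𝓝 p,
      (q - u) * (τ m n (coords₂ R S (Q + bvec₂ R S r)) *
          τ (m + 1) n (coords₂ R S (Q + bvec₂ R S q + bvec₂ R S u))) -
        (r - u) * (τ m n (coords₂ R S (Q + bvec₂ R S q)) *
          τ (m + 1) n (coords₂ R S (Q + bvec₂ R S r + bvec₂ R S u))) +
        (r - q) * (τ m n (coords₂ R S (Q + bvec₂ R S u)) *
          τ (m + 1) n (coords₂ R S (Q + bvec₂ R S r + bvec₂ R S q))) = 0 := by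
  have cp : ContinuousAt (bvec₂ R S) p :=
    (analyticAt_bvec₂ hp0 (hp1.trans_lt hρ₁) (hp2.trans_lt hρ₂)).continuousAt
  obtain ⟨ρ₁', ρ₂', a1, a2, b1, b2, h3⟩ := polydiscIn_eventually (a := p)
    (P := fun r => Q + bvec₂ R S r + bvec₂ R S q + bvec₂ R S u) (Q := fun _ => Q) hW
    (((continuousAt_const.add cp).add continuousAt_const).add continuousAt_const)
    continuousAt_const
    ((norm_nonneg _).trans hp1) hρ₁ ((norm_nonneg _).trans hp2) hρ₂ h
  filter_upwards [h3, inAnnulus_eventually (f := fun r : ℂ => r) (a := p)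
    continuousAt_id a1 b1 hp0 hp1 hp2] with r s1 s2
  exact hirotaMiwa_UC_row hol hier m n a2 b2 s2
    ⟨hq0, hq1.trans_lt a1, hq2.trans_lt b1⟩ ⟨hu0, hu1.trans_lt a1, hu2.trans_lt b1⟩ s1

end UC

end

/-! ### Derivatives, Hirota derivatives and homogeneity -/

section

section Calculus
variable {E : Type*} [NormedAddCommGroup E] [NormedSpace ℂ E] {f : E → ℂ}

theorem hasDerivAt_comp_curve {c : ℂ → E} {c' : E} {t : ℂ} (hf : AnalyticAt ℂ f (c t))
    (hc : HasDerivAt c c' t) : HasDerivAt (fun t => f (c t)) (fderiv ℂ f (c t) c') t :=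
  hf.differentiableAt.hasFDerivAt.comp_hasDerivAt t hc

theorem hasDerivAt_fderiv_apply {c b : ℂ → E} {c' b' : E} {t : ℂ} (hf : AnalyticAt ℂ f (c t))
    (hc : HasDerivAt c c' t) (hb : HasDerivAt b b' t) :
    HasDerivAt (fun t => fderiv ℂ f (c t) (b t))
      (fderiv ℂ (fderiv ℂ f) (c t) c' (b t) + fderiv ℂ f (c t) b') t :=
  (hf.fderiv.differentiableAt.hasFDerivAt.comp_hasDerivAt t hc).clm_apply hb

theorem hasDerivAt_fderiv2_apply {c a b : ℂ → E} {c' a' b' : E} {t : ℂ}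
    (hf : AnalyticAt ℂ f (c t)) (hc : HasDerivAt c c' t) (ha : HasDerivAt a a' t)
    (hb : HasDerivAt b b' t) :
    HasDerivAt (fun t => fderiv ℂ (fderiv ℂ f) (c t) (a t) (b t))
      (fderiv ℂ (fderiv ℂ (fderiv ℂ f)) (c t) c' (a t) (b t) +
        fderiv ℂ (fderiv ℂ f) (c t) a' (b t) + fderiv ℂ (fderiv ℂ f) (c t) (a t) b') t := by
  simpa using! ((hf.fderiv.fderiv.differentiableAt.hasFDerivAt.comp_hasDerivAt t hc).clm_apply
    ha).clm_apply hb

theorem fderiv_fderiv_symm {x : E} (hf : AnalyticAt ℂ f x) (u v : E) :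
    fderiv ℂ (fderiv ℂ f) x u v = fderiv ℂ (fderiv ℂ f) x v u :=
  second_derivative_symmetric_of_eventually (𝕜 := ℂ)
    (hf.eventually_analyticAt.mono fun _ hy => hy.differentiableAt.hasFDerivAt)
    hf.fderiv.differentiableAt.hasFDerivAt u v

end Calculus

section Hirota

theorem hirota_one {f g : ℂ → ℂ} {f' g' x : ℂ} (hf : HasDerivAt f f' x) (hg : HasDerivAt g g' x) :
    hirota 1 f g x = f' * g x - f x * g' := by
  rw [hirota, iteratedDeriv_one]
  have h1 : HasDerivAt (fun h => f (x + h)) f' 0 :=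
    HasDerivAt.comp_const_add x 0 (by simpa using hf)
  have h2 : HasDerivAt (fun h => g (x - h)) (-g') 0 :=
    HasDerivAt.comp_const_sub x 0 (by simpa using hg)
  rw [(h1.fun_mul h2).deriv]
  simp only [add_zero, sub_zero]
  ring

theorem hirota_two {f f₁ : ℂ → ℂ} {f₂ x : ℂ} (hf : ∀ᶠ y in 𝓝 x, HasDerivAt f (f₁ y) y)
    (hf₁ : HasDerivAt f₁ f₂ x) : hirota 2 f f x = 2 * (f₂ * f x - f₁ x ^ 2) := by
  rw [hirota, iteratedDeriv_succ, iteratedDeriv_one]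
  have t1 : Tendsto (fun h : ℂ => x + h) (𝓝 0) (𝓝 x) := by
    have := (by fun_prop : Continuous fun h : ℂ => x + h).tendsto 0
    simpa using this
  have t2 : Tendsto (fun h : ℂ => x - h) (𝓝 0) (𝓝 x) := by
    have := (by fun_prop : Continuous fun h : ℂ => x - h).tendsto 0
    simpa using this
  have hd : deriv (fun h => f (x + h) * f (x - h)) =ᶠ[𝓝 0]
      fun h => f₁ (x + h) * f (x - h) + f (x + h) * (-f₁ (x - h)) := by
    filter_upwards [t1.eventually hf, t2.eventually hf] with h h1 h2
    exact ((HasDerivAt.comp_const_add x h h1).fun_mul (HasDerivAt.comp_const_sub x h h2)).deriv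
  rw [hd.deriv_eq]
  have hx := hf.self_of_nhds
  have a1 : HasDerivAt (fun h => f (x + h)) (f₁ x) 0 :=
    HasDerivAt.comp_const_add x 0 (by simpa using hx)
  have a2 : HasDerivAt (fun h => f (x - h)) (-f₁ x) 0 :=
    HasDerivAt.comp_const_sub x 0 (by simpa using hx)
  have b1 : HasDerivAt (fun h => f₁ (x + h)) f₂ 0 :=
    HasDerivAt.comp_const_add x 0 (by simpa using hf₁)
  have b2 : HasDerivAt (fun h => f₁ (x - h)) (-f₂) 0 :=
    HasDerivAt.comp_const_sub x 0 (by simpa using hf₁)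
  rw [((b1.fun_mul a2).fun_add (a1.fun_mul b2.fun_neg)).deriv]
  simp only [add_zero, sub_zero]
  ring

end Hirota

section Homogeneous

theorem coords_update {R : ℝ} (hR : 0 < R) (v : BddSeq) (n : ℕ+) (h : ℂ) :
    coords R (v + (h - coords R v n) • (lp.single ⊤ n (1 / (R : ℂ) ^ (n : ℕ)) : BddSeq)) =
      Function.update (coords R v) n h := by
  rw [coords_add, coords_smul, coords_single hR]
  ext k
  by_cases hk : k = n
  · subst hk; simp
  · simp [hk]

theorem hasDerivAt_line {E : Type*} [NormedAddCommGroup E] [NormedSpace ℂ E] (v e : E) (a h : ℂ) :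
    HasDerivAt (fun h : ℂ => v + (h - a) • e) e h := by
  simpa using (((hasDerivAt_id h).sub_const a).smul_const e).const_add v

theorem smul_single (R : ℝ) (n : ℕ+) (a : ℂ) :
    a • (lp.single ⊤ n (1 / (R : ℂ) ^ (n : ℕ)) : BddSeq) =
      lp.single ⊤ n (a / (R : ℂ) ^ (n : ℕ)) := by
  rw [← lp.single_smul, smul_eq_mul, mul_one_div]

/-- Homogeneity as a statement on the Fréchet derivative along the Euler vector field. -/
theorem IsHomogeneous.fderiv_euler {R : ℝ} (hR : 0 < R) {U : Set Times} {F : Times → ℂ} {d : ℂ}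
    (hF : IsHolomorphic R U F) (h : IsHomogeneous R U F d) {x : Times} (hx : x ∈ U)
    (hg : GrowthBelow R x) :
    fderiv ℂ (fun v => F (coords R v)) (vec R x) (vec R fun n => (n : ℂ) * x n) = d * F x := by
  have hc : coords R (vec R x) = x := coords_vec hR hg
  have hf : AnalyticAt ℂ (fun v => F (coords R v)) (vec R x) := hF _ (by
    rw [Set.mem_preimage, hc]; exact hx)
  set L := fderiv ℂ (fun v => F (coords R v)) (vec R x)
  have h1 := L.hasSum (hasSum_vec hR hg.euler)
  refine h1.unique ((h x hx hg).congr_fun fun n => ?_)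
  have h2 : partialDeriv n F x = L (lp.single ⊤ n (1 / (R : ℂ) ^ (n : ℕ))) := by
    have h3 := hasDerivAt_comp_curve (f := fun v => F (coords R v))
      (c := fun h : ℂ => vec R x + (h - x n) •
        (lp.single ⊤ n (1 / (R : ℂ) ^ (n : ℕ)) : BddSeq)) (t := x n) (by simpa using hf)
      (hasDerivAt_line _ _ _ _)
    have h4 : (fun h => F (Function.update x n h)) = fun h : ℂ => F (coords R (vec R x +
        (h - x n) • (lp.single ⊤ n (1 / (R : ℂ) ^ (n : ℕ)) : BddSeq))) := by
      ext h
      have := coords_update hR (vec R x) n h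
      rw [hc] at this
      rw [this]
    rw [partialDeriv, h4, h3.deriv]
    simp [L]
  rw [h2, ← smul_eq_mul (_ * _), ← L.map_smul, smul_single]

/-- Homogeneity in two sets of variables as a statement on the Fréchet derivative. -/
theorem IsHomogeneous₂.fderiv_euler {R S : ℝ} (hR : 0 < R) (hS : 0 < S) {W : Set Times₂}
    {F : Times₂ → ℂ} {d : ℂ} (hF : IsHolomorphic₂ R S W F) (h : IsHomogeneous₂ R S W F d)
    {P : Times₂} (hP : P ∈ W) (hg₁ : GrowthBelow R P.1) (hg₂ : GrowthBelow S P.2) :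
    fderiv ℂ (fun v => F (coords₂ R S v)) (vec R P.1, vec S P.2)
      (vec R fun n => (n : ℂ) * P.1 n, -vec S fun n => (n : ℂ) * P.2 n) = d * F P := by
  have hc₁ : coords R (vec R P.1) = P.1 := coords_vec hR hg₁
  have hc₂ : coords S (vec S P.2) = P.2 := coords_vec hS hg₂
  have hf : AnalyticAt ℂ (fun v => F (coords₂ R S v)) (vec R P.1, vec S P.2) := hF _ (by
    rw [Set.mem_preimage, coords₂, hc₁, hc₂]; exact hP)
  set L := fderiv ℂ (fun v => F (coords₂ R S v)) (vec R P.1, vec S P.2)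
  have h1 := (L.comp (ContinuousLinearMap.inl ℂ BddSeq BddSeq)).hasSum (hasSum_vec hR hg₁.euler)
  have h2 := (L.comp (ContinuousLinearMap.inr ℂ BddSeq BddSeq)).hasSum (hasSum_vec hS hg₂.euler)
  have h5 : L (vec R fun n => (n : ℂ) * P.1 n, -vec S fun n => (n : ℂ) * P.2 n) =
      (L.comp (ContinuousLinearMap.inl ℂ BddSeq BddSeq)) (vec R fun n => (n : ℂ) * P.1 n) -
      (L.comp (ContinuousLinearMap.inr ℂ BddSeq BddSeq)) (vec S fun n => (n : ℂ) * P.2 n) := by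
    simp [← map_sub]
  rw [h5]
  refine (h1.sub h2).unique ((h P hP hg₁ hg₂).congr_fun fun n => ?_)
  have e1 : partialDeriv n (fun x => F (x, P.2)) P.1 =
      L (lp.single ⊤ n (1 / (R : ℂ) ^ (n : ℕ)), 0) := by
    have h3 := hasDerivAt_comp_curve (f := fun v => F (coords₂ R S v))
      (c := fun h : ℂ => ((vec R P.1, vec S P.2) : BddSeq₂) + (h - P.1 n) •
        ((lp.single ⊤ n (1 / (R : ℂ) ^ (n : ℕ)), 0) : BddSeq₂)) (t := P.1 n) (by simpa using hf)
      (hasDerivAt_line _ _ _ _)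
    have h4 : (fun h => F (Function.update P.1 n h, P.2)) = fun h : ℂ =>
        F (coords₂ R S (((vec R P.1, vec S P.2) : BddSeq₂) + (h - P.1 n) •
        ((lp.single ⊤ n (1 / (R : ℂ) ^ (n : ℕ)), 0) : BddSeq₂))) := by
      ext h
      have := coords_update hR (vec R P.1) n h
      rw [hc₁] at this
      simp only [Prod.smul_mk, Prod.mk_add_mk, smul_zero, add_zero, coords₂, this, hc₂]
    rw [partialDeriv, h4, h3.deriv]
    simp [L]
  have e2 : partialDeriv n (fun y => F (P.1, y)) P.2 =
      L (0, lp.single ⊤ n (1 / (S : ℂ) ^ (n : ℕ))) := by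
    have h3 := hasDerivAt_comp_curve (f := fun v => F (coords₂ R S v))
      (c := fun h : ℂ => ((vec R P.1, vec S P.2) : BddSeq₂) + (h - P.2 n) •
        ((0, lp.single ⊤ n (1 / (S : ℂ) ^ (n : ℕ))) : BddSeq₂)) (t := P.2 n) (by simpa using hf)
      (hasDerivAt_line _ _ _ _)
    have h4 : (fun h => F (P.1, Function.update P.2 n h)) = fun h : ℂ =>
        F (coords₂ R S (((vec R P.1, vec S P.2) : BddSeq₂) + (h - P.2 n) •
        ((0, lp.single ⊤ n (1 / (S : ℂ) ^ (n : ℕ))) : BddSeq₂))) := by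
      ext h
      have := coords_update hS (vec S P.2) n h
      rw [hc₂] at this
      simp only [Prod.smul_mk, Prod.mk_add_mk, smul_zero, add_zero, coords₂, this, hc₁]
    rw [partialDeriv, h4, h3.deriv]
    simp [L]
  rw [e1, e2, ← smul_eq_mul (_ * _), ← smul_eq_mul (_ * _), ← L.map_smul, ← L.map_smul, Prod.smul_mk,
    Prod.smul_mk, smul_zero, smul_zero, smul_single, smul_single]
  rfl

/-- Homogeneous functions that coincide on the domain have the same degree. -/
theorem IsHomogeneous.degree_unique {R : ℝ} (hR : 0 < R) {U : Set Times} (hU : IsDomain R U)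
    {F G : Times → ℂ} {d e : ℂ} (hF : IsHolomorphic R U F) (hG : IsHolomorphic R U G)
    (h : IsHomogeneous R U F d) (h' : IsHomogeneous R U G e) (hFG : ∀ x ∈ U, F x = G x)
    {x : Times} (hx : x ∈ U) (hg : GrowthBelow R x) (h0 : F x ≠ 0) : d = e := by
  have h1 := h.fderiv_euler hR hF hx hg
  have h2 := h'.fderiv_euler hR hG hx hg
  have h3 : (fun v => F (coords R v)) =ᶠ[𝓝 (vec R x)] fun v => G (coords R v) :=
    Filter.mem_of_superset (hU.2.mem_nhds (by rwa [Set.mem_preimage, coords_vec hR hg]))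
      fun v hv => hFG _ hv
  rw [h3.fderiv_eq, h2, ← hFG x hx] at h1
  exact (mul_right_cancel₀ h0 h1).symm

theorem IsHomogeneous₂.degree_unique {R S : ℝ} (hR : 0 < R) (hS : 0 < S) {W : Set Times₂}
    (hW : IsDomain₂ R S W) {F G : Times₂ → ℂ} {d e : ℂ} (hF : IsHolomorphic₂ R S W F)
    (hG : IsHolomorphic₂ R S W G) (h : IsHomogeneous₂ R S W F d) (h' : IsHomogeneous₂ R S W G e)
    (hFG : ∀ P ∈ W, F P = G P) {P : Times₂} (hP : P ∈ W) (hg₁ : GrowthBelow R P.1)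
    (hg₂ : GrowthBelow S P.2) (h0 : F P ≠ 0) : d = e := by
  have h1 := h.fderiv_euler hR hS hF hP hg₁ hg₂
  have h2 := h'.fderiv_euler hR hS hG hP hg₁ hg₂
  have h3 : (fun v => F (coords₂ R S v)) =ᶠ[𝓝 (vec R P.1, vec S P.2)]
      fun v => G (coords₂ R S v) :=
    Filter.mem_of_superset (hW.2.mem_nhds (by
      rwa [Set.mem_preimage, coords₂, coords_vec hR hg₁, coords_vec hS hg₂])) fun v hv => hFG _ hv
  rw [h3.fderiv_eq, h2, ← hFG P hP] at h1
  exact (mul_right_cancel₀ h0 h1).symm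

end Homogeneous

end

/-! ### From the Darboux chain to the Painlevé equations of type `A` -/

section

theorem sum_range_shift {N : ℕ} {w : ℤ → ℂ} (hw : ∀ n, w (n + N) = w n) (m : ℤ) :
    ∑ k ∈ Finset.range N, w (m + k) = ∑ k ∈ Finset.range N, w k := by
  have step : ∀ m : ℤ, ∑ k ∈ Finset.range N, w (m + 1 + k) = ∑ k ∈ Finset.range N, w (m + k) := by
    intro m
    have h1 := Finset.sum_range_succ (fun k : ℕ => w (m + k)) N
    have h2 := Finset.sum_range_succ' (fun k : ℕ => w (m + k)) N
    simp only [hw, Nat.cast_zero, add_zero] at h1 h2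
    have h3 : ∑ k ∈ Finset.range N, w (m + 1 + k) =
        ∑ k ∈ Finset.range N, w (m + ((k + 1 : ℕ) : ℤ)) :=
      Finset.sum_congr rfl fun k _ => by congr 1; push_cast; ring
    rw [h3]
    linear_combination h1 - h2
  induction m using Int.induction_on with
  | zero => simp
  | succ i ih => rw [step, ih]
  | pred i ih => rw [← ih, ← step]; simp

theorem sum_pairs (w : ℤ → ℂ) (n : ℤ) (g : ℕ) :
    ∑ i ∈ Finset.range (g + 1), (w (n + 2 * i) + w (n + 2 * i - 1)) =
      ∑ k ∈ Finset.range (2 * g + 2), w (n - 1 + k) := by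
  induction g with
  | zero => simp [Finset.sum_range_succ]; ring
  | succ g ih =>
    rw [Finset.sum_range_succ, ih, show 2 * (g + 1) + 2 = 2 * g + 2 + 1 + 1 by ring,
      Finset.sum_range_succ _ (2 * g + 2 + 1), Finset.sum_range_succ _ (2 * g + 2)]
    have e1 : n + 2 * ((g + 1 : ℕ) : ℤ) = n - 1 + ((2 * g + 2 + 1 : ℕ) : ℤ) := by push_cast; ring
    have e2 : n + 2 * ((g + 1 : ℕ) : ℤ) - 1 = n - 1 + ((2 * g + 2 : ℕ) : ℤ) := by push_cast; ring
    rw [e2, e1]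
    ring

/-- The alternating sum of `fₙ₊₁, …, fₙ₊₂g`, where `fₙ = wₙ + wₙ₋₁`, telescopes. -/
theorem alternating_sum (w : ℤ → ℂ) (n : ℤ) (g : ℕ) :
    ∑ i ∈ Finset.Icc 1 g, (w (n + 2 * i - 1) + w (n + 2 * i - 1 - 1)) -
      ∑ i ∈ Finset.Icc 1 g, (w (n + 2 * i) + w (n + 2 * i - 1)) = w n - w (n + 2 * g) := by
  induction g with
  | zero => simp
  | succ g ih =>
    rw [Finset.sum_Icc_succ_top (by omega), Finset.sum_Icc_succ_top (by omega)]
    have e : n + 2 * ((g + 1 : ℕ) : ℤ) - 1 - 1 = n + 2 * g := by push_cast; ring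
    rw [e]
    linear_combination ih

theorem double_sum_succ (F : ℕ → ℕ → ℂ) (g : ℕ) :
    ∑ i ∈ Finset.Icc 1 (g + 1), ∑ j ∈ Finset.Icc i (g + 1), F i j =
      ∑ i ∈ Finset.Icc 1 g, ∑ j ∈ Finset.Icc i g, F i j +
        ∑ i ∈ Finset.Icc 1 (g + 1), F i (g + 1) := by
  have h : ∀ i ∈ Finset.Icc 1 (g + 1), ∑ j ∈ Finset.Icc i (g + 1), F i j =
      ∑ j ∈ Finset.Icc i g, F i j + F i (g + 1) := fun i hi =>
    Finset.sum_Icc_succ_top (Finset.mem_Icc.1 hi).2 _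
  rw [Finset.sum_congr rfl h, Finset.sum_add_distrib, Finset.sum_Icc_succ_top (by omega)]
  simp

/-- The quadratic identity behind the equations with an even number of nodes. -/
theorem quadratic_identity (w : ℤ → ℂ) (n : ℤ) (g : ℕ) :
    (∑ i ∈ Finset.Icc 1 g, (w (n + 2 * i) + w (n + 2 * i - 1))) * (w n - w (n + 2 * g + 1)) =
      (∑ i ∈ Finset.Icc 1 g, ∑ j ∈ Finset.Icc i g,
          (w (n + 2 * i - 1) + w (n + 2 * i - 1 - 1)) * (w (n + 2 * j) + w (n + 2 * j - 1)) -
        ∑ i ∈ Finset.Icc 1 g, ∑ j ∈ Finset.Icc i g,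
          (w (n + 2 * i) + w (n + 2 * i - 1)) * (w (n + 2 * j + 1) + w (n + 2 * j + 1 - 1))) +
      ∑ i ∈ Finset.Icc 1 g, (w (n + 2 * i) ^ 2 - w (n + 2 * i - 1) ^ 2) := by
  induction g with
  | zero => simp
  | succ g ih =>
    rw [double_sum_succ, double_sum_succ, ← Finset.sum_mul, ← Finset.sum_mul]
    have ha := alternating_sum w n (g + 1)
    rw [sub_eq_iff_eq_add] at ha
    rw [ha]
    simp only [Finset.sum_Icc_succ_top (show 1 ≤ g + 1 by omega)]
    have e1 : n + 2 * ((g + 1 : ℕ) : ℤ) - 1 = n + 2 * g + 1 := by push_cast; ring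
    have e2 : n + 2 * ((g + 1 : ℕ) : ℤ) + 1 - 1 = n + 2 * ((g + 1 : ℕ) : ℤ) := by ring
    rw [e1, e2]
    linear_combination ih

/-- A periodic Darboux chain yields a solution of the Painlevé equation of type `A`. -/
theorem isPAAt_of_darbouxChain {N : ℕ} {α : ℤ → ℂ} {w : ℤ → ℂ → ℂ} {x : ℂ}
    (h : ∀ᶠ y in 𝓝 x, IsDarbouxChainAt N α w y) :
    IsPAAt N α (fun n y => w n y + w (n - 1) y) x := by
  obtain ⟨-, hw, -, hs, -, hd⟩ := h.self_of_nhds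
  refine ⟨fun g _ hN n => ?_, fun g _ hN n => ?_⟩
  · have ha := alternating_sum (fun k => w k x) n g
    have hp : w (n + 2 * g) x = w (n - 1) x := by
      rw [← hw (n - 1), hN]; congr 1; push_cast; ring
    rw [hp] at ha
    beta_reduce
    rw [ha]
    convert hd n using 1
    ring
  · have hsum : ∀ y, IsDarbouxChainAt N α w y →
        ∑ i ∈ Finset.range (g + 1), (w (n + 2 * i) y + w (n + 2 * i - 1) y) = N * y / 2 := by
      rintro y ⟨-, hw, -, hs, -⟩
      rw [sum_pairs (fun k => w k y), ← hN, sum_range_shift (w := fun k => w k y) hw (n - 1), hs]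
    have hder : HasDerivAt
        (fun y => ∑ i ∈ Finset.range (g + 1), (w (n + 2 * i) y + w (n + 2 * i - 1) y))
        (∑ i ∈ Finset.range (g + 1), (w (n + 2 * i) x ^ 2 - w (n + 2 * i - 1) x ^ 2 +
          α (n + 2 * i))) x :=
      HasDerivAt.fun_sum fun i _ => hd (n + 2 * i)
    have hder' : HasDerivAt (fun y : ℂ => (N : ℂ) * y / 2) (N * 1 / 2) x :=
      ((hasDerivAt_id x).const_mul (N : ℂ)).div_const 2
    have h1 := hder.unique (hder'.congr_of_eventuallyEq (h.mono hsum))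
    have h2 := hsum x h.self_of_nhds
    refine ⟨_, hd n, ?_⟩
    have h3 := quadratic_identity (fun k => w k x) n g
    have hp : w (n + 2 * g + 1) x = w (n - 1) x := by
      rw [← hw (n - 1), hN]; congr 1; push_cast; ring
    rw [hp] at h3
    have split : ∀ F : ℕ → ℂ, ∑ i ∈ Finset.range (g + 1), F i = F 0 + ∑ i ∈ Finset.Icc 1 g, F i := by
      intro F
      rw [Finset.range_eq_Ico, Finset.sum_eq_sum_Ico_succ_bot (by omega)]
      rfl
    rw [split] at h1 h2
    simp only [Nat.cast_zero, mul_zero, add_zero, Finset.sum_add_distrib (g := fun i : ℕ =>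
      α (n + 2 * i))] at h1 h2
    rw [← h2]
    set M := ∑ i ∈ Finset.Icc 1 g, (w (n + 2 * i) x + w (n + 2 * i - 1) x) with hM
    linear_combination (w n x + w (n - 1) x) * h3 + (w n x + w (n - 1) x) * h1

end

/-! ### Bilinear equations in the direction of the first time -/

section

/-- The coordinate vector field `∂/∂xₖ`. -/
def unitVec (R : ℝ) (k : ℕ+) : BddSeq := lp.single ⊤ k (1 / (R : ℂ) ^ (k : ℕ))

theorem coords_unitVec {R : ℝ} (hR : 0 < R) (k : ℕ+) : coords R (unitVec R k) = Pi.single k 1 :=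
  coords_single hR k 1

theorem deriv_bvec_zero {R : ℝ} (hR : 0 < R) : deriv (bvec R) 0 = unitVec R 1 := by
  apply coords_injective hR
  rw [coords_deriv_bvec (by simpa using hR), coords_unitVec hR]
  ext n
  by_cases h : n = 1
  · subst h; simp
  · have h' : (n : ℕ) - 1 ≠ 0 := by
      have := n.pos
      have h2 : (n : ℕ) ≠ 1 := fun h2 => h (PNat.eq h2)
      omega
    simp [h, h']

theorem deriv2_bvec_zero {R : ℝ} (hR : 0 < R) : deriv (deriv (bvec R)) 0 = unitVec R 2 := by
  apply coords_injective hR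
  rw [coords_deriv2_bvec (by simpa using hR), coords_unitVec hR]
  ext n
  by_cases h : n = 2
  · subst h; simp
  · rw [Pi.single_eq_of_ne h]
    have h2 : (n : ℕ) ≠ 2 := fun h2 => h (PNat.eq h2)
    obtain h3 | h3 : (n : ℕ) - 1 = 0 ∨ (n : ℕ) - 1 - 1 ≠ 0 := by omega
    · simp [h3]
    · simp [h3]

theorem deriv3_bvec_zero {R : ℝ} (hR : 0 < R) :
    deriv (deriv (deriv (bvec R))) 0 = (2 : ℂ) • unitVec R 3 := by
  apply coords_injective hR
  rw [coords_deriv3_bvec (by simpa using hR), coords_smul, coords_unitVec hR]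
  ext n
  by_cases h : n = 3
  · subst h; simp
  · rw [Pi.smul_apply, Pi.single_eq_of_ne h]
    have h2 : (n : ℕ) ≠ 3 := fun h2 => h (PNat.eq h2)
    obtain h3 | h3 | h3 : (n : ℕ) - 1 = 0 ∨ (n : ℕ) - 1 - 1 = 0 ∨ (n : ℕ) - 1 - 1 - 1 ≠ 0 := by
      omega
    · simp [h3]
    · simp [h3]
    · simp [h3]

section Taylor
variable {R : ℝ} {f : BddSeq → ℂ} {v : BddSeq}

/-- Taylor coefficients of `q ↦ f (v + [q])` at `q = 0`. -/
theorem deriv_shift (hR : 0 < R) (hf : AnalyticAt ℂ f v) :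
    AnalyticAt ℂ (fun q => f (v + bvec R q)) 0 ∧
    deriv (fun q => f (v + bvec R q)) 0 = fderiv ℂ f v (unitVec R 1) ∧
    deriv (deriv (fun q => f (v + bvec R q))) 0 =
      fderiv ℂ (fderiv ℂ f) v (unitVec R 1) (unitVec R 1) + fderiv ℂ f v (unitVec R 2) ∧
    deriv (deriv (deriv (fun q => f (v + bvec R q)))) 0 =
      fderiv ℂ (fderiv ℂ (fderiv ℂ f)) v (unitVec R 1) (unitVec R 1) (unitVec R 1) +
        3 * fderiv ℂ (fderiv ℂ f) v (unitVec R 1) (unitVec R 2) +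
        2 * fderiv ℂ f v (unitVec R 3) := by
  have hb : ∀ᶠ q : ℂ in 𝓝 0, ‖q‖ < R :=
    continuous_norm.continuousAt.eventually_lt continuousAt_const (by simpa using hR)
  have hB : AnalyticAt ℂ (bvec R) 0 := analyticAt_bvec (by simpa using hR)
  have hv0 : v + bvec R 0 = v := by rw [bvec_zero, add_zero]
  have hfa : ∀ᶠ q : ℂ in 𝓝 0, AnalyticAt ℂ f (v + bvec R q) := by
    have : ContinuousAt (fun q => v + bvec R q) 0 := hB.continuousAt.const_add v
    refine this.eventually ?_
    beta_reduce
    rw [hv0]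
    exact hf.eventually_analyticAt
  have hg : AnalyticAt ℂ (fun q => f (v + bvec R q)) 0 := by
    have h1 : AnalyticAt ℂ (fun q => v + bvec R q) 0 := analyticAt_const.add hB
    exact AnalyticAt.fun_comp (by rw [hv0]; exact hf) h1
  have hc : ∀ᶠ q : ℂ in 𝓝 0, HasDerivAt (fun q => v + bvec R q) (deriv (bvec R) q) q :=
    hb.mono fun q hq => (analyticAt_bvec hq).differentiableAt.hasDerivAt.const_add v
  have hc2 : ∀ᶠ q : ℂ in 𝓝 0, HasDerivAt (deriv (bvec R)) (deriv (deriv (bvec R)) q) q :=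
    hb.mono fun q hq => (analyticAt_bvec hq).deriv.differentiableAt.hasDerivAt
  have hc3 : HasDerivAt (deriv (deriv (bvec R))) (deriv (deriv (deriv (bvec R))) 0) 0 :=
    hB.deriv.deriv.differentiableAt.hasDerivAt
  have d1 : deriv (fun q => f (v + bvec R q)) =ᶠ[𝓝 0] fun q =>
      fderiv ℂ f (v + bvec R q) (deriv (bvec R) q) := by
    filter_upwards [hfa, hc] with q h1 h2
    exact (hasDerivAt_comp_curve (c := fun q => v + bvec R q) h1 h2).deriv
  have d2 : deriv (deriv (fun q => f (v + bvec R q))) =ᶠ[𝓝 0] fun q =>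
      fderiv ℂ (fderiv ℂ f) (v + bvec R q) (deriv (bvec R) q) (deriv (bvec R) q) +
        fderiv ℂ f (v + bvec R q) (deriv (deriv (bvec R)) q) := by
    filter_upwards [d1.eventuallyEq_nhds, hfa, hc, hc2] with q h0 h1 h2 h3
    rw [h0.deriv_eq]
    exact (hasDerivAt_fderiv_apply (c := fun q => v + bvec R q) h1 h2 h3).deriv
  refine ⟨hg, ?_, ?_, ?_⟩
  · rw [d1.self_of_nhds]
    beta_reduce
    rw [hv0, deriv_bvec_zero hR]
  · rw [d2.self_of_nhds]
    beta_reduce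
    rw [hv0, deriv_bvec_zero hR, deriv2_bvec_zero hR]
  · rw [d2.deriv_eq]
    have h1 := hfa.self_of_nhds
    have h := (hasDerivAt_fderiv2_apply (c := fun q => v + bvec R q) h1 hc.self_of_nhds
      hc2.self_of_nhds hc2.self_of_nhds).fun_add
      (hasDerivAt_fderiv_apply (c := fun q => v + bvec R q) h1 hc.self_of_nhds hc3)
    rw [h.deriv, hv0, deriv_bvec_zero hR, deriv2_bvec_zero hR, deriv3_bvec_zero hR,
      fderiv_fderiv_symm hf (unitVec R 2) (unitVec R 1), map_smul, smul_eq_mul]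
    ring

/-- Taylor coefficients of `q ↦ ∂f/∂x₁ (v + [q])` at `q = 0`. -/
theorem deriv_shift_fderiv (hR : 0 < R) (hf : AnalyticAt ℂ f v) :
    AnalyticAt ℂ (fun q => fderiv ℂ f (v + bvec R q) (unitVec R 1)) 0 ∧
    deriv (fun q => fderiv ℂ f (v + bvec R q) (unitVec R 1)) 0 =
      fderiv ℂ (fderiv ℂ f) v (unitVec R 1) (unitVec R 1) ∧
    deriv (deriv (fun q => fderiv ℂ f (v + bvec R q) (unitVec R 1))) 0 =
      fderiv ℂ (fderiv ℂ (fderiv ℂ f)) v (unitVec R 1) (unitVec R 1) (unitVec R 1) +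
        fderiv ℂ (fderiv ℂ f) v (unitVec R 1) (unitVec R 2) := by
  have hb : ∀ᶠ q : ℂ in 𝓝 0, ‖q‖ < R :=
    continuous_norm.continuousAt.eventually_lt continuousAt_const (by simpa using hR)
  have hB : AnalyticAt ℂ (bvec R) 0 := analyticAt_bvec (by simpa using hR)
  have hv0 : v + bvec R 0 = v := by rw [bvec_zero, add_zero]
  have hfa : ∀ᶠ q : ℂ in 𝓝 0, AnalyticAt ℂ f (v + bvec R q) := by
    have : ContinuousAt (fun q => v + bvec R q) 0 := hB.continuousAt.const_add v
    refine this.eventually ?_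
    beta_reduce
    rw [hv0]
    exact hf.eventually_analyticAt
  have hg : AnalyticAt ℂ (fun q => fderiv ℂ f (v + bvec R q) (unitVec R 1)) 0 := by
    have h1 : AnalyticAt ℂ (fun q => v + bvec R q) 0 := analyticAt_const.add hB
    have h2 : AnalyticAt ℂ (fun q => fderiv ℂ f (v + bvec R q)) 0 :=
      AnalyticAt.fun_comp (by rw [hv0]; exact hf.fderiv) h1
    exact ((ContinuousLinearMap.apply ℂ ℂ (unitVec R 1)).analyticAt _).fun_comp h2
  have hc : ∀ᶠ q : ℂ in 𝓝 0, HasDerivAt (fun q => v + bvec R q) (deriv (bvec R) q) q :=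
    hb.mono fun q hq => (analyticAt_bvec hq).differentiableAt.hasDerivAt.const_add v
  have hc2 : ∀ᶠ q : ℂ in 𝓝 0, HasDerivAt (deriv (bvec R)) (deriv (deriv (bvec R)) q) q :=
    hb.mono fun q hq => (analyticAt_bvec hq).deriv.differentiableAt.hasDerivAt
  have d1 : deriv (fun q => fderiv ℂ f (v + bvec R q) (unitVec R 1)) =ᶠ[𝓝 0] fun q =>
      fderiv ℂ (fderiv ℂ f) (v + bvec R q) (deriv (bvec R) q) (unitVec R 1) := by
    filter_upwards [hfa, hc] with q h1 h2
    rw [(hasDerivAt_fderiv_apply (c := fun q => v + bvec R q) h1 h2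
      (hasDerivAt_const q (unitVec R 1))).deriv]
    simp
  refine ⟨hg, ?_, ?_⟩
  · rw [d1.self_of_nhds]
    beta_reduce
    rw [hv0, deriv_bvec_zero hR]
  · rw [d1.deriv_eq, (hasDerivAt_fderiv2_apply (c := fun q => v + bvec R q) hfa.self_of_nhds
      hc.self_of_nhds hc2.self_of_nhds (hasDerivAt_const 0 (unitVec R 1))).deriv, hv0,
      deriv_bvec_zero hR, deriv2_bvec_zero hR, fderiv_fderiv_symm hf (unitVec R 2) (unitVec R 1)]
    simp

end Taylor

/-- The coefficients of `q²` and `q³` in a first order difference equation. -/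
theorem second_third_order {g g₁ h : ℂ → ℂ} {t t₁ u : ℂ} (hg : AnalyticAt ℂ g 0)
    (hg₁ : AnalyticAt ℂ g₁ 0) (hh : AnalyticAt ℂ h 0)
    (H : ∀ᶠ q in 𝓝 (0 : ℂ), t * g q - q * (t * g₁ q) + q * (t₁ * g q) - h q * u = 0) :
    t * deriv (deriv g) 0 - 2 * (t * deriv g₁ 0) + 2 * (t₁ * deriv g 0) -
      deriv (deriv h) 0 * u = 0 ∧
    t * deriv (deriv (deriv g)) 0 - 3 * (t * deriv (deriv g₁) 0) +
      3 * (t₁ * deriv (deriv g) 0) - deriv (deriv (deriv h)) 0 * u = 0 := by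
  have step : ∀ (a : ℂ) (G G₀ G₁ G₁' K : ℂ → ℂ), AnalyticAt ℂ G 0 → AnalyticAt ℂ G₀ 0 →
      AnalyticAt ℂ G₁ 0 → AnalyticAt ℂ G₁' 0 → AnalyticAt ℂ K 0 →
      (∀ᶠ q in 𝓝 (0 : ℂ), t * G q - (a * (t * G₁' q) + q * (t * G₁ q)) +
        (a * (t₁ * G₀ q) + q * (t₁ * G q)) - K q * u = 0) →
      ∀ᶠ q in 𝓝 (0 : ℂ), t * deriv G q -
        (a * (t * deriv G₁' q) + (1 * (t * G₁ q) + q * (t * deriv G₁ q))) +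
        (a * (t₁ * deriv G₀ q) + (1 * (t₁ * G q) + q * (t₁ * deriv G q))) - deriv K q * u = 0 := by
    intro a G G₀ G₁ G₁' K h1 h2 h3 h4 h5 hev
    filter_upwards [hev.eventually_nhds, h1.eventually_analyticAt, h2.eventually_analyticAt,
      h3.eventually_analyticAt, h4.eventually_analyticAt, h5.eventually_analyticAt] with
      q q0 q1 q2 q3 q4 q5
    have e1 := q1.differentiableAt.hasDerivAt
    have e2 := q2.differentiableAt.hasDerivAt
    have e3 := q3.differentiableAt.hasDerivAt
    have e4 := q4.differentiableAt.hasDerivAt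
    have e5 := q5.differentiableAt.hasDerivAt
    have hid := hasDerivAt_id' q
    have e := (((e1.const_mul t).fun_sub (((e4.const_mul t).const_mul a).fun_add
      (hid.fun_mul (e3.const_mul t)))).fun_add (((e2.const_mul t₁).const_mul a).fun_add
      (hid.fun_mul (e1.const_mul t₁)))).fun_sub (e5.mul_const u)
    exact e.unique ((hasDerivAt_const q (0 : ℂ)).congr_of_eventuallyEq q0)
  -- In the `a`-th derivative of the equation, Leibniz's rule for the factor `q` produces `a` times
  -- the derivative of order `a - 1`; `G₀` and `G₁'` stand for the functions of this lower order.
  have H1 := step 0 g g g₁ g₁ h hg hg hg₁ hg₁ hh (H.mono fun q hq => by linear_combination hq)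
  have H2 := step 1 (deriv g) g (deriv g₁) g₁ (deriv h) hg.deriv hg hg₁.deriv hg₁ hh.deriv
    (H1.mono fun q hq => by linear_combination hq)
  have H3 := step 2 (deriv (deriv g)) (deriv g) (deriv (deriv g₁)) (deriv g₁) (deriv (deriv h))
    hg.deriv.deriv hg.deriv hg₁.deriv.deriv hg₁.deriv hh.deriv.deriv
    (H2.mono fun q hq => by linear_combination hq)
  exact ⟨by linear_combination H2.self_of_nhds, by linear_combination H3.self_of_nhds⟩

section KP
variable {R : ℝ} {U : Set Times} {τ : ℤ → Times → ℂ}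

/-- The first order part in `p` of the Hirota–Miwa equation at `p = 0`. -/
theorem firstOrder_KP (hU : IsDomain R U) (hol : ∀ n, IsHolomorphic R U (τ n))
    (hier : IsModifiedKP R U τ) (n : ℤ) {y : BddSeq} {q : ℂ} {ρ : ℝ} (hρR : ρ < R)
    (hq : ‖q‖ ≤ ρ) (h : DiscIn R U ρ (y + bvec R q) y) :
    ∀ᶠ r in 𝓝 q, τ n (coords R y) * τ (n + 1) (coords R (y + bvec R r)) -
      r * (τ n (coords R y) *
        fderiv ℂ (fun v => τ (n + 1) (coords R v)) (y + bvec R r) (unitVec R 1)) +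
      r * (fderiv ℂ (fun v => τ n (coords R v)) y (unitVec R 1) *
        τ (n + 1) (coords R (y + bvec R r))) -
      τ n (coords R (y + bvec R r)) * τ (n + 1) (coords R y) = 0 := by
  have hρ : 0 ≤ ρ := (norm_nonneg q).trans hq
  have hR : 0 < R := hρ.trans_lt hρR
  have hB : AnalyticAt ℂ (bvec R) 0 := analyticAt_bvec (by simpa using hR)
  have H := hirotaMiwa_KP_eventually hU hol hier n (p := 0) hρ hρR (by simpa using hρ) hq
    (by rwa [bvec_zero, add_zero])
  have H1 : ∀ᶠ r in 𝓝 q, ∀ᶠ p in 𝓝 (0 : ℂ), (p - r) * (τ n (coords R y) *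
        τ (n + 1) (coords R (y + bvec R p + bvec R r))) +
      r * (τ n (coords R (y + bvec R p)) * τ (n + 1) (coords R (y + bvec R r))) -
      p * (τ n (coords R (y + bvec R r)) * τ (n + 1) (coords R (y + bvec R p))) = 0 := by
    have c : Tendsto (fun s : ℂ × ℂ => (y, s.2, s.1)) (𝓝 q ×ˢ 𝓝 0) (𝓝 (y, 0, q)) := by
      rw [← nhds_prod_eq]
      exact (by fun_prop : Continuous fun s : ℂ × ℂ => (y, s.2, s.1)).tendsto (q, 0)
    exact (c.eventually H).curry
  have hy : y ∈ coords R ⁻¹' U := by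
    have := (h 0 (by simpa using hρ)).1
    rwa [bvec_zero, add_zero] at this
  have hyq : ∀ᶠ r in 𝓝 q, y + bvec R r ∈ coords R ⁻¹' U := by
    have c : ContinuousAt (fun r => y + bvec R r) q :=
      (analyticAt_bvec (hq.trans_lt hρR)).continuousAt.const_add y
    exact c.eventually (hU.2.mem_nhds (h q hq).1)
  filter_upwards [H1, hyq] with r r1 r2
  have hb := hB.differentiableAt.hasDerivAt
  have a1 := hasDerivAt_comp_curve (f := fun v => τ (n + 1) (coords R v)) (t := 0)
    (c := fun p => y + bvec R p + bvec R r) (by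
      simp only [bvec_zero, add_zero]; exact hol (n + 1) _ r2) ((hb.const_add y).add_const _)
  have a2 := hasDerivAt_comp_curve (f := fun v => τ n (coords R v)) (t := 0)
    (c := fun p => y + bvec R p) (by
      simp only [bvec_zero, add_zero]; exact hol n _ hy) (hb.const_add y)
  have a3 := hasDerivAt_comp_curve (f := fun v => τ (n + 1) (coords R v)) (t := 0)
    (c := fun p => y + bvec R p) (by
      simp only [bvec_zero, add_zero]; exact hol (n + 1) _ hy) (hb.const_add y)
  have hid := hasDerivAt_id' (0 : ℂ)
  have e := (((hid.sub_const r).fun_mul (a1.const_mul (τ n (coords R y)))).fun_add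
    ((a2.mul_const (τ (n + 1) (coords R (y + bvec R r)))).const_mul r)).fun_sub
    (hid.fun_mul (a3.const_mul (τ n (coords R (y + bvec R r)))))
  have e' := e.unique ((hasDerivAt_const (0 : ℂ) (0 : ℂ)).congr_of_eventuallyEq r1)
  simp only [bvec_zero, add_zero, deriv_bvec_zero hR] at e'
  linear_combination e'

/-- The equations of weight two and three of the modified KP hierarchy, that is,
`(D₁² + D₂) τₙ · τₙ₊₁ = 0` and `(D₁³ - 3 D₁ D₂ - 4 D₃) τₙ · τₙ₊₁ = 0` up to a multiple of a
derivative of the former. -/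
theorem weight_two_three (hR : 0 < R) (hU : IsDomain R U) (hol : ∀ n, IsHolomorphic R U (τ n))
    (hier : IsModifiedKP R U τ) (n : ℤ) {v : BddSeq} (hv : coords R v ∈ U) {t u : BddSeq → ℂ}
    (ht : t = fun v => τ n (coords R v)) (hu : u = fun v => τ (n + 1) (coords R v)) :
    t v * (fderiv ℂ u v (unitVec R 2) - fderiv ℂ (fderiv ℂ u) v (unitVec R 1) (unitVec R 1)) +
      2 * (fderiv ℂ t v (unitVec R 1) * fderiv ℂ u v (unitVec R 1)) -
      (fderiv ℂ (fderiv ℂ t) v (unitVec R 1) (unitVec R 1) + fderiv ℂ t v (unitVec R 2)) * u v = 0 ∧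
    t v * (2 * fderiv ℂ u v (unitVec R 3) -
        2 * fderiv ℂ (fderiv ℂ (fderiv ℂ u)) v (unitVec R 1) (unitVec R 1) (unitVec R 1)) +
      3 * (fderiv ℂ t v (unitVec R 1) *
        (fderiv ℂ (fderiv ℂ u) v (unitVec R 1) (unitVec R 1) + fderiv ℂ u v (unitVec R 2))) -
      (fderiv ℂ (fderiv ℂ (fderiv ℂ t)) v (unitVec R 1) (unitVec R 1) (unitVec R 1) +
        3 * fderiv ℂ (fderiv ℂ t) v (unitVec R 1) (unitVec R 2) +
        2 * fderiv ℂ t v (unitVec R 3)) * u v = 0 := by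
  have hta : AnalyticAt ℂ t v := by rw [ht]; exact hol n v hv
  have hua : AnalyticAt ℂ u v := by rw [hu]; exact hol (n + 1) v hv
  obtain ⟨g0, g1, g2, g3⟩ := deriv_shift hR hua
  obtain ⟨k0, k1, k2⟩ := deriv_shift_fderiv hR hua
  obtain ⟨h0, h1, h2, h3⟩ := deriv_shift hR hta
  -- At `q = 0` the disc degenerates to the point `v`.
  have H := firstOrder_KP hU hol hier n (y := v) (q := 0) (ρ := 0) hR (by simp) (by
    intro w hw
    have : w = 0 := by simpa using hw
    simpa [this, bvec_zero] using hv)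
  obtain ⟨e2, e3⟩ := second_third_order (t := t v) (t₁ := fderiv ℂ t v (unitVec R 1)) (u := u v)
    g0 k0 h0 (by simpa only [ht, hu] using H)
  rw [g1, g2, k1, h2] at e2
  rw [g2, g3, k2, h3] at e3
  exact ⟨by linear_combination e2, by linear_combination e3⟩

end KP

end

/-! ### The second Painlevé equation and the Darboux chain from the modified KP hierarchy -/

section

theorem sum_rootKP {N : ℕ} {d : ℤ → ℂ} (hd : ∀ n, d (n + N) = d n) :
    ∑ n ∈ Finset.range N, rootKP d n = N := by
  have h1 := sum_range_shift hd (-1)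
  have h2 := sum_range_shift hd 1
  have e1 : ∑ k ∈ Finset.range N, d ((k : ℤ) - 1) = ∑ k ∈ Finset.range N, d k := by
    rw [← h1]; exact Finset.sum_congr rfl fun k _ => by ring_nf
  have e2 : ∑ k ∈ Finset.range N, d ((k : ℤ) + 1) = ∑ k ∈ Finset.range N, d k := by
    rw [← h2]; exact Finset.sum_congr rfl fun k _ => by ring_nf
  simp only [rootKP, Finset.sum_add_distrib, Finset.sum_sub_distrib, ← Finset.mul_sum, e1, e2]
  simp
  ring

theorem rootKP_periodic {N : ℕ} {d : ℤ → ℂ} (hd : ∀ n, d (n + N) = d n) (n : ℤ) :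
    rootKP d (n + N) = rootKP d n := by
  have h1 := hd (n - 1)
  have h2 := hd n
  have h3 := hd (n + 1)
  rw [show n - 1 + (N : ℤ) = n + N - 1 by ring] at h1
  rw [show n + 1 + (N : ℤ) = n + N + 1 by ring] at h3
  rw [rootKP, rootKP, h1, h2, h3]

/-- The Darboux chain as a consequence of the bilinear equation of weight two. -/
theorem darbouxChain_of_bilinear {N : ℕ} {σ σ₁ : ℤ → ℂ → ℂ} {σ₂ d : ℤ → ℂ} {x : ℂ}
    (h1 : ∀ n, ∀ᶠ y in 𝓝 x, HasDerivAt (σ n) (σ₁ n y) y)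
    (h2 : ∀ n, HasDerivAt (σ₁ n) (σ₂ n) x) (hp : ∀ n, σ (n + N) =ᶠ[𝓝 x] σ n)
    (hd : ∀ n, d (n + N) = d n) (h0 : ∀ n, σ n x ≠ 0)
    (hb : ∀ n, σ n x * (x * σ₁ (n + 1) x - d (n + 1) * σ (n + 1) x - σ₂ (n + 1)) +
      2 * (σ₁ n x * σ₁ (n + 1) x) - (σ₂ n + x * σ₁ n x - d n * σ n x) * σ (n + 1) x = 0) :
    IsDarbouxChainAt N (rootKP d) (wKP σ) x := by
  set L : ℤ → ℂ → ℂ := fun n y => σ₁ n y / σ n y with hL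
  have hne : ∀ n, ∀ᶠ y in 𝓝 x, σ n y ≠ 0 := fun n =>
    (h1 n).self_of_nhds.continuousAt.eventually_ne (h0 n)
  have hw : ∀ n, wKP σ n =ᶠ[𝓝 x] fun y => y / 2 + (L n y - L (n + 1) y) := by
    intro n
    filter_upwards [h1 n, h1 (n + 1), hne n, hne (n + 1)] with y y1 y2 y3 y4
    rw [wKP, hirota_one y1 y2, hL]
    field_simp
  have hLd : ∀ n, HasDerivAt (L n) (σ₂ n / σ n x - L n x ^ 2) x := by
    intro n
    refine HasDerivAt.congr_deriv ((h2 n).fun_div (h1 n).self_of_nhds (h0 n)) ?_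
    have := h0 n
    simp only [hL]
    field_simp
  have hLp : ∀ n, L (n + N) x = L n x := by
    intro n
    have e := ((h1 (n + N)).self_of_nhds.congr_of_eventuallyEq (hp n).symm).unique
      (h1 n).self_of_nhds
    simp only [hL, e, (hp n).self_of_nhds]
  have hwd : ∀ n, HasDerivAt (wKP σ n)
      (1 / 2 + ((σ₂ n / σ n x - L n x ^ 2) - (σ₂ (n + 1) / σ (n + 1) x - L (n + 1) x ^ 2))) x :=
    fun n => (((hasDerivAt_id' x).div_const 2).fun_add
      ((hLd n).fun_sub (hLd (n + 1)))).congr_of_eventuallyEq (hw n)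
  have hb' : ∀ n, x * L (n + 1) x - d (n + 1) - σ₂ (n + 1) / σ (n + 1) x +
      2 * (L n x * L (n + 1) x) - (σ₂ n / σ n x + x * L n x - d n) = 0 := by
    intro n
    have e1 := h0 n
    have e2 := h0 (n + 1)
    simp only [hL]
    field_simp
    linear_combination hb n
  refine ⟨rootKP_periodic hd, fun n => ?_, sum_rootKP hd, ?_, fun n => (hwd n).differentiableAt,
    fun n => ?_⟩
  · rw [(hw n).self_of_nhds, (hw (n + N)).self_of_nhds]
    beta_reduce
    have := hLp (n + 1)
    rw [show n + 1 + (N : ℤ) = n + N + 1 by ring] at this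
    rw [hLp n, this]
  · rw [Finset.sum_congr rfl fun (n : ℕ) _ => (hw n).self_of_nhds, Finset.sum_add_distrib]
    have := Finset.sum_range_sub' (fun n : ℕ => L n x) N
    push_cast at this
    rw [this]
    have e := hLp 0
    rw [zero_add] at e
    rw [e]
    simp
    ring
  · refine HasDerivAt.congr_deriv ((hwd n).fun_add (hwd (n - 1))) ?_
    rw [(hw n).self_of_nhds, (hw (n - 1)).self_of_nhds, rootKP]
    have e1 := hb' n
    have e2 := hb' (n - 1)
    rw [sub_add_cancel] at e2 ⊢
    linear_combination e1 - e2

/-- The symmetric form of `P_II` as a consequence of the bilinear equations of weight two and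
three. -/
theorem symmetricPII_of_bilinear {σ : ℤ → ℂ → ℂ} {t₁ t₂ u₁ u₂ : ℂ → ℂ} {t₃ u₃ x d₀ d₁ : ℂ}
    {α : ℤ → ℂ} (ht : ∀ᶠ y in 𝓝 x, HasDerivAt (σ 0) (t₁ y) y)
    (ht₁ : ∀ᶠ y in 𝓝 x, HasDerivAt t₁ (t₂ y) y) (ht₂ : HasDerivAt t₂ t₃ x)
    (hu : ∀ᶠ y in 𝓝 x, HasDerivAt (σ 1) (u₁ y) y)
    (hu₁ : ∀ᶠ y in 𝓝 x, HasDerivAt u₁ (u₂ y) y) (hu₂ : HasDerivAt u₂ u₃ x)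
    (hp : σ 2 =ᶠ[𝓝 x] σ 0) (h0 : σ 0 x ≠ 0) (h1 : σ 1 x ≠ 0)
    (hA : ∀ᶠ y in 𝓝 x, t₂ y * σ 1 y - 2 * (t₁ y * u₁ y) + σ 0 y * u₂ y = 0)
    (hB : x * (σ 0 x * u₁ x - t₁ x * σ 1 x) + (d₀ - d₁) * (σ 0 x * σ 1 x) - σ 0 x * u₃ +
      σ 1 x * t₃ + 3 * (t₁ x * u₂ x - u₁ x * t₂ x) = 0)
    (hα₀ : α 0 = 2 * (d₁ - d₀) + 1) (hα₁ : α 1 = 2 * (d₀ - d₁) + 1) :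
    IsSymmetricPIIAt α (qII σ) (fII σ) x := by
  have hne0 : ∀ᶠ y in 𝓝 x, σ 0 y ≠ 0 := ht.self_of_nhds.continuousAt.eventually_ne h0
  have hne1 : ∀ᶠ y in 𝓝 x, σ 1 y ≠ 0 := hu.self_of_nhds.continuousAt.eventually_ne h1
  have hq : qII σ =ᶠ[𝓝 x] fun y => t₁ y / σ 0 y - u₁ y / σ 1 y := by
    filter_upwards [ht, hu, hne0, hne1] with y y1 y2 y3 y4
    rw [qII, hirota_one y1 y2]
    field_simp
  have hf : ∀ (n : ℤ) (s₁ s₂ : ℂ → ℂ), (∀ᶠ y in 𝓝 x, HasDerivAt (σ (n + 1)) (s₁ y) y) →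
      (∀ᶠ y in 𝓝 x, HasDerivAt s₁ (s₂ y) y) → (σ (n + 1) x ≠ 0) →
      fII σ n =ᶠ[𝓝 x] fun y => y / 2 - 2 * (s₂ y / σ (n + 1) y - (s₁ y / σ (n + 1) y) ^ 2) := by
    intro n s₁ s₂ e1 e2 e3
    filter_upwards [e1.eventually_nhds, e2, e1.self_of_nhds.continuousAt.eventually_ne e3]
      with y y1 y2 y3
    rw [fII, hirota_two y1 y2]
    field_simp
  have hf₀ := hf 0 u₁ u₂ hu hu₁ h1
  have hf₁ : fII σ 1 =ᶠ[𝓝 x] fun y => y / 2 - 2 * (t₂ y / σ 0 y - (t₁ y / σ 0 y) ^ 2) := by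
    have e1 : ∀ᶠ y in 𝓝 x, HasDerivAt (σ (1 + 1)) (t₁ y) y := by
      filter_upwards [ht, hp.eventuallyEq_nhds] with y y1 y2
      exact y1.congr_of_eventuallyEq y2
    have e2 : σ (1 + 1) x ≠ 0 := fun h => h0 (hp.self_of_nhds ▸ h)
    filter_upwards [hf 1 t₁ t₂ e1 ht₁ e2, hp] with y y1 y2
    rw [y1, show (1 + 1 : ℤ) = 2 by norm_num, y2]
  have hf₀' : fII σ 0 =ᶠ[𝓝 x] fun y => y / 2 - 2 * (u₂ y / σ 1 y - (u₁ y / σ 1 y) ^ 2) := hf₀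
  have a0 := ht.self_of_nhds
  have a1 := ht₁.self_of_nhds
  have b0 := hu.self_of_nhds
  have b1 := hu₁.self_of_nhds
  have A := hA.self_of_nhds
  have A' := (((ht₂.fun_mul b0).fun_sub ((a1.fun_mul b1).const_mul 2)).fun_add
    (a0.fun_mul hu₂)).unique ((hasDerivAt_const x (0 : ℂ)).congr_of_eventuallyEq hA)
  have L : ∀ {s s₁ s₂ : ℂ → ℂ} {s₃ : ℂ}, HasDerivAt s (s₁ x) x → HasDerivAt s₁ (s₂ x) x →
      HasDerivAt s₂ s₃ x → s x ≠ 0 → HasDerivAt (fun y => y / 2 - 2 * (s₂ y / s y - (s₁ y / s y) ^ 2))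
        (1 / 2 - 2 * (s₃ / s x - 3 * (s₂ x / s x) * (s₁ x / s x) + 2 * (s₁ x / s x) ^ 3)) x := by
    intro s s₁ s₂ s₃ e0 e1 e2 e3
    refine HasDerivAt.congr_deriv (((hasDerivAt_id' x).div_const 2).fun_sub (((e2.fun_div e0 e3).fun_sub
      ((e1.fun_div e0 e3).fun_pow 2)).const_mul 2)) ?_
    rw [show (2 - 1 : ℕ) = 1 from rfl, pow_one]
    push_cast
    field_simp
    ring
  -- logarithmic derivatives
  have A2 : t₂ x / σ 0 x = 2 * (t₁ x / σ 0 x) * (u₁ x / σ 1 x) - u₂ x / σ 1 x := by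
    field_simp
    linear_combination A
  have A3 : t₃ / σ 0 x = t₂ x / σ 0 x * (u₁ x / σ 1 x) + t₁ x / σ 0 x * (u₂ x / σ 1 x) -
      u₃ / σ 1 x := by
    field_simp
    linear_combination A'
  have B : u₃ / σ 1 x = x * (u₁ x / σ 1 x - t₁ x / σ 0 x) + (d₀ - d₁) +
      t₃ / σ 0 x + 3 * (t₁ x / σ 0 x * (u₂ x / σ 1 x) - u₁ x / σ 1 x * (t₂ x / σ 0 x)) := by
    field_simp
    linear_combination -hB
  rw [IsSymmetricPIIAt, hq.self_of_nhds, hf₀'.self_of_nhds, hf₁.self_of_nhds, hα₀, hα₁]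
  beta_reduce
  refine ⟨?_, ?_, ?_, ?_⟩
  · refine HasDerivAt.congr_deriv (((a1.fun_div a0 h0).fun_sub (b1.fun_div b0 h1)).congr_of_eventuallyEq hq) ?_
    field_simp
    ring
  · refine HasDerivAt.congr_deriv ((L b0 b1 hu₂ h1).congr_of_eventuallyEq hf₀') ?_
    rw [A2] at A3 B
    rw [A3] at B
    generalize t₁ x / σ 0 x = T at *
    generalize u₁ x / σ 1 x = V at *
    generalize u₂ x / σ 1 x = M at *
    linear_combination -B
  · refine HasDerivAt.congr_deriv ((L a0 a1 ht₂ h0).congr_of_eventuallyEq hf₁) ?_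
    rw [A3, A2]
    rw [A2] at A3 B
    rw [A3] at B
    generalize t₁ x / σ 0 x = T at *
    generalize u₁ x / σ 1 x = V at *
    generalize u₂ x / σ 1 x = M at *
    linear_combination B
  · rw [A2]
    ring

/-- Elimination of `f₀` and `f₁` from the symmetric form: `2 q'' = f₀' - f₁' = 2 (f₀ + f₁) q + (α₀ - α₁) / 2`. -/
theorem isPIIAt_of_symmetric {α : ℤ → ℂ} {q : ℂ → ℂ} {f : ℤ → ℂ → ℂ} {x : ℂ}
    (h : ∀ᶠ y in 𝓝 x, IsSymmetricPIIAt α q f y) (hα : α 0 + α 1 = 2) :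
    IsPIIAt ((α 0 - 1) / 2) q x := by
  refine ⟨fun y => (f 0 y - f 1 y) / 2, h.mono fun y hy => hy.1, ?_⟩
  obtain ⟨-, h0, h1, h2⟩ := h.self_of_nhds
  refine HasDerivAt.congr_deriv ((h0.fun_sub h1).div_const 2) ?_
  linear_combination q x * h2 - hα / 4

section KP
variable {ℓ : ℕ} {R : ℝ} {U : Set Times} {τ : ℤ → Times → ℂ} {d : ℤ → ℂ}

/-- The degrees are determined by the functions, and are therefore periodic as well. -/
theorem IsKPSimilarity.degree_periodic (h : IsKPSimilarity ℓ R U τ d) {x : Times} (hx : x ∈ U)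
    (hg : GrowthBelow R x) (h0 : ∀ n, τ n x ≠ 0) (n : ℤ) : d (n + ℓ) = d n :=
  (h.homogeneous (n + ℓ)).degree_unique h.pos h.domain (h.holomorphic _) (h.holomorphic _)
    (h.homogeneous n) (h.periodic n) hx hg (h0 _)

/-- Derivatives of a function along a line. -/
theorem hasDerivAt_along_line {E : Type*} [NormedAddCommGroup E] [NormedSpace ℂ E] {f : E → ℂ}
    {v e : E} {x : ℂ}
    (hf : AnalyticAt ℂ f (v + x • e)) :
    HasDerivAt (fun y => f (v + y • e)) (fderiv ℂ f (v + x • e) e) x ∧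
    (∀ b, HasDerivAt (fun y => fderiv ℂ f (v + y • e) b)
      (fderiv ℂ (fderiv ℂ f) (v + x • e) e b) x) ∧
    HasDerivAt (fun y => fderiv ℂ (fderiv ℂ f) (v + y • e) e e)
      (fderiv ℂ (fderiv ℂ (fderiv ℂ f)) (v + x • e) e e e) x := by
  have hc : HasDerivAt (fun y : ℂ => v + y • e) e x := by
    simpa using ((hasDerivAt_id x).smul_const e).const_add v
  refine ⟨hasDerivAt_comp_curve (c := fun y : ℂ => v + y • e) hf hc, fun b => ?_, ?_⟩
  · simpa using hasDerivAt_fderiv_apply (c := fun y : ℂ => v + y • e) hf hc (hasDerivAt_const x b)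
  · simpa using hasDerivAt_fderiv2_apply (c := fun y : ℂ => v + y • e) hf hc
      (hasDerivAt_const x e) (hasDerivAt_const x e)

/-- A periodic family of functions consists of finitely many functions, so that all of them are nonzero
near a point where they are nonzero. -/
theorem eventually_all_ne_zero {σ : ℤ → ℂ → ℂ} {x : ℂ} {N : ℕ} (hN : 0 < N)
    (hc : ∀ n, ContinuousAt (σ n) x) (h0 : ∀ n, σ n x ≠ 0)
    (hp : ∀ᶠ y in 𝓝 x, ∀ n, σ (n + N) y = σ n y) : ∀ᶠ y in 𝓝 x, ∀ n, σ n y ≠ 0 := by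
  have h1 : ∀ᶠ y in 𝓝 x, ∀ n ∈ Finset.Ico (0 : ℤ) N, σ n y ≠ 0 := by
    rw [Filter.eventually_all_finset]
    exact fun n _ => (hc n).eventually_ne (h0 n)
  filter_upwards [h1, hp] with y y1 y2 n
  have hper : Function.Periodic (fun n => σ n y) N := y2
  have hN' : (0 : ℤ) < N := by exact_mod_cast hN
  have e : σ (n % N) y = σ n y := by
    have := (hper.int_mul (n / N)) (n % N)
    beta_reduce at this
    rw [← this]
    congr 1
    have := Int.emod_add_mul_ediv n N
    push_cast
    linarith [mul_comm (N : ℤ) (n / N)]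
  rw [← e]
  exact y1 _ (Finset.mem_Ico.2 ⟨Int.emod_nonneg n hN'.ne', Int.emod_lt_of_pos n hN'⟩)

theorem growthBelow_timesA (hR : 0 < R) (x : ℂ) : GrowthBelow R (timesA x) :=
  growthBelow_of_eventually_zero hR 2 fun n hn => by
    have h1 : n ≠ 1 := by rintro rfl; simp at hn
    have h2 : n ≠ 2 := by rintro rfl; simp at hn
    simp [timesA, h1, h2]

theorem growthBelow_timesII (hR : 0 < R) (x : ℂ) : GrowthBelow R (timesII x) :=
  growthBelow_of_eventually_zero hR 3 fun n hn => by
    have h1 : n ≠ 1 := by rintro rfl; simp at hn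
    have h2 : n ≠ 3 := by rintro rfl; simp at hn
    simp [timesII, h1, h2]

theorem coords_lineA (hR : 0 < R) (x : ℂ) :
    coords R (vec R (timesA 0) + x • unitVec R 1) = timesA x := by
  rw [coords_add, coords_smul, coords_vec hR (growthBelow_timesA hR 0), coords_unitVec hR]
  ext n
  by_cases h : n = 1 <;> simp [timesA, h]

theorem coords_lineII (hR : 0 < R) (x : ℂ) :
    coords R (vec R (timesII 0) + x • unitVec R 1) = timesII x := by
  rw [coords_add, coords_smul, coords_vec hR (growthBelow_timesII hR 0), coords_unitVec hR]
  ext n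
  by_cases h : n = 1 <;> simp [timesII, h]

theorem vec_timesA (hR : 0 < R) (x : ℂ) :
    vec R (timesA x) = vec R (timesA 0) + x • unitVec R 1 :=
  (eq_vec hR (growthBelow_timesA hR x) (coords_lineA hR x)).symm

theorem vec_timesII (hR : 0 < R) (x : ℂ) :
    vec R (timesII x) = vec R (timesII 0) + x • unitVec R 1 :=
  (eq_vec hR (growthBelow_timesII hR x) (coords_lineII hR x)).symm

theorem euler_timesA (hR : 0 < R) (x : ℂ) :
    vec R (fun n => (n : ℂ) * timesA x n) = x • unitVec R 1 - unitVec R 2 := by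
  refine (eq_vec hR (growthBelow_timesA hR x).euler ?_).symm
  rw [coords_sub, coords_smul, coords_unitVec hR, coords_unitVec hR]
  ext n
  by_cases h : n = 1
  · subst h; simp [timesA]
  · by_cases h' : n = 2
    · subst h'; simp [timesA]; norm_num
    · simp [timesA, h, h']

theorem euler_timesII (hR : 0 < R) (x : ℂ) :
    vec R (fun n => (n : ℂ) * timesII x n) = x • unitVec R 1 - (4 : ℂ) • unitVec R 3 := by
  refine (eq_vec hR (growthBelow_timesII hR x).euler ?_).symm
  rw [coords_sub, coords_smul, coords_smul, coords_unitVec hR, coords_unitVec hR]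
  ext n
  by_cases h : n = 1
  · subst h; simp [timesII]
  · by_cases h' : n = 3
    · subst h'; simp [timesII]; norm_num
    · simp [timesII, h, h']

theorem eventually_mem_lineA (hR : 0 < R) (hU : IsDomain R U) {x : ℂ} (hx : timesA x ∈ U) :
    ∀ᶠ y in 𝓝 x, timesA y ∈ U := by
  have hc : Continuous fun y : ℂ => vec R (timesA 0) + y • unitVec R 1 := by fun_prop
  filter_upwards [hc.continuousAt.eventually (hU.2.mem_nhds (x := vec R (timesA 0) +
    x • unitVec R 1) (by rwa [Set.mem_preimage, coords_lineA hR]))] with y hy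
  have : coords R (vec R (timesA 0) + y • unitVec R 1) ∈ U := hy
  rwa [coords_lineA hR] at this

theorem eventually_mem_lineII (hR : 0 < R) (hU : IsDomain R U) {x : ℂ} (hx : timesII x ∈ U) :
    ∀ᶠ y in 𝓝 x, timesII y ∈ U := by
  have hc : Continuous fun y : ℂ => vec R (timesII 0) + y • unitVec R 1 := by fun_prop
  filter_upwards [hc.continuousAt.eventually (hU.2.mem_nhds (x := vec R (timesII 0) +
    x • unitVec R 1) (by rwa [Set.mem_preimage, coords_lineII hR]))] with y hy
  have : coords R (vec R (timesII 0) + y • unitVec R 1) ∈ U := hy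
  rwa [coords_lineII hR] at this

/-- The Darboux chain for homogeneous periodic solutions: homogeneity expresses `∂τₙ/∂x₂` by
`x ∂τₙ/∂x₁` in the bilinear equation of weight two. -/
theorem IsKPSimilarity.darbouxChain (h : IsKPSimilarity ℓ R U τ d) {x : ℂ} (hx : timesA x ∈ U)
    (h0 : ∀ n, τ n (timesA x) ≠ 0) :
    IsDarbouxChainAt ℓ (rootKP d) (wKP fun n y => τ n (timesA y)) x := by
  have hR := h.pos
  set v := vec R (timesA 0)
  set e := unitVec R 1
  set f : ℤ → BddSeq → ℂ := fun n v => τ n (coords R v) with hf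
  have hfv : ∀ n y, τ n (timesA y) = f n (v + y • e) := fun n y => by
    rw [hf]; beta_reduce; rw [coords_lineA hR]
  have hfa : ∀ᶠ y in 𝓝 x, ∀ n, AnalyticAt ℂ (f n) (v + y • e) := by
    filter_upwards [eventually_mem_lineA hR h.domain hx] with y hy n
    exact h.holomorphic n _ (by rwa [Set.mem_preimage, coords_lineA hR])
  have hfx := hfa.self_of_nhds
  have hσ : (fun n y => τ n (timesA y)) = fun n y => f n (v + y • e) := by
    ext n y; exact hfv n y
  have hom : ∀ n, fderiv ℂ (f n) (v + x • e) (unitVec R 2) =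
      x * fderiv ℂ (f n) (v + x • e) e - d n * f n (v + x • e) := by
    intro n
    have e1 := (h.homogeneous n).fderiv_euler hR (h.holomorphic n) hx (growthBelow_timesA hR x)
    rw [euler_timesA hR, map_sub, map_smul, vec_timesA hR, hfv, smul_eq_mul] at e1
    linear_combination -e1
  rw [hσ]
  refine darbouxChain_of_bilinear (σ₁ := fun n y => fderiv ℂ (f n) (v + y • e) e)
    (fun n => hfa.mono fun y hy => (hasDerivAt_along_line (hy n)).1)
    (fun n => (hasDerivAt_along_line (hfx n)).2.1 e) (fun n => ?_)
    (h.degree_periodic hx (growthBelow_timesA hR x) h0) (fun n => by rw [← hfv]; exact h0 n)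
    fun n => ?_
  · filter_upwards [eventually_mem_lineA hR h.domain hx] with y hy
    rw [← hfv, ← hfv]
    exact h.periodic n _ hy
  · have := (weight_two_three hR h.domain h.holomorphic h.hierarchy n (v := v + x • e)
      (by rwa [coords_lineA hR]) (t := f n) (u := f (n + 1)) rfl rfl).1
    rw [hom, hom] at this
    linear_combination this

theorem IsKPSimilarity.continuousAt_lineA (h : IsKPSimilarity ℓ R U τ d) {x : ℂ}
    (hx : timesA x ∈ U) (n : ℤ) : ContinuousAt (fun y => τ n (timesA y)) x := by
  have hc : Continuous fun y : ℂ => vec R (timesA 0) + y • unitVec R 1 := by fun_prop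
  have := ContinuousAt.comp (g := fun v => τ n (coords R v)) (x := x) (h.holomorphic n _ (by
    rwa [Set.mem_preimage, coords_lineA h.pos])).continuousAt hc.continuousAt
  refine this.congr (.of_forall fun y => ?_)
  simp only [Function.comp_apply, coords_lineA h.pos]

theorem IsKPSimilarity.isPAAt (h : IsKPSimilarity ℓ R U τ d) (hℓ : 0 < ℓ) {x : ℂ}
    (hx : timesA x ∈ U) (h0 : ∀ n, τ n (timesA x) ≠ 0) :
    IsPAAt ℓ (rootKP d) (fun n y => wKP (fun n y => τ n (timesA y)) n y +
      wKP (fun n y => τ n (timesA y)) (n - 1) y) x := by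
  have hm := eventually_mem_lineA h.pos h.domain hx
  refine isPAAt_of_darbouxChain ?_
  filter_upwards [hm, eventually_all_ne_zero hℓ (h.continuousAt_lineA hx) h0
    (hm.mono fun y hy n => h.periodic n _ hy)] with y y1 y2
  exact h.darbouxChain y1 y2

theorem IsKPSimilarity.continuousAt_lineII (h : IsKPSimilarity ℓ R U τ d) {x : ℂ}
    (hx : timesII x ∈ U) (n : ℤ) : ContinuousAt (fun y => τ n (timesII y)) x := by
  have hc : Continuous fun y : ℂ => vec R (timesII 0) + y • unitVec R 1 := by fun_prop
  have := ContinuousAt.comp (g := fun v => τ n (coords R v)) (x := x) (h.holomorphic n _ (by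
    rwa [Set.mem_preimage, coords_lineII h.pos])).continuousAt hc.continuousAt
  refine this.congr (.of_forall fun y => ?_)
  simp only [Function.comp_apply, coords_lineII h.pos]

/-- The symmetric form of `P_II` for homogeneous 2-periodic solutions: homogeneity expresses
`∂τₙ/∂x₃` by `x ∂τₙ/∂x₁` in the bilinear equation of weight three, and the equations of weight two
for `(τ₀, τ₁)` and `(τ₁, τ₂) = (τ₁, τ₀)` eliminate `x₂`. -/
theorem IsKPSimilarity.symmetricPII (h : IsKPSimilarity 2 R U τ d) {x : ℂ} (hx : timesII x ∈ U)
    (h0 : ∀ n, τ n (timesII x) ≠ 0) :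
    IsSymmetricPIIAt (rootKP d) (qII fun n y => τ n (timesII y))
      (fII fun n y => τ n (timesII y)) x := by
  have hR := h.pos
  have hm := eventually_mem_lineII hR h.domain hx
  set v := vec R (timesII 0)
  set e := unitVec R 1
  set f : ℤ → BddSeq → ℂ := fun n v => τ n (coords R v) with hf
  have hfv : ∀ n y, τ n (timesII y) = f n (v + y • e) := fun n y => by
    rw [hf]; beta_reduce; rw [coords_lineII hR]
  have hfa : ∀ᶠ y in 𝓝 x, ∀ n, AnalyticAt ℂ (f n) (v + y • e) := by
    filter_upwards [hm] with y hy n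
    exact h.holomorphic n _ (by rwa [Set.mem_preimage, coords_lineII hR])
  have hfx := hfa.self_of_nhds
  have hσ : (fun n y => τ n (timesII y)) = fun n y => f n (v + y • e) := by
    ext n y; exact hfv n y
  have hom : ∀ n, 4 * fderiv ℂ (f n) (v + x • e) (unitVec R 3) =
      x * fderiv ℂ (f n) (v + x • e) e - d n * f n (v + x • e) := by
    intro n
    have e1 := (h.homogeneous n).fderiv_euler hR (h.holomorphic n) hx (growthBelow_timesII hR x)
    rw [euler_timesII hR, map_sub, map_smul, map_smul, vec_timesII hR, hfv, smul_eq_mul,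
      smul_eq_mul] at e1
    linear_combination -e1
  have hd := h.degree_periodic hx (growthBelow_timesII hR x) h0
  have hd1 : d (-1) = d 1 := (hd (-1)).symm
  have hd2 : d 2 = d 0 := hd 0
  have hper : ∀ y, timesII y ∈ U → f 2 =ᶠ[𝓝 (v + y • e)] f 0 := by
    intro y hy
    refine Filter.mem_of_superset (h.domain.2.mem_nhds (x := v + y • e)
      (by rwa [Set.mem_preimage, coords_lineII hR])) fun w hw => h.periodic 0 _ hw
  have two : ∀ y, timesII y ∈ U →
      f 0 (v + y • e) * fderiv ℂ (f 1) (v + y • e) (unitVec R 2) -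
        fderiv ℂ (f 0) (v + y • e) (unitVec R 2) * f 1 (v + y • e) = 0 ∧
      fderiv ℂ (fderiv ℂ (f 0)) (v + y • e) e e * f 1 (v + y • e) -
        2 * (fderiv ℂ (f 0) (v + y • e) e * fderiv ℂ (f 1) (v + y • e) e) +
        f 0 (v + y • e) * fderiv ℂ (fderiv ℂ (f 1)) (v + y • e) e e = 0 := by
    intro y hy
    have hy' : coords R (v + y • e) ∈ U := by rwa [coords_lineII hR]
    have e1 := (weight_two_three hR h.domain h.holomorphic h.hierarchy 0 hy' (t := f 0)
      (u := f 1) rfl rfl).1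
    have e2 := (weight_two_three hR h.domain h.holomorphic h.hierarchy 1 hy' (t := f 1)
      (u := f 2) rfl rfl).1
    rw [(hper y hy).fderiv_eq, (hper y hy).fderiv.fderiv_eq, (hper y hy).self_of_nhds] at e2
    -- The difference of the two equations is `D₂ τ₀ · τ₁ = 0`, their sum is `D₁² τ₀ · τ₁ = 0`.
    exact ⟨by linear_combination e1 / 2 - e2 / 2, by linear_combination -e1 / 2 - e2 / 2⟩
  rw [hσ]
  refine symmetricPII_of_bilinear (t₁ := fun y => fderiv ℂ (f 0) (v + y • e) e)
    (t₂ := fun y => fderiv ℂ (fderiv ℂ (f 0)) (v + y • e) e e)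
    (u₁ := fun y => fderiv ℂ (f 1) (v + y • e) e)
    (u₂ := fun y => fderiv ℂ (fderiv ℂ (f 1)) (v + y • e) e e) (d₀ := d 0) (d₁ := d 1)
    (hfa.mono fun y hy => (hasDerivAt_along_line (hy 0)).1)
    (hfa.mono fun y hy => (hasDerivAt_along_line (hy 0)).2.1 e)
    (hasDerivAt_along_line (hfx 0)).2.2
    (hfa.mono fun y hy => (hasDerivAt_along_line (hy 1)).1)
    (hfa.mono fun y hy => (hasDerivAt_along_line (hy 1)).2.1 e)
    (hasDerivAt_along_line (hfx 1)).2.2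
    (hm.mono fun y hy => (hper y hy).self_of_nhds) (by rw [← hfv]; exact h0 0)
    (by rw [← hfv]; exact h0 1) (hm.mono fun y hy => (two y hy).2) ?_
    (by rw [rootKP]; norm_num [hd1]; ring) (by rw [rootKP]; norm_num [hd2]; ring)
  -- The difference of the two equations of weight three; its terms with `∂/∂x₂` form a multiple of
  -- the derivative in `x₁` of `D₂ τ₀ · τ₁ = 0`.
  have hx' : coords R (v + x • e) ∈ U := by rwa [coords_lineII hR]
  have e1 := (weight_two_three hR h.domain h.holomorphic h.hierarchy 0 hx' (t := f 0)
    (u := f 1) rfl rfl).2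
  have e2 := (weight_two_three hR h.domain h.holomorphic h.hierarchy 1 hx' (t := f 1)
    (u := f 2) rfl rfl).2
  rw [(hper x hx).fderiv_eq, (hper x hx).fderiv.fderiv_eq, (hper x hx).fderiv.fderiv.fderiv_eq,
    (hper x hx).self_of_nhds] at e2
  have e3 := (((hasDerivAt_along_line (hfx 0)).1.fun_mul
    ((hasDerivAt_along_line (hfx 1)).2.1 (unitVec R 2))).fun_sub
    (((hasDerivAt_along_line (hfx 0)).2.1 (unitVec R 2)).fun_mul
    (hasDerivAt_along_line (hfx 1)).1)).unique
    ((hasDerivAt_const x (0 : ℂ)).congr_of_eventuallyEq (hm.mono fun y hy => (two y hy).1))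
  have o0 := hom 0
  have o1 := hom 1
  linear_combination e1 - e2 - 3 * e3 - f 0 (v + x • e) * o1 + f 1 (v + x • e) * o0

theorem IsKPSimilarity.isPIIAt (h : IsKPSimilarity 2 R U τ d) {x : ℂ} (hx : timesII x ∈ U)
    (h0 : ∀ n, τ n (timesII x) ≠ 0) :
    IsPIIAt ((rootKP d 0 - 1) / 2) (qII fun n y => τ n (timesII y)) x := by
  have hm := eventually_mem_lineII h.pos h.domain hx
  have hs := sum_rootKP (h.degree_periodic hx (growthBelow_timesII h.pos x) h0)
  refine isPIIAt_of_symmetric (f := fII fun n y => τ n (timesII y)) ?_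
    (by simpa [Finset.sum_range_succ] using hs)
  filter_upwards [hm, eventually_all_ne_zero (N := 2) (by norm_num) (h.continuousAt_lineII hx) h0
    (hm.mono fun y hy n => h.periodic n _ hy)] with y y1 y2
  exact h.symmetricPII y1 y2

end KP

end

/-! ### The `P_III`-chain -/

section

theorem prod_Icc_div {r : ℕ → ℂ} (hr : ∀ n, r n ≠ 0) (N : ℕ) :
    ∏ n ∈ Finset.Icc 1 N, r (n - 1) / r n = r 0 / r N := by
  induction N with
  | zero => simp [hr]
  | succ N ih =>
    rw [Finset.prod_Icc_succ_top (by omega), ih, Nat.add_sub_cancel]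
    have := hr N
    have := hr (N + 1)
    field_simp

theorem sum_Icc_sub (r : ℕ → ℂ) (N : ℕ) :
    ∑ n ∈ Finset.Icc 1 N, (r n - r (n - 1)) = r N - r 0 := by
  induction N with
  | zero => simp
  | succ N ih =>
    rw [Finset.sum_Icc_succ_top (by omega), ih, Nat.add_sub_cancel]
    ring

/-- The `P_III`-chain as a consequence of three bilinear equations.  Here `v n` and `d n` are the
derivative along `∂/∂a` and the degree of the `n`-th function. -/
theorem pIIIChain_of_bilinear {ℓ : ℕ} {σ : ℤ → ℂ → ℂ → ℂ} {a s : ℂ} {A P G v d : ℤ → ℂ}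
    (hA : ∀ n, HasDerivAt (σ n a) (A n) s) (hP : ∀ n, HasDerivAt (σ n (a - 1)) (P n) s)
    (hG : ∀ n, HasDerivAt (σ n (a + 1)) (G n) s)
    (hp : ∀ n b, b = a - 1 ∨ b = a ∨ b = a + 1 → σ (n + ℓ) b s = σ n b s)
    (hv : ∀ n, v (n + ℓ) = v n) (hd : ∀ n, d (n + ℓ) = d n)
    (hA0 : ∀ n, σ n a s ≠ 0) (hP0 : ∀ n, σ n (a - 1) s ≠ 0)
    (h1 : ∀ n, σ n (a - 1) s * σ (n + 1) a s - σ n (a - 1) s * A (n + 1) + P n * σ (n + 1) a s -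
      σ n a s * σ (n + 1) (a - 1) s = 0)
    (h2 : ∀ n, σ n a s * σ (n + 1) (a + 1) s - σ n a s * G (n + 1) + A n * σ (n + 1) (a + 1) s -
      σ n (a + 1) s * σ (n + 1) a s = 0)
    (h3 : ∀ n, σ n (a - 1) s * σ (n + 1) (a + 1) s + v n * σ (n + 1) a s -
      σ n a s * σ (n + 1) a s - σ n a s * v (n + 1) = 0)
    (h4 : ∀ n, s * A n + a * v n = d n * σ n a s) :
    IsPIIIChainAt ℓ a (rootKP d) (fIII σ a) (gIII σ a) s := by
  have hpa : ∀ n, σ (n + ℓ) a s = σ n a s := fun n => hp n a (by simp)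
  have hpp : ∀ n, σ (n + ℓ) (a - 1) s = σ n (a - 1) s := fun n => hp n _ (by simp)
  have hpg : ∀ n, σ (n + ℓ) (a + 1) s = σ n (a + 1) s := fun n => hp n _ (by simp)
  have sh : ∀ n : ℤ, n + ℓ - 1 = n - 1 + ℓ := fun n => by ring
  have hf : ∀ n, fIII σ a n s = 1 - A n / σ n a s + P (n - 1) / σ (n - 1) (a - 1) s := by
    intro n
    have e := h1 (n - 1)
    rw [sub_add_cancel] at e
    have := hA0 n
    have := hP0 (n - 1)
    rw [fIII]
    field_simp
    linear_combination -e
  have hg : ∀ n, gIII σ a n s = 1 + (v n / σ n a s - v (n - 1) / σ (n - 1) a s) := by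
    intro n
    have e := h3 (n - 1)
    rw [sub_add_cancel] at e
    have := hA0 n
    have := hA0 (n - 1)
    rw [gIII]
    field_simp
    linear_combination e
  refine ⟨rootKP_periodic hd, fun n => ?_, fun n => ?_, ?_, ?_, fun n => ?_, fun n => ?_⟩
  · rw [fIII, fIII, sh, hpa, hpp, hpp, hpa]
  · rw [gIII, gIII, sh, hpa, hpp, hpa, hpg]
  · have e := prod_Icc_div (r := fun n : ℕ => σ n a s / σ n (a - 1) s)
      (fun n => div_ne_zero (hA0 n) (hP0 n)) ℓ
    have e2 := hpa 0
    have e3 := hpp 0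
    rw [zero_add] at e2 e3
    rw [e2, e3, Nat.cast_zero, div_self (div_ne_zero (hA0 0) (hP0 0))] at e
    rw [← e]
    refine Finset.prod_congr rfl fun n hn => ?_
    rw [fIII, Nat.cast_sub (Finset.mem_Icc.1 hn).1, Nat.cast_one]
    have := hA0 n
    have := hP0 n
    have := hP0 (n - 1)
    field_simp
  · have e := sum_Icc_sub (fun n : ℕ => v n / σ n a s) ℓ
    have e2 := hpa 0
    have e3 := hv 0
    rw [zero_add] at e2 e3
    rw [e2, e3, Nat.cast_zero, sub_self] at e
    have : ∑ n ∈ Finset.Icc 1 ℓ, gIII σ a n s = ∑ n ∈ Finset.Icc 1 ℓ, (1 +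
        (v n / σ n a s - v ((n - 1 : ℕ) : ℤ) / σ ((n - 1 : ℕ) : ℤ) a s)) :=
      Finset.sum_congr rfl fun n hn => by
        rw [hg, Nat.cast_sub (Finset.mem_Icc.1 hn).1, Nat.cast_one]
    rw [this, Finset.sum_add_distrib, e]
    simp
  · refine ⟨_, ((hA (n - 1)).fun_mul (hP n)).fun_div ((hP (n - 1)).fun_mul (hA n))
      (mul_ne_zero (hP0 _) (hA0 _)), ?_⟩
    have e1 := hf n
    have e2 := hf (n + 1)
    have e3 := hg n
    have e4 := hg (n + 1)
    rw [add_sub_cancel_right] at e2 e4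
    have k : ∀ n, a * (v n / σ n a s) = d n - s * (A n / σ n a s) := fun n => by
      have := hA0 n
      field_simp
      linear_combination h4 n
    have k1 := k n
    have k2 := k (n - 1)
    have k3 := k (n + 1)
    have z1 := hA0 n
    have z2 := hA0 (n - 1)
    have z3 := hP0 n
    have z4 := hP0 (n - 1)
    have key : s * ((A (n - 1) / σ (n - 1) a s) + P n / σ n (a - 1) s -
        P (n - 1) / σ (n - 1) (a - 1) s - A n / σ n a s) =
        s * (1 - A (n + 1) / σ (n + 1) a s + P n / σ n (a - 1) s -
          (1 - A n / σ n a s + P (n - 1) / σ (n - 1) (a - 1) s)) +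
        a * (1 + (v n / σ n a s - v (n - 1) / σ (n - 1) a s) -
          (1 + (v (n + 1) / σ (n + 1) a s - v n / σ n a s))) +
        (d (n - 1) - 2 * d n + d (n + 1) + 1) - 1 := by
      linear_combination -2 * k1 + k2 + k3
    rw [e3, e4, e2, e1, rootKP, ← key, ← e1, fIII]
    field_simp
    ring
  · refine HasDerivAt.congr_deriv (((hP (n - 1)).fun_mul (hG n)).fun_div
      ((hA (n - 1)).fun_mul (hA n)) (mul_ne_zero (hA0 _) (hA0 _))) ?_
    have e := h2 (n - 1)
    have e' := h1 (n - 1)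
    rw [sub_add_cancel] at e e'
    have z1 := hA0 n
    have z2 := hA0 (n - 1)
    have z3 := hP0 (n - 1)
    have z4 := hA0 (n - 1 - 1)
    have z5 := hP0 (n - 1 - 1)
    have e1 : fIII σ a (n - 1) s * gIII σ a (n - 1) s =
        σ (n - 1) (a - 1) s * σ (n - 1) (a + 1) s / σ (n - 1) a s ^ 2 := by
      rw [fIII, gIII]
      field_simp
    rw [e1, hf n, gIII]
    field_simp
    linear_combination (-σ n a s * σ (n - 1) (a - 1) s) * e

section
variable {ℓ : ℕ} {R : ℝ} {U : Set Times} {τ : ℤ → Times → ℂ} {d : ℤ → ℂ}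

theorem coords_timesIII (hR : 1 < R) (a s : ℂ) :
    coords R (s • unitVec R 1 + a • bvec R 1) = timesIII a s := by
  rw [coords_add, coords_smul, coords_smul, coords_unitVec (one_pos.trans hR),
    coords_bvec (by simpa using hR)]
  ext n
  by_cases h : n = 1
  · subst h; simp [timesIII, bracket]
  · simp [timesIII, bracket, h]; ring

theorem growthBelow_unit (hR : 0 < R) (k : ℕ+) : GrowthBelow R (Pi.single k (1 : ℂ) : Times) :=
  growthBelow_of_eventually_zero hR k fun n hn =>
    Pi.single_eq_of_ne (M := fun _ => ℂ) (by rintro rfl; exact lt_irrefl _ hn) 1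

theorem growthBelow_timesIII (hR : 1 < R) (a s : ℂ) : GrowthBelow R (timesIII a s) := by
  rw [← coords_timesIII hR, coords_add, coords_smul, coords_smul,
    coords_unitVec (one_pos.trans hR), coords_bvec (by simpa using hR)]
  exact ((growthBelow_unit (one_pos.trans hR) 1).smul s).add
    ((growthBelow_bracket (by simpa using hR)).smul a)

theorem vec_timesIII (hR : 1 < R) (a s : ℂ) :
    vec R (timesIII a s) = s • unitVec R 1 + a • bvec R 1 :=
  (eq_vec (one_pos.trans hR) (growthBelow_timesIII hR a s) (coords_timesIII hR a s)).symm

theorem euler_timesIII (hR : 1 < R) (a s : ℂ) :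
    vec R (fun n => (n : ℂ) * timesIII a s n) = s • unitVec R 1 + a • deriv (bvec R) 1 := by
  have h0 := one_pos.trans hR
  refine (eq_vec h0 (growthBelow_timesIII hR a s).euler ?_).symm
  rw [coords_add, coords_smul, coords_smul, coords_unitVec h0,
    coords_deriv_bvec (by simpa using hR)]
  ext n
  have hn : (n : ℂ) ≠ 0 := by exact_mod_cast n.ne_zero
  by_cases h : n = 1
  · subst h; simp [timesIII]
  · simp [timesIII, h]; field_simp

theorem bracket_zero : bracket 0 = 0 := by
  ext n
  simp [bracket]

/-- The first order part in `p` of the Hirota–Miwa equation at `p = q`. -/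
theorem diagonal_derivative_KP (hU : IsDomain R U) (hol : ∀ n, IsHolomorphic R U (τ n))
    (hier : IsModifiedKP R U τ) (n : ℤ) {y : BddSeq} {q : ℂ} {ρ : ℝ} (hρR : ρ < R) (hq : ‖q‖ ≤ ρ)
    (h : DiscIn R U ρ (y + bvec R q + bvec R q) y) (hyq : coords R (y + bvec R q) ∈ U) :
    τ n (coords R y) * τ (n + 1) (coords R (y + bvec R q + bvec R q)) +
      q * (fderiv ℂ (fun v => τ n (coords R v)) (y + bvec R q) (deriv (bvec R) q) *
        τ (n + 1) (coords R (y + bvec R q))) -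
      τ n (coords R (y + bvec R q)) * τ (n + 1) (coords R (y + bvec R q)) -
      q * (τ n (coords R (y + bvec R q)) *
        fderiv ℂ (fun v => τ (n + 1) (coords R v)) (y + bvec R q) (deriv (bvec R) q)) = 0 := by
  have hρ : 0 ≤ ρ := (norm_nonneg q).trans hq
  have H := hirotaMiwa_KP_eventually hU hol hier n hρ hρR hq hq h
  have hq' := hq.trans_lt hρR
  have H1 : ∀ᶠ p in 𝓝 q, (p - q) * (τ n (coords R y) *
        τ (n + 1) (coords R (y + bvec R p + bvec R q))) +
      q * (τ n (coords R (y + bvec R p)) * τ (n + 1) (coords R (y + bvec R q))) -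
      p * (τ n (coords R (y + bvec R q)) * τ (n + 1) (coords R (y + bvec R p))) = 0 :=
    ((by fun_prop : Continuous fun p : ℂ => (y, p, q)).tendsto q).eventually H
  have hb := (analyticAt_bvec hq').differentiableAt.hasDerivAt
  have hx : coords R (y + bvec R q + bvec R q) ∈ U := by
    have := (h 0 (by simpa using hρ)).2
    rwa [bvec_zero, sub_zero] at this
  have a1 := hasDerivAt_comp_curve (f := fun v => τ (n + 1) (coords R v)) (t := q)
    (c := fun p => y + bvec R p + bvec R q) (hol (n + 1) _ hx) ((hb.const_add y).add_const _)
  have a2 := hasDerivAt_comp_curve (f := fun v => τ n (coords R v)) (t := q)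
    (c := fun p => y + bvec R p) (hol n _ hyq) (hb.const_add y)
  have a3 := hasDerivAt_comp_curve (f := fun v => τ (n + 1) (coords R v)) (t := q)
    (c := fun p => y + bvec R p) (hol (n + 1) _ hyq) (hb.const_add y)
  have hid := hasDerivAt_id' q
  have e := (((hid.sub_const q).fun_mul (a1.const_mul (τ n (coords R y)))).fun_add
    ((a2.mul_const (τ (n + 1) (coords R (y + bvec R q)))).const_mul q)).fun_sub
    (hid.fun_mul (a3.const_mul (τ n (coords R (y + bvec R q)))))
  have e' := e.unique ((hasDerivAt_const q (0 : ℂ)).congr_of_eventuallyEq H1)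
  linear_combination e'

/-- The `P_III`-chain for homogeneous periodic solutions.  The shift of `a` by one is the translation by
`[1]`, so that the discrete equations at `q = 1` are equations between `τₙ(a - 1)`, `τₙ(a)` and
`τₙ(a + 1)`. -/
theorem IsKPSimilarity.pIIIChain (h : IsKPSimilarity ℓ R U τ d) (hR : 1 < R) {a s : ℂ}
    (hU : ∀ w : ℂ, ‖w‖ ≤ 1 → timesIII (a - 1) s + bracket w ∈ U ∧ timesIII a s + bracket w ∈ U ∧
      timesIII a s - bracket w ∈ U ∧ timesIII (a + 1) s - bracket w ∈ U)
    (h0 : ∀ n, τ n (timesIII a s) ≠ 0 ∧ τ n (timesIII (a - 1) s) ≠ 0) :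
    IsPIIIChainAt ℓ a (rootKP d) (fIII (fun n a s => τ n (timesIII a s)) a)
      (gIII (fun n a s => τ n (timesIII a s)) a) s := by
  have hR0 := one_pos.trans hR
  set e := unitVec R 1
  set c : ℂ → ℂ → BddSeq := fun a s => s • e + a • bvec R 1 with hc
  have hcc : ∀ a s, coords R (c a s) = timesIII a s := coords_timesIII hR
  have hadd : ∀ b, c b s + bvec R 1 = c (b + 1) s := fun b => by
    simp only [hc, add_smul, one_smul, add_assoc]
  have hadd' : c (a - 1) s + bvec R 1 = c a s := by rw [hadd, sub_add_cancel]
  have plus : ∀ b w, ‖w‖ ≤ 1 → coords R (c b s + bvec R w) = timesIII b s + bracket w :=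
    fun b w hw => by rw [coords_add, hcc, coords_bvec (hw.trans_lt hR)]
  have minus : ∀ b w, ‖w‖ ≤ 1 → coords R (c b s - bvec R w) = timesIII b s - bracket w :=
    fun b w hw => by rw [coords_sub, hcc, coords_bvec (hw.trans_lt hR)]
  obtain ⟨m1, m2, -, m4⟩ := hU 0 (by simp)
  rw [bracket_zero, add_zero] at m1 m2
  rw [bracket_zero, sub_zero] at m4
  have hσ : (fun n a s => τ n (timesIII a s)) = fun n a s => τ n (coords R (c a s)) := by
    ext n a s; rw [hcc]
  have mem : ∀ {b}, timesIII b s ∈ U → c b s ∈ coords R ⁻¹' U := fun hb => by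
    rwa [Set.mem_preimage, hcc]
  have der : ∀ n {b}, timesIII b s ∈ U → HasDerivAt (fun s => τ n (coords R (c b s)))
      (fderiv ℂ (fun v => τ n (coords R v)) (c b s) e) s := fun n b hb => by
    refine hasDerivAt_comp_curve (f := fun v => τ n (coords R v)) (c := c b)
      (h.holomorphic n _ (mem hb)) ?_
    have := ((hasDerivAt_id s).smul_const e).add_const (b • bvec R 1)
    rwa [one_smul] at this
  rw [hσ]
  refine pIIIChain_of_bilinear
    (v := fun n => fderiv ℂ (fun v => τ n (coords R v)) (c a s) (deriv (bvec R) 1))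
    (fun n => der n m2) (fun n => der n m1) (fun n => der n m4) ?_ (fun n => ?_)
    (h.degree_periodic m2 (growthBelow_timesIII hR a s) fun n => (h0 n).1)
    (fun n => by rw [hcc]; exact (h0 n).1) (fun n => by rw [hcc]; exact (h0 n).2)
    (fun n => ?_) (fun n => ?_) (fun n => ?_) (fun n => ?_)
  · rintro n b (rfl | rfl | rfl)
    · exact h.periodic n _ (mem m1)
    · exact h.periodic n _ (mem m2)
    · exact h.periodic n _ (mem m4)
  · have : (fun v => τ (n + ℓ) (coords R v)) =ᶠ[𝓝 (c a s)] fun v => τ n (coords R v) :=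
      Filter.mem_of_superset (h.domain.2.mem_nhds (mem m2)) fun v hv => h.periodic n _ hv
    rw [this.fderiv_eq]
  · have E := (firstOrder_KP h.domain h.holomorphic h.hierarchy n (y := c (a - 1) s) (q := 1) hR
      (by simp) (fun w hw => by
        rw [hadd', plus _ _ hw, minus _ _ hw]
        exact ⟨(hU w hw).1, (hU w hw).2.2.1⟩)).self_of_nhds
    rw [hadd'] at E
    linear_combination E
  · have E := (firstOrder_KP h.domain h.holomorphic h.hierarchy n (y := c a s) (q := 1) hR
      (by simp) (fun w hw => by
        rw [hadd, plus _ _ hw, minus _ _ hw]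
        exact ⟨(hU w hw).2.1, (hU w hw).2.2.2⟩)).self_of_nhds
    rw [hadd] at E
    linear_combination E
  · have E := diagonal_derivative_KP h.domain h.holomorphic h.hierarchy n (y := c (a - 1) s)
      (q := 1) hR (by simp) (fun w hw => by
        rw [hadd', hadd, plus _ _ hw, minus _ _ hw]
        exact ⟨(hU w hw).1, (hU w hw).2.2.2⟩) (by rw [hadd', hcc]; exact m2)
    rw [hadd', hadd] at E
    linear_combination E
  · have E := (h.homogeneous n).fderiv_euler hR0 (h.holomorphic n) m2 (growthBelow_timesIII hR a s)
    rw [euler_timesIII hR, map_add, map_smul, map_smul, vec_timesIII hR, smul_eq_mul,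
      smul_eq_mul] at E
    rw [hcc]
    exact E

end

end

/-! ### Darboux chains with an even number of nodes -/

section

theorem sum_range_two_mul (w : ℤ → ℂ) (N : ℕ) :
    ∑ n ∈ Finset.range (2 * N), w n = ∑ i ∈ Finset.range N, (w (2 * i) + w (2 * i + 1)) := by
  induction N with
  | zero => simp
  | succ N ih =>
    rw [show 2 * (N + 1) = 2 * N + 1 + 1 by ring, Finset.sum_range_succ, Finset.sum_range_succ, ih,
      Finset.sum_range_succ _ N]
    push_cast
    ring

theorem rootUC_even (d : ℤ → ℤ → ℂ) (a : ℂ) (i : ℤ) :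
    rootUC d a (2 * i) = 2 * (d (i + 1) (-i) - d i (-i + 1) + a + 1) := by
  have h : (2 * i + 1) / 2 = i := by omega
  rw [rootUC, if_pos (even_two_mul i), h]

theorem rootUC_odd (d : ℤ → ℤ → ℂ) (a : ℂ) (i : ℤ) :
    rootUC d a (2 * i + 1) = 2 * (d i (-i) - d (i + 1) (-(i + 1)) - a) := by
  have h : (2 * i + 1 + 1) / 2 = i + 1 := by omega
  rw [rootUC, if_neg (Int.not_even_iff_odd.2 (odd_two_mul_add_one i)), h]
  ring_nf

theorem wUC_even (σ : ℤ → ℤ → ℂ → ℂ → ℂ) (a : ℂ) (i : ℤ) (x : ℂ) :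
    wUC σ a (2 * i) x =
      -x * uV σ a i (-i) (-x ^ 2 / 2) + (-x ^ 2 / 2 + a + 1 / 2) / (-x) := by
  have h : (2 * i + 1) / 2 = i := by omega
  rw [wUC, if_pos (even_two_mul i), h]

theorem wUC_odd (σ : ℤ → ℤ → ℂ → ℂ → ℂ) (a : ℂ) (i : ℤ) (x : ℂ) :
    wUC σ a (2 * i + 1) x =
      -x * vV σ a (i + 1) (-(i + 1)) (-x ^ 2 / 2) + (-x ^ 2 / 2 - a - 1 / 2) / (-x) := by
  have h : (2 * i + 1 + 1) / 2 = i + 1 := by omega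
  rw [wUC, if_neg (Int.not_even_iff_odd.2 (odd_two_mul_add_one i)), h]

/-- The Darboux chain with an even number of nodes as a consequence of bilinear equations for the
functions `Aᵢ = σ_{i,-i}(a)` and `Bᵢ = σ_{i+1,-i}(a + 1)`. -/
theorem darbouxChain_of_bilinear₂ {ℓ : ℕ} {σ : ℤ → ℤ → ℂ → ℂ → ℂ} {d : ℤ → ℤ → ℂ} {a x s : ℂ}
    {A B A₁ B₁ : ℤ → ℂ → ℂ} {A₂ B₂ : ℤ → ℂ} (hx : x ≠ 0) (hs : s = -x ^ 2 / 2)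
    (hAσ : ∀ i, A i = σ i (-i) a) (hBσ : ∀ i, B i = σ (i + 1) (-i) (a + 1))
    (hA : ∀ i, ∀ᶠ y in 𝓝 s, HasDerivAt (A i) (A₁ i y) y)
    (hB : ∀ i, ∀ᶠ y in 𝓝 s, HasDerivAt (B i) (B₁ i y) y)
    (hA₁ : ∀ i, HasDerivAt (A₁ i) (A₂ i) s) (hB₁ : ∀ i, HasDerivAt (B₁ i) (B₂ i) s)
    (hA0 : ∀ i, A i s ≠ 0) (hB0 : ∀ i, B i s ≠ 0)
    (hAp : ∀ i, A (i + ℓ) =ᶠ[𝓝 s] A i) (hBp : ∀ i, B (i + ℓ) =ᶠ[𝓝 s] B i)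
    (hdA : ∀ i, d (i + ℓ) (-(i + ℓ)) = d i (-i))
    (hdB : ∀ i, d (i + ℓ + 1) (-(i + ℓ)) = d (i + 1) (-i))
    (hE : ∀ i, s * A i s * (B₁ i s * B (i - 1) s + B i s * B₁ (i - 1) s + B₂ i * B (i - 1) s -
        B i s * B₂ (i - 1)) =
      2 * s * A₁ i s * (B i s * B (i - 1) s + B₁ i s * B (i - 1) s - B i s * B₁ (i - 1) s) +
        A i s * ((d (i + 1) (-i) - d i (-i + 1)) * (B i s * B (i - 1) s) -
          (a + 1) * (B₁ i s * B (i - 1) s - B i s * B₁ (i - 1) s)))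
    (hO : ∀ i, s * B i s * (A₁ (i + 1) s * A i s + A (i + 1) s * A₁ i s + A₂ (i + 1) * A i s -
        A (i + 1) s * A₂ i) =
      2 * s * B₁ i s * (A (i + 1) s * A i s + A₁ (i + 1) s * A i s - A (i + 1) s * A₁ i s) -
        B i s * ((d (i + 1) (-(i + 1)) - d i (-i)) * (A (i + 1) s * A i s) -
          a * (A₁ (i + 1) s * A i s - A (i + 1) s * A₁ i s))) :
    IsDarbouxChainAt (2 * ℓ) (rootUC d a) (wUC σ a) x := by
  set LA : ℤ → ℂ → ℂ := fun i y => A₁ i y / A i y with hLA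
  set LB : ℤ → ℂ → ℂ := fun i y => B₁ i y / B i y with hLB
  have hAne : ∀ i, ∀ᶠ y in 𝓝 s, A i y ≠ 0 := fun i =>
    (hA i).self_of_nhds.continuousAt.eventually_ne (hA0 i)
  have hBne : ∀ i, ∀ᶠ y in 𝓝 s, B i y ≠ 0 := fun i =>
    (hB i).self_of_nhds.continuousAt.eventually_ne (hB0 i)
  have hc : HasDerivAt (fun y : ℂ => -y ^ 2 / 2) (-x) x := by
    refine HasDerivAt.congr_deriv (((hasDerivAt_id' x).fun_pow 2).fun_neg.div_const 2) ?_
    push_cast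
    ring
  have hct : Tendsto (fun y : ℂ => -y ^ 2 / 2) (𝓝 x) (𝓝 s) := by
    rw [hs]; exact hc.continuousAt.tendsto
  have hwE : ∀ i, wUC σ a (2 * i) =ᶠ[𝓝 x] fun y =>
      -y * (LA i (-y ^ 2 / 2) - LB i (-y ^ 2 / 2)) + (-y ^ 2 / 2 + (a + 1 / 2)) / (-y) := by
    intro i
    filter_upwards [hct.eventually (hA i), hct.eventually (hB i), hct.eventually (hAne i),
      hct.eventually (hBne i)] with y y1 y2 y3 y4
    rw [wUC_even, uV, ← hAσ, ← hBσ, hirota_one y1 y2, add_assoc, ← div_sub_div _ _ y3 y4]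
  have hwO : ∀ i, wUC σ a (2 * i + 1) =ᶠ[𝓝 x] fun y =>
      -y * (LB i (-y ^ 2 / 2) - LA (i + 1) (-y ^ 2 / 2)) +
        (-y ^ 2 / 2 + (-a - 1 / 2)) / (-y) := by
    intro i
    filter_upwards [hct.eventually (hA (i + 1)), hct.eventually (hB i),
      hct.eventually (hAne (i + 1)), hct.eventually (hBne i)] with y y1 y2 y3 y4
    have e : B i = σ (i + 1) (-(i + 1) + 1) (a + 1) := by rw [hBσ]; congr 2; ring
    rw [wUC_odd, vV, ← hAσ, ← e, hirota_one y1 y2, ← div_sub_div _ _ y3 y4, neg_sub,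
      show -y ^ 2 / 2 - a - 1 / 2 = -y ^ 2 / 2 + (-a - 1 / 2) by ring]
  have hLAd : ∀ i, HasDerivAt (fun y => LA i (-y ^ 2 / 2))
      ((A₂ i / A i s - LA i s ^ 2) * (-x)) x := by
    intro i
    have h1 : HasDerivAt (LA i) (A₂ i / A i s - LA i s ^ 2) s := by
      refine HasDerivAt.congr_deriv ((hA₁ i).fun_div (hA i).self_of_nhds (hA0 i)) ?_
      have := hA0 i
      simp only [hLA]
      field_simp
    rw [hs] at h1 ⊢
    exact h1.comp x hc
  have hLBd : ∀ i, HasDerivAt (fun y => LB i (-y ^ 2 / 2))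
      ((B₂ i / B i s - LB i s ^ 2) * (-x)) x := by
    intro i
    have h1 : HasDerivAt (LB i) (B₂ i / B i s - LB i s ^ 2) s := by
      refine HasDerivAt.congr_deriv ((hB₁ i).fun_div (hB i).self_of_nhds (hB0 i)) ?_
      have := hB0 i
      simp only [hLB]
      field_simp
    rw [hs] at h1 ⊢
    exact h1.comp x hc
  have hk : ∀ k : ℂ, HasDerivAt (fun y : ℂ => (-y ^ 2 / 2 + k) / (-y)) (1 / 2 + k / x ^ 2) x := by
    intro k
    refine HasDerivAt.congr_deriv ((hc.add_const k).fun_div (hasDerivAt_id' x).fun_neg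
      (neg_ne_zero.2 hx)) ?_
    field_simp
    ring
  have hdE : ∀ i, HasDerivAt (wUC σ a (2 * i))
      (-(LA i s - LB i s) + x ^ 2 * ((A₂ i / A i s - LA i s ^ 2) - (B₂ i / B i s - LB i s ^ 2)) +
        (1 / 2 + (a + 1 / 2) / x ^ 2)) x := by
    intro i
    refine HasDerivAt.congr_deriv ((((hasDerivAt_id' x).fun_neg.fun_mul
      ((hLAd i).fun_sub (hLBd i))).fun_add (hk (a + 1 / 2))).congr_of_eventuallyEq (hwE i)) ?_
    rw [← hs]
    ring
  have hdO : ∀ i, HasDerivAt (wUC σ a (2 * i + 1))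
      (-(LB i s - LA (i + 1) s) + x ^ 2 * ((B₂ i / B i s - LB i s ^ 2) -
        (A₂ (i + 1) / A (i + 1) s - LA (i + 1) s ^ 2)) + (1 / 2 + (-a - 1 / 2) / x ^ 2)) x := by
    intro i
    refine HasDerivAt.congr_deriv ((((hasDerivAt_id' x).fun_neg.fun_mul
      ((hLBd i).fun_sub (hLAd (i + 1)))).fun_add (hk (-a - 1 / 2))).congr_of_eventuallyEq
      (hwO i)) ?_
    rw [← hs]
    ring
  have hvE : ∀ i, wUC σ a (2 * i) x = -x * (LA i s - LB i s) + (s + (a + 1 / 2)) / (-x) := by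
    intro i; rw [(hwE i).self_of_nhds, hs]
  have hvO : ∀ i, wUC σ a (2 * i + 1) x =
      -x * (LB i s - LA (i + 1) s) + (s + (-a - 1 / 2)) / (-x) := by
    intro i; rw [(hwO i).self_of_nhds, hs]
  have hLAp : ∀ i, LA (i + ℓ) s = LA i s := by
    intro i
    have e := ((hA (i + ℓ)).self_of_nhds.congr_of_eventuallyEq (hAp i).symm).unique
      (hA i).self_of_nhds
    simp only [hLA, e, (hAp i).self_of_nhds]
  have hLBp : ∀ i, LB (i + ℓ) s = LB i s := by
    intro i
    have e := ((hB (i + ℓ)).self_of_nhds.congr_of_eventuallyEq (hBp i).symm).unique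
      (hB i).self_of_nhds
    simp only [hLB, e, (hBp i).self_of_nhds]
  have hE' : ∀ i, s * (LB i s + LB (i - 1) s + B₂ i / B i s - B₂ (i - 1) / B (i - 1) s) =
      2 * s * LA i s * (1 + LB i s - LB (i - 1) s) +
        (d (i + 1) (-i) - d i (-i + 1) - (a + 1) * (LB i s - LB (i - 1) s)) := by
    intro i
    have e1 := hA0 i
    have e2 := hB0 i
    have e3 := hB0 (i - 1)
    simp only [hLA, hLB]
    field_simp
    linear_combination hE i
  have hO' : ∀ i, s * (LA (i + 1) s + LA i s + A₂ (i + 1) / A (i + 1) s - A₂ i / A i s) =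
      2 * s * LB i s * (1 + LA (i + 1) s - LA i s) -
        (d (i + 1) (-(i + 1)) - d i (-i) - a * (LA (i + 1) s - LA i s)) := by
    intro i
    have e1 := hB0 i
    have e2 := hA0 (i + 1)
    have e3 := hA0 i
    simp only [hLA, hLB]
    field_simp
    linear_combination hO i
  have hpairs : ∀ n : ℤ, (∃ i, n = 2 * i) ∨ ∃ i, n = 2 * i + 1 := fun n => by
    obtain ⟨i, hi⟩ := Int.even_or_odd' n
    exact hi.imp (fun h => ⟨i, h⟩) (fun h => ⟨i, h⟩)
  have sh1 : ∀ i : ℤ, 2 * i + ((2 * ℓ : ℕ) : ℤ) = 2 * (i + ℓ) := fun i => by push_cast; ring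
  have sh2 : ∀ i : ℤ, 2 * i + 1 + ((2 * ℓ : ℕ) : ℤ) = 2 * (i + ℓ) + 1 := fun i => by
    push_cast; ring
  have sh3 : ∀ i : ℤ, i + ℓ + 1 = i + 1 + ℓ := fun i => by ring
  have hdB' : ∀ i, d (i + ℓ) (-(i + ℓ) + 1) = d i (-i + 1) := by
    intro i
    have := hdB (i - 1)
    rwa [show i - 1 + (ℓ : ℤ) + 1 = i + ℓ by ring, sub_add_cancel,
      show -(i - 1 + (ℓ : ℤ)) = -(i + ℓ) + 1 by ring, show -(i - 1) = -i + 1 by ring] at this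
  refine ⟨fun n => ?_, fun n => ?_, ?_, ?_, fun n => ?_, fun n => ?_⟩
  · obtain ⟨i, rfl⟩ | ⟨i, rfl⟩ := hpairs n
    · rw [sh1, rootUC_even, rootUC_even, hdB, hdB']
    · rw [sh2, rootUC_odd, rootUC_odd, hdA, sh3, hdA]
  · obtain ⟨i, rfl⟩ | ⟨i, rfl⟩ := hpairs n
    · rw [sh1, hvE, hvE, hLAp, hLBp]
    · rw [sh2, hvO, hvO, sh3, hLAp, hLBp]
  · rw [sum_range_two_mul]
    have key : ∀ i : ℕ, rootUC d a (2 * (i : ℤ)) + rootUC d a (2 * (i : ℤ) + 1) =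
        2 + 2 * (((d (((i + 1 : ℕ) : ℤ)) (-((i + 1 : ℕ) : ℤ) + 1) -
            d ((i + 1 : ℕ) : ℤ) (-((i + 1 : ℕ) : ℤ)))) -
          (d (i : ℤ) (-(i : ℤ) + 1) - d (i : ℤ) (-(i : ℤ)))) := by
      intro i
      rw [rootUC_even, rootUC_odd]
      push_cast
      rw [show -((i : ℤ) + 1) + 1 = -(i : ℤ) by ring]
      ring
    rw [Finset.sum_congr rfl fun i _ => key i, Finset.sum_add_distrib, ← Finset.mul_sum,
      Finset.sum_range_sub (fun i : ℕ => d (i : ℤ) (-(i : ℤ) + 1) - d (i : ℤ) (-(i : ℤ)))]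
    have e1 := hdA 0
    have e2 := hdB' 0
    rw [zero_add] at e1 e2
    rw [e1, e2]
    simp
    ring
  · rw [sum_range_two_mul (fun n => wUC σ a n x)]
    have key : ∀ i : ℕ, wUC σ a (2 * (i : ℤ)) x + wUC σ a (2 * (i : ℤ) + 1) x =
        x + x * (LA ((i + 1 : ℕ) : ℤ) s - LA (i : ℤ) s) := by
      intro i
      rw [hvE, hvO, hs]
      push_cast
      field_simp
      ring
    rw [Finset.sum_congr rfl fun i _ => key i, Finset.sum_add_distrib, ← Finset.mul_sum,
      Finset.sum_range_sub (fun i : ℕ => LA (i : ℤ) s)]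
    have e1 := hLAp 0
    rw [zero_add] at e1
    rw [e1]
    simp
    ring
  · obtain ⟨i, rfl⟩ | ⟨i, rfl⟩ := hpairs n
    · exact (hdE i).differentiableAt
    · exact (hdO i).differentiableAt
  · obtain ⟨i, rfl⟩ | ⟨i, rfl⟩ := hpairs n
    · have e : 2 * i - 1 = 2 * (i - 1) + 1 := by ring
      rw [e]
      refine HasDerivAt.congr_deriv ((hdE i).fun_add (hdO (i - 1))) ?_
      rw [hvE, hvO, rootUC_even, sub_add_cancel]
      have h1 := hE' i
      generalize LA i s = p at *
      generalize LB i s = q at *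
      generalize LB (i - 1) s = r at *
      subst hs
      generalize B₂ i / B i _ = M₁ at *
      generalize B₂ (i - 1) / B (i - 1) _ = M₂ at *
      field_simp
      linear_combination (8 * x ^ 2) * h1
    · rw [add_sub_cancel_right]
      refine HasDerivAt.congr_deriv ((hdO i).fun_add (hdE i)) ?_
      rw [hvE, hvO, rootUC_odd]
      have h1 := hO' i
      generalize LB i s = p at *
      generalize LA i s = q at *
      generalize LA (i + 1) s = r at *
      subst hs
      generalize A₂ i / A i _ = M₁ at *
      generalize A₂ (i + 1) / A (i + 1) _ = M₂ at *
      field_simp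
      linear_combination (8 * x ^ 2) * h1

end

/-! ### Bilinear equations of the modified UC hierarchy on a diagonal -/

section

theorem coords₂_smul (R S : ℝ) (c : ℂ) (v : BddSeq₂) :
    coords₂ R S (c • v) = c • coords₂ R S v := by
  ext : 1 <;> simp [coords₂, coords_smul]

theorem coords₂_deriv {R S : ℝ} {c : ℂ → BddSeq₂} {w : ℂ} (hc : DifferentiableAt ℂ c w)
    {φ : ℂ → Times₂} (h : ∀ᶠ z in 𝓝 w, coords₂ R S (c z) = φ z) :
    coords₂ R S (deriv c w) =
      (fun n => deriv (fun z => (φ z).1 n) w, fun n => deriv (fun z => (φ z).2 n) w) := by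
  have h1 : HasDerivAt (fun z => (c z).1) (deriv c w).1 w :=
    (ContinuousLinearMap.fst ℂ BddSeq BddSeq).hasFDerivAt.comp_hasDerivAt w hc.hasDerivAt
  have h2 : HasDerivAt (fun z => (c z).2) (deriv c w).2 w :=
    (ContinuousLinearMap.snd ℂ BddSeq BddSeq).hasFDerivAt.comp_hasDerivAt w hc.hasDerivAt
  have e1 : coords R (deriv c w).1 = fun n => deriv (fun z => (φ z).1 n) w := by
    ext n
    rw [← h1.deriv]
    exact coords_deriv h1.differentiableAt (h.mono fun z hz => congrArg Prod.fst hz) n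
  have e2 : coords S (deriv c w).2 = fun n => deriv (fun z => (φ z).2 n) w := by
    ext n
    rw [← h2.deriv]
    exact coords_deriv h2.differentiableAt (h.mono fun z hz => congrArg Prod.snd hz) n
  rw [coords₂, e1, e2]

section
variable {R S : ℝ} {w : ℂ}

theorem eventually_bvec₂_domain (h0 : w ≠ 0) (h1 : ‖w‖ < R) (h2 : ‖w⁻¹‖ < S) :
    ∀ᶠ z in 𝓝 w, z ≠ 0 ∧ ‖z‖ < R ∧ ‖z⁻¹‖ < S := by
  filter_upwards [continuousAt_id.eventually_ne h0,
    continuous_norm.continuousAt.eventually_lt continuousAt_const h1,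
    (continuousAt_inv₀ h0).norm.eventually_lt continuousAt_const h2] with z z1 z2 z3
  exact ⟨z1, z2, z3⟩

theorem hasDerivAt_inv_pow {z : ℂ} (hz : z ≠ 0) (n : ℕ) :
    HasDerivAt (fun z : ℂ => z⁻¹ ^ n) (-(n * z⁻¹ ^ (n + 1))) z := by
  refine HasDerivAt.congr_deriv ((hasDerivAt_inv hz).fun_pow n) ?_
  rcases n with _ | n
  · simp
  · rw [Nat.add_sub_cancel, ← inv_pow]
    ring

theorem coords₂_deriv_bvec₂ (h0 : w ≠ 0) (h1 : ‖w‖ < R) (h2 : ‖w⁻¹‖ < S) :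
    coords₂ R S (deriv (bvec₂ R S) w) =
      (fun n : ℕ+ => w ^ ((n : ℕ) - 1), fun n : ℕ+ => -w⁻¹ ^ ((n : ℕ) + 1)) := by
  rw [coords₂_deriv (analyticAt_bvec₂ h0 h1 h2).differentiableAt
    ((eventually_bvec₂_domain h0 h1 h2).mono fun z hz => coords₂_bvec₂ hz.2.1 hz.2.2)]
  ext n
  · have hn : (n : ℂ) ≠ 0 := by exact_mod_cast n.ne_zero
    simp only [bracket₂, bracket, deriv_div_const, deriv_pow_field]
    field_simp
  · have hn : (n : ℂ) ≠ 0 := by exact_mod_cast n.ne_zero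
    simp only [bracket₂, bracket]
    rw [((hasDerivAt_inv_pow h0 n).div_const (n : ℂ)).deriv]
    field_simp

theorem coords₂_deriv2_bvec₂ (h0 : w ≠ 0) (h1 : ‖w‖ < R) (h2 : ‖w⁻¹‖ < S) :
    coords₂ R S (deriv (deriv (bvec₂ R S)) w) =
      (fun n : ℕ+ => (((n : ℕ) - 1 : ℕ) : ℂ) * w ^ ((n : ℕ) - 1 - 1),
        fun n : ℕ+ => ((n : ℂ) + 1) * w⁻¹ ^ ((n : ℕ) + 2)) := by
  rw [coords₂_deriv (analyticAt_bvec₂ h0 h1 h2).deriv.differentiableAt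
    ((eventually_bvec₂_domain h0 h1 h2).mono fun z hz =>
      coords₂_deriv_bvec₂ hz.1 hz.2.1 hz.2.2)]
  ext n
  · simp
  · change deriv (fun z : ℂ => -z⁻¹ ^ ((n : ℕ) + 1)) w = ((n : ℂ) + 1) * w⁻¹ ^ ((n : ℕ) + 2)
    rw [(hasDerivAt_inv_pow h0 ((n : ℕ) + 1)).fun_neg.deriv]
    push_cast
    ring

end

/-- Homogeneity at the point with coordinates `P`, with the Euler vector field given by its
coordinates. -/
theorem IsHomogeneous₂.fderiv_apply {R S : ℝ} (hR : 0 < R) (hS : 0 < S) {W : Set Times₂}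
    {F : Times₂ → ℂ} {d : ℂ} (hF : IsHolomorphic₂ R S W F) (h : IsHomogeneous₂ R S W F d)
    {P : Times₂} (hP : P ∈ W) (hg₁ : GrowthBelow R P.1) (hg₂ : GrowthBelow S P.2)
    {v e : BddSeq₂} (hv : coords₂ R S v = P)
    (he : coords₂ R S e = (fun n : ℕ+ => (n : ℂ) * P.1 n, fun n : ℕ+ => -((n : ℂ) * P.2 n))) :
    fderiv ℂ (fun v => F (coords₂ R S v)) v e = d * F (coords₂ R S v) := by
  have h1 : v = (vec R P.1, vec S P.2) :=
    Prod.ext (eq_vec hR hg₁ (congrArg Prod.fst hv)) (eq_vec hS hg₂ (congrArg Prod.snd hv))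
  have h2 : e = (vec R fun n => (n : ℂ) * P.1 n, -vec S fun n => (n : ℂ) * P.2 n) := by
    refine Prod.ext (eq_vec hR hg₁.euler (congrArg Prod.fst he)) ?_
    refine neg_eq_iff_eq_neg.1 (eq_vec hS hg₂.euler ?_)
    have : coords S e.2 = fun n : ℕ+ => -((n : ℂ) * P.2 n) := congrArg Prod.snd he
    rw [← neg_one_smul ℂ e.2, coords_smul, this]
    ext n
    simp
  have h3 := h.fderiv_euler hR hS hF hP hg₁ hg₂
  rw [hv, h2, h1]
  exact h3

/-- First and second derivative of a function along an analytic curve. -/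
theorem deriv_comp_analytic_curve {E : Type*} [NormedAddCommGroup E] [NormedSpace ℂ E]
    [CompleteSpace E] {f : E → ℂ} {c : ℂ → E} {t : ℂ} (hf : AnalyticAt ℂ f (c t))
    (hc : AnalyticAt ℂ c t) :
    AnalyticAt ℂ (fun s => f (c s)) t ∧
    deriv (fun s => f (c s)) t = fderiv ℂ f (c t) (deriv c t) ∧
    deriv (deriv fun s => f (c s)) t = fderiv ℂ (fderiv ℂ f) (c t) (deriv c t) (deriv c t) +
      fderiv ℂ f (c t) (deriv (deriv c) t) := by
  have hfa : ∀ᶠ s in 𝓝 t, AnalyticAt ℂ f (c s) :=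
    hc.continuousAt.eventually hf.eventually_analyticAt
  have d1 : deriv (fun s => f (c s)) =ᶠ[𝓝 t] fun s => fderiv ℂ f (c s) (deriv c s) := by
    filter_upwards [hfa, hc.eventually_analyticAt] with s h1 h2
    exact (hasDerivAt_comp_curve h1 h2.differentiableAt.hasDerivAt).deriv
  refine ⟨hf.fun_comp hc, d1.self_of_nhds, ?_⟩
  rw [d1.deriv_eq]
  exact (hasDerivAt_fderiv_apply hf hc.differentiableAt.hasDerivAt
    hc.deriv.differentiableAt.hasDerivAt).deriv

/-- The derivatives at `p = q` of an equation of Hirota–Miwa type. -/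
theorem diagonal_first_second {t a b q : ℂ} {C α β : ℂ → ℂ} (hC : AnalyticAt ℂ C q)
    (hα : AnalyticAt ℂ α q) (hβ : AnalyticAt ℂ β q)
    (H : ∀ᶠ p in 𝓝 q, (p - q) * (t * C p) = p * (α p * b) - q * (a * β p)) :
    t * C q = α q * b + q * (deriv α q * b - a * deriv β q) ∧
    2 * (t * deriv C q) = 2 * (deriv α q * b) +
      q * (deriv (deriv α) q * b - a * deriv (deriv β) q) := by
  have H1 : ∀ᶠ p in 𝓝 q, t * C p + (p - q) * (t * deriv C p) =
      α p * b + p * (deriv α p * b) - q * (a * deriv β p) := by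
    filter_upwards [H.eventually_nhds, hC.eventually_analyticAt, hα.eventually_analyticAt,
      hβ.eventually_analyticAt] with p p0 p1 p2 p3
    have hid := hasDerivAt_id' p
    have e1 := (hid.sub_const q).fun_mul (p1.differentiableAt.hasDerivAt.const_mul t)
    have e2 := (hid.fun_mul (p2.differentiableAt.hasDerivAt.mul_const b)).fun_sub
      ((p3.differentiableAt.hasDerivAt.const_mul a).const_mul q)
    linear_combination e1.unique (e2.congr_of_eventuallyEq p0)
  have hid := hasDerivAt_id' q
  have e1 := (hC.differentiableAt.hasDerivAt.const_mul t).fun_add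
    ((hid.sub_const q).fun_mul (hC.deriv.differentiableAt.hasDerivAt.const_mul t))
  have e2 := ((hα.differentiableAt.hasDerivAt.mul_const b).fun_add
    (hid.fun_mul (hα.deriv.differentiableAt.hasDerivAt.mul_const b))).fun_sub
      ((hβ.deriv.differentiableAt.hasDerivAt.const_mul a).const_mul q)
  exact ⟨by linear_combination H1.self_of_nhds,
    by linear_combination e1.unique (e2.congr_of_eventuallyEq H1)⟩

section UC
variable {R S : ℝ} {W : Set Times₂} {τ : ℤ → ℤ → Times₂ → ℂ}

/-- The first order part of the Hirota–Miwa equation at `p = q`, near a point, and its second order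
part at the point. -/
theorem diagonal_derivative_UC (hW : IsDomain₂ R S W)
    (hol : ∀ m n, IsHolomorphic₂ R S W (τ m n)) (hier : IsModifiedUC R S W τ) (m n : ℤ)
    {Q : BddSeq₂} {q : ℂ} {ρ₁ ρ₂ : ℝ} (hρ₁ : ρ₁ < R) (hρ₂ : ρ₂ < S)
    (hq0 : q ≠ 0) (hq1 : ‖q‖ ≤ ρ₁) (hq2 : ‖q⁻¹‖ ≤ ρ₂)
    (h : PolydiscIn R S W ρ₁ ρ₂ (Q + bvec₂ R S q + bvec₂ R S q) Q)
    {t a b C : BddSeq₂ → ℂ} (ht : t = fun v => τ m n (coords₂ R S v))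
    (ha : a = fun v => τ (m + 1) n (coords₂ R S v)) (hb : b = fun v => τ m (n + 1) (coords₂ R S v))
    (hC : C = fun v => τ (m + 1) (n + 1) (coords₂ R S v)) :
    (∀ᶠ P in 𝓝 Q, t P * C (P + bvec₂ R S q + bvec₂ R S q) =
      a (P + bvec₂ R S q) * b (P + bvec₂ R S q) +
      q * (fderiv ℂ a (P + bvec₂ R S q) (deriv (bvec₂ R S) q) * b (P + bvec₂ R S q) -
        a (P + bvec₂ R S q) * fderiv ℂ b (P + bvec₂ R S q) (deriv (bvec₂ R S) q))) ∧
    2 * (t Q * fderiv ℂ C (Q + bvec₂ R S q + bvec₂ R S q) (deriv (bvec₂ R S) q)) =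
      2 * (fderiv ℂ a (Q + bvec₂ R S q) (deriv (bvec₂ R S) q) * b (Q + bvec₂ R S q)) +
      q * ((fderiv ℂ (fderiv ℂ a) (Q + bvec₂ R S q) (deriv (bvec₂ R S) q) (deriv (bvec₂ R S) q) +
          fderiv ℂ a (Q + bvec₂ R S q) (deriv (deriv (bvec₂ R S)) q)) * b (Q + bvec₂ R S q) -
        a (Q + bvec₂ R S q) *
          (fderiv ℂ (fderiv ℂ b) (Q + bvec₂ R S q) (deriv (bvec₂ R S) q) (deriv (bvec₂ R S) q) +
          fderiv ℂ b (Q + bvec₂ R S q) (deriv (deriv (bvec₂ R S)) q))) := by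
  have hT := analyticAt_bvec₂ hq0 (hq1.trans_lt hρ₁) (hq2.trans_lt hρ₂)
  set T := bvec₂ R S q with hTq
  have H := hirotaMiwa_UC_diagonal_eventually hW hol hier m n hρ₁ hρ₂ hq0 hq1 hq2 hq0 hq1 hq2 h
  have H1 : ∀ᶠ P in 𝓝 Q, ∀ᶠ p in 𝓝 q, (p - q) * (t P * C (P + bvec₂ R S p + T)) =
      p * (a (P + bvec₂ R S p) * b (P + T)) - q * (a (P + T) * b (P + bvec₂ R S p)) := by
    rw [nhds_prod_eq] at H
    rw [ht, ha, hb, hC]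
    exact H.curry
  have hm1 : ∀ᶠ P in 𝓝 Q, P + T ∈ coords₂ R S ⁻¹' W :=
    (continuous_id.add continuous_const).continuousAt.eventually
      (hW.2.mem_nhds (h q q⁻¹ hq1 hq2).1)
  have hm2 : ∀ᶠ P in 𝓝 Q, P + T + T ∈ coords₂ R S ⁻¹' W := by
    have h0 := (h 0 0 (by simpa using (norm_nonneg _).trans hq1)
      (by simpa using (norm_nonneg _).trans hq2)).2
    rw [bvec_zero, bvec_zero, Prod.mk_zero_zero, sub_zero] at h0
    exact ((continuous_id.add continuous_const).add continuous_const).continuousAt.eventually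
      (hW.2.mem_nhds h0)
  have key : ∀ᶠ P in 𝓝 Q, t P * C (P + T + T) = a (P + T) * b (P + T) +
      q * (fderiv ℂ a (P + T) (deriv (bvec₂ R S) q) * b (P + T) -
        a (P + T) * fderiv ℂ b (P + T) (deriv (bvec₂ R S) q)) ∧
      2 * (t P * fderiv ℂ C (P + T + T) (deriv (bvec₂ R S) q)) =
      2 * (fderiv ℂ a (P + T) (deriv (bvec₂ R S) q) * b (P + T)) +
      q * ((fderiv ℂ (fderiv ℂ a) (P + T) (deriv (bvec₂ R S) q) (deriv (bvec₂ R S) q) +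
          fderiv ℂ a (P + T) (deriv (deriv (bvec₂ R S)) q)) * b (P + T) -
        a (P + T) *
          (fderiv ℂ (fderiv ℂ b) (P + T) (deriv (bvec₂ R S) q) (deriv (bvec₂ R S) q) +
          fderiv ℂ b (P + T) (deriv (deriv (bvec₂ R S)) q))) := by
    filter_upwards [H1, hm1, hm2] with P P1 P2 P3
    have hcurve : AnalyticAt ℂ (fun p => P + bvec₂ R S p) q := analyticAt_const.fun_add hT
    have hcurve' : AnalyticAt ℂ (fun p => P + bvec₂ R S p + T) q :=
      hcurve.fun_add analyticAt_const
    have d1 : deriv (fun p => P + bvec₂ R S p) = deriv (bvec₂ R S) := by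
      ext1 p; rw [deriv_const_add]
    have d2 : deriv (fun p => P + bvec₂ R S p + T) = deriv (bvec₂ R S) := by
      ext1 p; rw [deriv_add_const, deriv_const_add]
    obtain ⟨a0, a1, a2⟩ := deriv_comp_analytic_curve (f := a) (c := fun p => P + bvec₂ R S p)
      (t := q) (by rw [ha]; exact hol _ _ _ P2) hcurve
    obtain ⟨b0, b1, b2⟩ := deriv_comp_analytic_curve (f := b) (c := fun p => P + bvec₂ R S p)
      (t := q) (by rw [hb]; exact hol _ _ _ P2) hcurve
    obtain ⟨c0, c1, -⟩ := deriv_comp_analytic_curve (f := C) (c := fun p => P + bvec₂ R S p + T)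
      (t := q) (by rw [hC]; exact hol _ _ _ P3) hcurve'
    have e := diagonal_first_second c0 a0 b0 P1
    rw [a1, a2, b1, b2, c1, d1, d2] at e
    exact e
  exact ⟨key.mono fun P hP => hP.1, key.self_of_nhds.2⟩

end UC

section Line
variable {ℓ : ℕ} {R S : ℝ} {W : Set Times₂} {τ : ℤ → ℤ → Times₂ → ℂ} {d : ℤ → ℤ → ℂ}

theorem norm_one_lt (hR : 1 < R) : ‖(1 : ℂ)‖ < R := by simpa using hR

theorem norm_one_inv_lt (hR : 1 < R) : ‖(1 : ℂ)⁻¹‖ < R := by simpa using hR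

/-- The point with coordinates `timesV a s`. -/
def pointV (R S : ℝ) (a s : ℂ) : BddSeq₂ := a • bvec₂ R S 1 + s • deriv (bvec₂ R S) 1

theorem coords₂_pointV (hR : 1 < R) (hS : 1 < S) (a s : ℂ) :
    coords₂ R S (pointV R S a s) = timesV a s := by
  rw [pointV, coords₂_add, coords₂_smul, coords₂_smul,
    coords₂_bvec₂ (norm_one_lt hR) (norm_one_inv_lt hS),
    coords₂_deriv_bvec₂ one_ne_zero (norm_one_lt hR) (norm_one_inv_lt hS)]
  ext n <;> simp [timesV, bracket₂, bracket] <;> ring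

theorem pointV_add_one (a s : ℂ) : pointV R S a s + bvec₂ R S 1 = pointV R S (a + 1) s := by
  simp only [pointV, add_smul, one_smul]
  abel

theorem growthBelow_const (hR : 1 < R) (s : ℂ) : GrowthBelow R fun _ : ℕ+ => s := by
  convert (growthBelow_pow (norm_one_lt hR)).smul s using 1
  ext n
  simp

theorem growthBelow_timesV (hR : 1 < R) (hS : 1 < S) (a s : ℂ) :
    GrowthBelow R (timesV a s).1 ∧ GrowthBelow S (timesV a s).2 := by
  constructor
  · convert (growthBelow_const hR s).add ((growthBelow_bracket (norm_one_lt hR)).smul a) using 1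
    ext n
    simp [timesV, bracket]
    ring
  · convert (growthBelow_const hS (-s)).add
      ((growthBelow_bracket (norm_one_lt hS)).smul a) using 1
    ext n
    simp [timesV, bracket]
    ring

/-- Homogeneity at `timesV a s`: the Euler vector field is there a combination of the first two
derivatives at `1` of the curve `w ↦ ([w], [w⁻¹])`. -/
theorem IsUCSimilarity.euler_pointV (h : IsUCSimilarity ℓ R S W τ d) (hR : 1 < R) (hS : 1 < S)
    (m n : ℤ) {a s : ℂ} (hP : timesV a s ∈ W) :
    s * (fderiv ℂ (fun v => τ m n (coords₂ R S v)) (pointV R S a s) (deriv (deriv (bvec₂ R S)) 1) +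
      fderiv ℂ (fun v => τ m n (coords₂ R S v)) (pointV R S a s) (deriv (bvec₂ R S) 1)) +
      a * fderiv ℂ (fun v => τ m n (coords₂ R S v)) (pointV R S a s) (deriv (bvec₂ R S) 1) =
      d m n * τ m n (coords₂ R S (pointV R S a s)) := by
  rw [← (h.homogeneous m n).fderiv_apply h.posR h.posS (h.holomorphic m n) hP
    (growthBelow_timesV hR hS a s).1 (growthBelow_timesV hR hS a s).2 (coords₂_pointV hR hS a s)
    (e := s • (deriv (deriv (bvec₂ R S)) 1 + deriv (bvec₂ R S) 1) + a • deriv (bvec₂ R S) 1) ?_]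
  · simp only [map_add, map_smul, smul_eq_mul]
  · rw [coords₂_add, coords₂_smul, coords₂_add, coords₂_smul,
      coords₂_deriv_bvec₂ one_ne_zero (norm_one_lt hR) (norm_one_inv_lt hS),
      coords₂_deriv2_bvec₂ one_ne_zero (norm_one_lt hR) (norm_one_inv_lt hS)]
    ext n
    · have hn : (n : ℂ) ≠ 0 := by exact_mod_cast n.ne_zero
      have h1 : (((n : ℕ) - 1 : ℕ) : ℂ) = n - 1 := by
        rw [Nat.cast_sub n.pos, Nat.cast_one]
      change s * ((((n : ℕ) - 1 : ℕ) : ℂ) * 1 ^ ((n : ℕ) - 1 - 1) + 1 ^ ((n : ℕ) - 1)) +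
        a * 1 ^ ((n : ℕ) - 1) = (n : ℂ) * (s + a / (n : ℂ))
      rw [h1, one_pow, one_pow]
      field_simp
      ring
    · have hn : (n : ℂ) ≠ 0 := by exact_mod_cast n.ne_zero
      simp [timesV]
      field_simp
      ring

/-- The bilinear equations behind the Darboux chain with an even number of nodes: `Z` is the
derivative in `s` of `τₘₙ τₘ₊₁,ₙ₊₁`, and the derivative along `∑ n (∂/∂xₙ + ∂/∂yₙ)` has been
eliminated by homogeneity, as has the function `τₘ₊₁,ₙ₊₁` (or `τₘₙ`). -/
theorem IsUCSimilarity.bilinear_pointV (h : IsUCSimilarity ℓ R S W τ d) (hR : 1 < R) (hS : 1 < S)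
    {m n m' n' : ℤ} (hm : m' = m + 1) (hn : n' = n + 1) {k s : ℂ} (hk : timesV k s ∈ W)
    (hk₁ : timesV (k - 1) s ∈ W) (hk₂ : timesV (k + 1) s ∈ W)
    (hP : PolydiscIn R S W 1 1 (pointV R S (k + 1) s) (pointV R S (k - 1) s))
    {f : ℤ → ℤ → BddSeq₂ → ℂ} (hf : f = fun m n v => τ m n (coords₂ R S v))
    {a b a₁ b₁ a₂ b₂ t t₁ C C₁ : ℂ} (ha : a = f m' n (pointV R S k s))
    (hb : b = f m n' (pointV R S k s))
    (ha₁ : a₁ = fderiv ℂ (f m' n) (pointV R S k s) (deriv (bvec₂ R S) 1))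
    (hb₁ : b₁ = fderiv ℂ (f m n') (pointV R S k s) (deriv (bvec₂ R S) 1))
    (ha₂ : a₂ = fderiv ℂ (fderiv ℂ (f m' n)) (pointV R S k s) (deriv (bvec₂ R S) 1)
      (deriv (bvec₂ R S) 1))
    (hb₂ : b₂ = fderiv ℂ (fderiv ℂ (f m n')) (pointV R S k s) (deriv (bvec₂ R S) 1)
      (deriv (bvec₂ R S) 1))
    (ht : t = f m n (pointV R S (k - 1) s))
    (ht₁ : t₁ = fderiv ℂ (f m n) (pointV R S (k - 1) s) (deriv (bvec₂ R S) 1))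
    (hC : C = f m' n' (pointV R S (k + 1) s))
    (hC₁ : C₁ = fderiv ℂ (f m' n') (pointV R S (k + 1) s) (deriv (bvec₂ R S) 1)) :
    s * t * (a₁ * b + a * b₁ + a₂ * b - a * b₂) = 2 * s * t₁ * (a * b + a₁ * b - a * b₁) +
      t * ((d m' n - d m n') * (a * b) - k * (a₁ * b - a * b₁)) ∧
    s * C * (a₁ * b + a * b₁ + a₂ * b - a * b₂) = 2 * s * C₁ * (a * b + a₁ * b - a * b₁) -
      C * ((d m' n - d m n') * (a * b) - k * (a₁ * b - a * b₁)) := by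
  subst hm hn
  have e1 : ∀ s, pointV R S (k - 1) s + bvec₂ R S 1 = pointV R S k s := fun s => by
    rw [pointV_add_one, sub_add_cancel]
  have e2 : ∀ s, pointV R S k s + bvec₂ R S 1 = pointV R S (k + 1) s := fun s => pointV_add_one _ _
  obtain ⟨G1, G2⟩ := diagonal_derivative_UC h.domain h.holomorphic h.hierarchy m n hR hS
    one_ne_zero (by simp) (by simp) (by rwa [e1, e2]) (t := f m n) (a := f (m + 1) n)
    (b := f m (n + 1)) (C := f (m + 1) (n + 1)) (by rw [hf]) (by rw [hf]) (by rw [hf]) (by rw [hf])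
  have hc : ∀ k : ℂ, Continuous fun s => pointV R S k s := fun k => by
    unfold pointV; fun_prop
  have G1' : ∀ᶠ y in 𝓝 s, f m n (pointV R S (k - 1) y) * f (m + 1) (n + 1) (pointV R S (k + 1) y) =
      f (m + 1) n (pointV R S k y) * f m (n + 1) (pointV R S k y) +
      (fderiv ℂ (f (m + 1) n) (pointV R S k y) (deriv (bvec₂ R S) 1) *
        f m (n + 1) (pointV R S k y) - f (m + 1) n (pointV R S k y) *
        fderiv ℂ (f m (n + 1)) (pointV R S k y) (deriv (bvec₂ R S) 1)) := by
    filter_upwards [(hc (k - 1)).continuousAt.eventually G1] with y hy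
    rw [e1, e2, one_mul] at hy
    exact hy
  have hfa : ∀ {k : ℂ} m n, timesV k s ∈ W →
      AnalyticAt ℂ (f m n) (k • bvec₂ R S 1 + s • deriv (bvec₂ R S) 1) := by
    intro k m n hk
    rw [hf]
    exact h.holomorphic m n _ (by
      rw [Set.mem_preimage, ← pointV, coords₂_pointV hR hS]; exact hk)
  have A := hasDerivAt_along_line (hfa (m + 1) n hk)
  have B := hasDerivAt_along_line (hfa m (n + 1) hk)
  have T := hasDerivAt_along_line (hfa m n hk₁)
  have C' := hasDerivAt_along_line (hfa (m + 1) (n + 1) hk₂)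
  have D := (T.1.fun_mul C'.1).unique (((A.1.fun_mul B.1).fun_add (((A.2.1 _).fun_mul
    B.1).fun_sub (A.1.fun_mul (B.2.1 _)))).congr_of_eventuallyEq G1')
  have g1 := G1'.self_of_nhds
  rw [e1, e2] at G2
  have h1 := h.euler_pointV hR hS (m + 1) n hk
  have h2 := h.euler_pointV hR hS m (n + 1) hk
  have hpt : ∀ k s : ℂ, k • bvec₂ R S 1 + s • deriv (bvec₂ R S) 1 = pointV R S k s := fun _ _ => rfl
  simp only [hpt] at D
  have hfmn : ∀ m n, (fun v => τ m n (coords₂ R S v)) = f m n := fun m n => by rw [hf]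
  have hfv : ∀ m n v, τ m n (coords₂ R S v) = f m n v := fun m n v => by rw [hf]
  rw [hfmn, hfv] at h1 h2
  rw [← ha, ← hb, ← ha₁, ← hb₁, ← ht, ← hC] at g1
  rw [← ha, ← hb, ← ha₁, ← ha₂, ← hb₂, ← ht, ← hC₁] at G2
  rw [← ha, ← hb, ← ha₁, ← hb₁, ← ha₂, ← hb₂, ← ht, ← hC, ← ht₁, ← hC₁] at D
  rw [← ha, ← ha₁] at h1
  rw [← hb, ← hb₁] at h2
  generalize fderiv ℂ (f (m + 1) n) (pointV R S k s) (deriv (deriv (bvec₂ R S)) 1) = aK at *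
  generalize fderiv ℂ (f m (n + 1)) (pointV R S k s) (deriv (deriv (bvec₂ R S)) 1) = bK at *
  -- `aK` and `bK` are the derivatives along the second derivative of the curve; they are eliminated
  -- by homogeneity.
  have Z : 2 * s * (t * C₁) = s * (a₁ * b + a * b₁ + a₂ * b - a * b₂) +
      ((d (m + 1) n - d m (n + 1)) * (a * b) - k * (a₁ * b - a * b₁)) := by
    linear_combination s * G2 + b * h1 - a * h2
  constructor
  · linear_combination t * Z - 2 * s * t * D + 2 * s * t₁ * g1
  · linear_combination -C * Z + 2 * s * C₁ * g1

theorem IsUCSimilarity.degree_periodic (h : IsUCSimilarity ℓ R S W τ d) {P : Times₂} (hP : P ∈ W)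
    (hg₁ : GrowthBelow R P.1) (hg₂ : GrowthBelow S P.2) {m n m' n' : ℤ}
    (hτ : ∀ P ∈ W, τ m n P = τ m' n' P) (h0 : τ m n P ≠ 0) : d m n = d m' n' :=
  (h.homogeneous m n).degree_unique h.posR h.posS h.domain (h.holomorphic m n)
    (h.holomorphic m' n') (h.homogeneous m' n') hτ hP hg₁ hg₂ h0

theorem IsUCSimilarity.periodic_diag (h : IsUCSimilarity ℓ R S W τ d) (m n : ℤ) {P : Times₂}
    (hP : P ∈ W) : τ (m + ℓ) (n - ℓ) P = τ m n P := by
  rw [h.periodic₁ m (n - ℓ) P hP, ← h.periodic₂ m (n - ℓ) P hP, sub_add_cancel]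

end Line

end

/-! ### The Darboux chain from the modified UC hierarchy -/

section

theorem PolydiscIn.mem {R S : ℝ} {W : Set Times₂} {ρ₁ ρ₂ : ℝ} {P Q : BddSeq₂}
    (h : PolydiscIn R S W ρ₁ ρ₂ P Q) (h1 : 0 ≤ ρ₁) (h2 : 0 ≤ ρ₂) :
    coords₂ R S Q ∈ W ∧ coords₂ R S P ∈ W := by
  have := h 0 0 (by simpa using h1) (by simpa using h2)
  rwa [bvec_zero, bvec_zero, Prod.mk_zero_zero, add_zero, sub_zero] at this

theorem PolydiscIn.mono {R S : ℝ} {W : Set Times₂} {ρ₁ ρ₂ ρ₁' ρ₂' : ℝ} {P Q : BddSeq₂}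
    (h : PolydiscIn R S W ρ₁ ρ₂ P Q) (h1 : ρ₁' ≤ ρ₁) (h2 : ρ₂' ≤ ρ₂) :
    PolydiscIn R S W ρ₁' ρ₂' P Q := fun w₁ w₂ hw₁ hw₂ => h w₁ w₂ (hw₁.trans h1) (hw₂.trans h2)

theorem continuous_pointV (R S : ℝ) (a : ℂ) : Continuous fun s => pointV R S a s := by
  unfold pointV; fun_prop

variable {ℓ : ℕ} {R S : ℝ} {W : Set Times₂} {τ : ℤ → ℤ → Times₂ → ℂ} {d : ℤ → ℤ → ℂ}

theorem eventually_mem_timesV (hR : 1 < R) (hS : 1 < S) (hW : IsDomain₂ R S W) {a s : ℂ}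
    (h : timesV a s ∈ W) : ∀ᶠ y in 𝓝 s, timesV a y ∈ W := by
  filter_upwards [(continuous_pointV R S a).continuousAt.eventually (hW.2.mem_nhds
    (x := pointV R S a s) (by rwa [Set.mem_preimage, coords₂_pointV hR hS]))] with y hy
  have : coords₂ R S (pointV R S a y) ∈ W := hy
  rwa [coords₂_pointV hR hS] at this

/-- The Darboux chain with `2 ℓ` nodes for homogeneous `(ℓ, ℓ)`-periodic solutions of the modified UC
hierarchy.  The equations with even index come from the polydisc condition around `timesV (a + 1) s`
and those with odd index from the one around `timesV a s`. -/
theorem IsUCSimilarity.darbouxChain (h : IsUCSimilarity ℓ R S W τ d) (hR : 1 < R) (hS : 1 < S)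
    {a x s : ℂ} (hx : x ≠ 0) (hs : s = -x ^ 2 / 2)
    (hP : PolydiscIn R S W 1 1 (pointV R S (a + 1) s) (pointV R S (a - 1) s))
    (hP' : PolydiscIn R S W 1 1 (pointV R S (a + 1 + 1) s) (pointV R S a s))
    (hA0 : ∀ i : ℤ, τ i (-i) (timesV a s) ≠ 0)
    (hB0 : ∀ i : ℤ, τ (i + 1) (-i) (timesV (a + 1) s) ≠ 0) :
    IsDarbouxChainAt (2 * ℓ) (rootUC d a) (wUC (fun m n a s => τ m n (timesV a s)) a) x := by
  obtain ⟨m0, m2⟩ := hP.mem zero_le_one zero_le_one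
  obtain ⟨m1, m3⟩ := hP'.mem zero_le_one zero_le_one
  rw [coords₂_pointV hR hS] at m0 m1 m2 m3
  set f : ℤ → ℤ → BddSeq₂ → ℂ := fun m n v => τ m n (coords₂ R S v) with hf
  set D := deriv (bvec₂ R S) 1 with hD
  have hfv : ∀ m n b y, f m n (pointV R S b y) = τ m n (timesV b y) := fun m n b y => by
    rw [hf]; beta_reduce; rw [coords₂_pointV hR hS]
  have hσ : (fun m n a s => τ m n (timesV a s)) = fun m n a s => f m n (pointV R S a s) := by
    ext m n a s; rw [hfv]
  have hfa : ∀ {b y} m n, timesV b y ∈ W → AnalyticAt ℂ (f m n) (b • bvec₂ R S 1 + y • D) :=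
    fun m n hb => h.holomorphic m n _ (by
      rw [Set.mem_preimage, ← pointV, coords₂_pointV hR hS]; exact hb)
  have mA := eventually_mem_timesV hR hS h.domain m1
  have mB := eventually_mem_timesV hR hS h.domain m2
  have per : ∀ (i j : ℤ) {P}, P ∈ W → τ (i + ℓ) (j - ℓ) P = τ i j P := fun i j _ hP =>
    h.periodic_diag i j hP
  rw [hσ]
  refine darbouxChain_of_bilinear₂ (s := s)
    (A := fun i y => f i (-i) (pointV R S a y))
    (B := fun i y => f (i + 1) (-i) (pointV R S (a + 1) y))
    (A₁ := fun i y => fderiv ℂ (f i (-i)) (pointV R S a y) D)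
    (B₁ := fun i y => fderiv ℂ (f (i + 1) (-i)) (pointV R S (a + 1) y) D)
    (A₂ := fun i => fderiv ℂ (fderiv ℂ (f i (-i))) (pointV R S a s) D D)
    (B₂ := fun i => fderiv ℂ (fderiv ℂ (f (i + 1) (-i))) (pointV R S (a + 1) s) D D)
    hx hs (fun _ => rfl) (fun _ => rfl)
    (fun i => mA.mono fun y hy => (hasDerivAt_along_line (hfa i (-i) hy)).1)
    (fun i => mB.mono fun y hy => (hasDerivAt_along_line (hfa (i + 1) (-i) hy)).1)
    (fun i => (hasDerivAt_along_line (hfa i (-i) m1)).2.1 D)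
    (fun i => (hasDerivAt_along_line (hfa (i + 1) (-i) m2)).2.1 D)
    (fun i => by rw [hfv]; exact hA0 i) (fun i => by rw [hfv]; exact hB0 i)
    (fun i => mA.mono fun y hy => ?_) (fun i => mB.mono fun y hy => ?_)
    (fun i => ?_) (fun i => ?_) (fun i => ?_) (fun i => ?_)
  · beta_reduce
    rw [hfv, hfv, ← per i (-i) hy]
    ring_nf
  · beta_reduce
    rw [hfv, hfv, ← per (i + 1) (-i) hy]
    ring_nf
  · refine h.degree_periodic m1 (growthBelow_timesV hR hS a s).1 (growthBelow_timesV hR hS a s).2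
      (fun P hP => ?_) (hA0 _)
    rw [← per i (-i) hP]
    ring_nf
  · refine h.degree_periodic m2 (growthBelow_timesV hR hS (a + 1) s).1
      (growthBelow_timesV hR hS (a + 1) s).2 (fun P hP => ?_) (hB0 _)
    rw [← per (i + 1) (-i) hP]
    ring_nf
  · have e1 : -(i - 1) = -i + 1 := by ring
    have e2 : i - 1 + 1 = i := by ring
    rw [e1, e2]
    have := (h.bilinear_pointV hR hS (m := i) (n := -i) rfl rfl (k := a + 1) (s := s) m2
      (by rwa [add_sub_cancel_right]) m3 (by rwa [add_sub_cancel_right]) hf rfl rfl rfl rfl rfl rfl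
      rfl rfl rfl rfl).1
    rw [add_sub_cancel_right] at this
    exact this
  · have e1 : -i = -(i + 1) + 1 := by ring
    have := (h.bilinear_pointV hR hS (m := i) (n := -(i + 1)) rfl e1 (k := a) (s := s) m1
      m0 m2 hP hf rfl rfl rfl rfl rfl rfl rfl rfl rfl rfl).2
    exact this

theorem IsUCSimilarity.isPAAt (h : IsUCSimilarity ℓ R S W τ d) (hℓ : 0 < ℓ) (hR : 1 < R)
    (hS : 1 < S) {a x s : ℂ} (hx : x ≠ 0) (hs : s = -x ^ 2 / 2)
    (hP : PolydiscIn R S W 1 1 (pointV R S (a + 1) s) (pointV R S (a - 1) s))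
    (hP' : PolydiscIn R S W 1 1 (pointV R S (a + 1 + 1) s) (pointV R S a s))
    (hA0 : ∀ i : ℤ, τ i (-i) (timesV a s) ≠ 0)
    (hB0 : ∀ i : ℤ, τ (i + 1) (-i) (timesV (a + 1) s) ≠ 0) :
    IsPAAt (2 * ℓ) (rootUC d a) (fun k y => wUC (fun m n a s => τ m n (timesV a s)) a k y +
      wUC (fun m n a s => τ m n (timesV a s)) a (k - 1) y) x := by
  obtain ⟨-, m2⟩ := hP.mem zero_le_one zero_le_one
  obtain ⟨m1, -⟩ := hP'.mem zero_le_one zero_le_one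
  rw [coords₂_pointV hR hS] at m1 m2
  have hc : Tendsto (fun y : ℂ => -y ^ 2 / 2) (𝓝 x) (𝓝 s) := by
    rw [hs]
    exact (by fun_prop : Continuous fun y : ℂ => -y ^ 2 / 2).tendsto x
  obtain ⟨_, _, r1, -, r2, -, E⟩ := polydiscIn_eventually (a := s) h.domain
    (continuous_pointV R S (a + 1)).continuousAt (continuous_pointV R S (a - 1)).continuousAt
    zero_le_one hR zero_le_one hS hP
  obtain ⟨_, _, r1', -, r2', -, E'⟩ := polydiscIn_eventually (a := s) h.domain
    (continuous_pointV R S (a + 1 + 1)).continuousAt (continuous_pointV R S a).continuousAt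
    zero_le_one hR zero_le_one hS hP'
  have cont : ∀ m n {b}, timesV b s ∈ W → ContinuousAt (fun y => τ m n (timesV b y)) s := by
    intro m n b hb
    have := ContinuousAt.comp (g := fun v => τ m n (coords₂ R S v)) (x := s)
      (h.holomorphic m n _ (by rwa [Set.mem_preimage, coords₂_pointV hR hS])).continuousAt
      (continuous_pointV R S b).continuousAt
    refine this.congr (.of_forall fun y => ?_)
    simp only [Function.comp_apply, coords₂_pointV hR hS]
  have mA := eventually_mem_timesV hR hS h.domain m1
  have mB := eventually_mem_timesV hR hS h.domain m2
  have nA := eventually_all_ne_zero (σ := fun i y => τ i (-i) (timesV a y)) hℓ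
    (fun i => cont _ _ m1) hA0 (mA.mono fun y hy i => by
      rw [← h.periodic_diag i (-i) hy]; ring_nf)
  have nB := eventually_all_ne_zero (σ := fun i y => τ (i + 1) (-i) (timesV (a + 1) y)) hℓ
    (fun i => cont _ _ m2) hB0 (mB.mono fun y hy i => by
      rw [← h.periodic_diag (i + 1) (-i) hy]; ring_nf)
  refine isPAAt_of_darbouxChain ?_
  filter_upwards [hc.eventually E, hc.eventually E', hc.eventually nA, hc.eventually nB,
    continuousAt_id.eventually_ne hx] with y y1 y2 y3 y4 y5
  exact h.darbouxChain hR hS y5 rfl (y1.mono r1.le r2.le) (y2.mono r1'.le r2'.le) y3 y4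

/-- Passage from points of `W` to polydiscs in the Banach space. -/
theorem polydiscIn_of_bracket₂ {P Q : BddSeq₂} {ρ₁ ρ₂ : ℝ} (h1 : ρ₁ < R) (h2 : ρ₂ < S)
    {p q : Times₂} (hP : coords₂ R S P = p) (hQ : coords₂ R S Q = q)
    (h : ∀ w₁ w₂ : ℂ, ‖w₁‖ ≤ ρ₁ → ‖w₂‖ ≤ ρ₂ → q + bracket₂ w₁ w₂ ∈ W ∧ p - bracket₂ w₁ w₂ ∈ W) :
    PolydiscIn R S W ρ₁ ρ₂ P Q := by
  intro w₁ w₂ hw₁ hw₂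
  rw [coords₂_add, coords₂_sub, coords₂_pair (hw₁.trans_lt h1) (hw₂.trans_lt h2), hP, hQ]
  exact h w₁ w₂ hw₁ hw₂

end

/-! ### The coefficients of the `P_VI`-chain -/

section

/-- A first order recurrence with periodic solution along the antidiagonals is solved by the
coefficients of the `P_VI`-chain. -/
theorem coeffU_eq {ℓ : ℕ} {q : ℂ} {F F' G U : ℤ → ℤ → ℂ}
    (hU : ∀ m n, U m n + G m n = q * F m (n + 1) / F' m (n + 1) * U (m - 1) (n + 1))
    (hper : ∀ m n, U (m - ℓ) (n + ℓ) = U m n)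
    (hprod : ∀ m n, ∏ β ∈ Finset.Icc 1 ℓ,
      q * F (m - (β : ℤ) + 1) (n + (β : ℤ)) / F' (m - (β : ℤ) + 1) (n + (β : ℤ)) = q ^ ℓ)
    (hq : q ^ ℓ ≠ 1) :
    (∀ m n, coeffU ℓ q F F' G m n = U m n) ∧
      ∀ m n, coeffV ℓ q F F' G m n = U m n + G m n := by
  -- The recurrence `hU` iterated `N` times; after `ℓ` steps `U` returns to itself, multiplied by
  -- `q ^ ℓ`.
  have iter : ∀ (m n : ℤ) (N : ℕ), U m n = -∑ α ∈ Finset.Icc 1 N,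
      G (m - α + 1) (n + α - 1) * ∏ β ∈ Finset.Icc 1 (α - 1),
        q * F (m - (β : ℤ) + 1) (n + (β : ℤ)) / F' (m - (β : ℤ) + 1) (n + (β : ℤ)) +
      (∏ β ∈ Finset.Icc 1 N,
        q * F (m - (β : ℤ) + 1) (n + (β : ℤ)) / F' (m - (β : ℤ) + 1) (n + (β : ℤ))) *
        U (m - N) (n + N) := by
    intro m n N
    induction N with
    | zero => simp
    | succ N ih =>
      rw [ih, Finset.sum_Icc_succ_top (by omega), Finset.prod_Icc_succ_top (by omega),
        Nat.add_sub_cancel]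
      have e := hU (m - N) (n + N)
      have e1 : m - ((N + 1 : ℕ) : ℤ) + 1 = m - N := by push_cast; ring
      have e2 : n + ((N + 1 : ℕ) : ℤ) - 1 = n + N := by push_cast; ring
      have e3 : n + ((N + 1 : ℕ) : ℤ) = n + N + 1 := by push_cast; ring
      have e4 : m - ((N + 1 : ℕ) : ℤ) = m - N - 1 := by push_cast; ring
      rw [e1, e2, e3, e4]
      linear_combination (∏ β ∈ Finset.Icc 1 N,
        q * F (m - (β : ℤ) + 1) (n + (β : ℤ)) / F' (m - (β : ℤ) + 1) (n + (β : ℤ))) * e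
  have hq' : q ^ ℓ - 1 ≠ 0 := sub_ne_zero.2 hq
  have key : ∀ m n, coeffU ℓ q F F' G m n = U m n := by
    intro m n
    have e := iter m n ℓ
    rw [hprod, hper] at e
    rw [coeffU]
    field_simp
    linear_combination e
  refine ⟨key, fun m n => ?_⟩
  rw [hU, ← key (m - 1) (n + 1), coeffU, coeffV, mul_left_comm]
  congr 1
  rw [Finset.mul_sum]
  refine Finset.sum_congr rfl fun α hα => ?_
  obtain ⟨k, rfl⟩ : ∃ k, α = k + 1 := ⟨α - 1, by have := (Finset.mem_Icc.1 hα).1; omega⟩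
  rw [Finset.prod_range_succ', Nat.add_sub_cancel]
  have h1 : ∏ β ∈ Finset.Icc 1 k, q * F (m - 1 - (β : ℤ) + 1) (n + 1 + (β : ℤ)) /
      F' (m - 1 - (β : ℤ) + 1) (n + 1 + (β : ℤ)) =
      ∏ β ∈ Finset.range k, q * F (m - ((β + 1 : ℕ) : ℤ)) (n + ((β + 1 : ℕ) : ℤ) + 1) /
        F' (m - ((β + 1 : ℕ) : ℤ)) (n + ((β + 1 : ℕ) : ℤ) + 1) := by
    rw [Finset.range_eq_Ico, Finset.prod_Ico_add' (fun β : ℕ => q * F (m - (β : ℤ))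
      (n + (β : ℤ) + 1) / F' (m - (β : ℤ)) (n + (β : ℤ) + 1)) 0 k 1, zero_add]
    refine Finset.prod_congr (by ext; simp) fun β _ => ?_
    rw [show m - 1 - (β : ℤ) + 1 = m - β by ring, show n + 1 + (β : ℤ) = n + β + 1 by ring]
  rw [h1]
  have e1 : m - 1 - ((k + 1 : ℕ) : ℤ) + 1 = m - ((k + 1 : ℕ) : ℤ) := by ring
  have e2 : n + 1 + ((k + 1 : ℕ) : ℤ) - 1 = n + ((k + 1 : ℕ) : ℤ) := by ring
  rw [e1, e2]
  simp only [Nat.cast_zero, sub_zero, add_zero]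
  ring

/-- The derivative of a ratio of products, with the logarithmic derivative of the denominator split off. -/
theorem hasDerivAt_ratio {A B C E : ℂ → ℂ} {A' B' C' E' x : ℂ} (hA : HasDerivAt A A' x)
    (hB : HasDerivAt B B' x) (hC : HasDerivAt C C' x) (hE : HasDerivAt E E' x) (hC0 : C x ≠ 0)
    (hE0 : E x ≠ 0) : HasDerivAt (fun y => A y * B y / (C y * E y))
      ((A' * B x + A x * B') / (C x * E x) -
        A x * B x / (C x * E x) * (C' / C x + E' / E x)) x := by
  refine HasDerivAt.congr_deriv ((hA.fun_mul hB).fun_div (hC.fun_mul hE)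
    (mul_ne_zero hC0 hE0)) ?_
  field_simp

/-- The coefficients `U` and `V` of the `P_VI`-chain in terms of tau functions.  The values of
the tau functions at `(a, b)` and its neighbours are denoted `S` at `(a, b)`, `P` at the points
`(a + 1, b)`, `P'` at `(a, b + 1)`, `N` at `(a - 1, b)` and `M` at `(a - 1, b + 1)`, or the same
with the roles of `a` and `b` exchanged. -/
theorem coeffU_eq_tau {ℓ : ℕ} {q a k : ℂ} {S P P' N M F F' G : ℤ → ℤ → ℂ}
    (hS : ∀ m n, S m n ≠ 0) (hP : ∀ m n, P m n ≠ 0) (hP' : ∀ m n, P' m n ≠ 0)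
    (hSp : ∀ m n, S (m - ℓ) (n + ℓ) = S m n) (hPp : ∀ m n, P (m - ℓ) (n + ℓ) = P m n)
    (hPp' : ∀ m n, P' (m - ℓ) (n + ℓ) = P' m n) (hMp : ∀ m n, M (m - ℓ) (n + ℓ) = M m n)
    (hF : ∀ m n, F m n = P m (n - 1) * S (m - 1) (n - 1) / (P (m - 1) n * S m (n - 2)))
    (hF' : ∀ m n, F' m n = P' m (n - 1) * S (m - 1) (n - 1) / (P' (m - 1) n * S m (n - 2)))
    (hG : ∀ m n, G m n = a * (N (m - 1) (n - 1) * P m n / (S (m - 1) n * S m (n - 1))))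
    (hA : ∀ m n, N (m - 1) (n - 1) * P' m n =
      k * (q * (S m (n - 1) * M (m - 1) n) - M m (n - 1) * S (m - 1) n))
    (hq : q ^ ℓ ≠ 1) :
    (∀ m n, coeffU ℓ q F F' G m n = a * k * (P m n * M m (n - 1) / (P' m n * S m (n - 1)))) ∧
    ∀ m n, coeffV ℓ q F F' G m n =
      a * k * q * (P m n * M (m - 1) n / (P' m n * S (m - 1) n)) := by
  have hFF : ∀ m n, q * F m (n + 1) / F' m (n + 1) =
      q * (P m n * P' (m - 1) (n + 1) / (P (m - 1) (n + 1) * P' m n)) := by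
    intro m n
    rw [hF, hF', add_sub_cancel_right, show n + 1 - 2 = n - 1 by ring]
    have h1 := hS (m - 1) n
    have h2 := hS m (n - 1)
    have h3 := hP (m - 1) (n + 1)
    have h4 := hP' (m - 1) (n + 1)
    have h5 := hP' m n
    field_simp
  have hV : ∀ m n, a * k * (P m n * M m (n - 1) / (P' m n * S m (n - 1))) + G m n =
      a * k * q * (P m n * M (m - 1) n / (P' m n * S (m - 1) n)) := by
    intro m n
    have h1 := hS (m - 1) n
    have h2 := hS m (n - 1)
    have h5 := hP' m n
    rw [hG]
    field_simp
    linear_combination a * P m n * hA m n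
  have h := coeffU_eq (ℓ := ℓ) (q := q) (F := F) (F' := F') (G := G)
    (U := fun m n => a * k * (P m n * M m (n - 1) / (P' m n * S m (n - 1)))) (fun m n => ?_)
    (fun m n => ?_) (fun m n => ?_) hq
  · exact ⟨h.1, fun m n => by rw [h.2, hV]⟩
  · rw [hV, hFF, add_sub_cancel_right]
    have h1 := hS (m - 1) n
    have h3 := hP (m - 1) (n + 1)
    have h4 := hP' (m - 1) (n + 1)
    have h5 := hP' m n
    field_simp
  · rw [hPp, hPp', show n + (ℓ : ℤ) - 1 = n - 1 + ℓ by ring, hMp, hSp]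
  · have e := prod_Icc_div (r := fun β : ℕ => P (m - β) (n + β) / P' (m - β) (n + β))
      (fun β => div_ne_zero (hP _ _) (hP' _ _)) ℓ
    rw [hPp, hPp', Nat.cast_zero, sub_zero, add_zero, div_self (div_ne_zero (hP _ _) (hP' _ _))] at e
    rw [← mul_one (q ^ ℓ), ← e]
    have e3 : q ^ ℓ = ∏ β ∈ Finset.Icc 1 ℓ, q := by simp
    rw [e3, ← Finset.prod_mul_distrib]
    refine Finset.prod_congr rfl fun β hβ => ?_
    have h := hFF (m - β + 1) (n + β - 1)
    rw [sub_add_cancel, add_sub_cancel_right] at h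
    rw [h, Nat.cast_sub (Finset.mem_Icc.1 hβ).1, Nat.cast_one,
      show m - ((β : ℤ) - 1) = m - β + 1 by ring, show n + ((β : ℤ) - 1) = n + β - 1 by ring]
    have h3 := hP (m - β) (n + β)
    have h4 := hP' (m - β) (n + β)
    have h5 := hP' (m - β + 1) (n + β - 1)
    field_simp

end

/-! ### The `P_VI`-chain from bilinear equations -/

section

/-- Periodicity of a function of two indices in each of them. -/
def BiPeriodic (ℓ : ℕ) (X : ℤ → ℤ → ℂ) : Prop :=
  ∀ m n, X (m + ℓ) n = X m n ∧ X m (n + ℓ) = X m n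

theorem BiPeriodic.sub_add {ℓ : ℕ} {X : ℤ → ℤ → ℂ} (h : BiPeriodic ℓ X) (m n : ℤ) :
    X (m - ℓ) (n + ℓ) = X m n := by
  rw [(h _ _).2, ← (h _ _).1, sub_add_cancel]

theorem BiPeriodic.add_sub {ℓ : ℕ} {X : ℤ → ℤ → ℂ} (h : BiPeriodic ℓ X) (m n : ℤ) :
    X (m + ℓ) (n - ℓ) = X m n := by
  rw [(h _ _).1, ← (h _ _).2, sub_add_cancel]

/-- The products of `f⁽⁰⁾` and of `f⁽¹⁾` along an antidiagonal telescope. -/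
theorem prod_antidiagonal {ℓ : ℕ} {P S F : ℤ → ℤ → ℂ} (hP : ∀ m n, P m n ≠ 0)
    (hS : ∀ m n, S m n ≠ 0) (hPp : BiPeriodic ℓ P) (hSp : BiPeriodic ℓ S)
    (hF : ∀ m n, F m n = P m (n - 1) * S (m - 1) (n - 1) / (P (m - 1) n * S m (n - 2)))
    (m n : ℤ) : ∏ j ∈ Finset.Icc 1 ℓ, F (m + (j : ℤ)) (n - (j : ℤ)) = 1 := by
  have e := prod_Icc_div (r := fun j : ℕ => S (m + j) (n - j - 2) / P (m + j) (n - j - 1))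
    (fun j => div_ne_zero (hS _ _) (hP _ _)) ℓ
  have e1 : n - (ℓ : ℤ) - 2 = n - 2 - ℓ := by ring
  have e2 : n - (ℓ : ℤ) - 1 = n - 1 - ℓ := by ring
  rw [e1, e2, hSp.add_sub, hPp.add_sub, Nat.cast_zero, add_zero, sub_zero,
    div_self (div_ne_zero (hS _ _) (hP _ _))] at e
  rw [← e]
  refine Finset.prod_congr rfl fun j hj => ?_
  rw [hF, Nat.cast_sub (Finset.mem_Icc.1 hj).1, Nat.cast_one,
    show m + ((j : ℤ) - 1) = m + j - 1 by ring, show n - ((j : ℤ) - 1) - 2 = n - j - 1 by ring,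
    show n - ((j : ℤ) - 1) - 1 = n - j by ring]
  have h1 := hP (m + j - 1) (n - j)
  have h2 := hP (m + j) (n - j - 1)
  have h3 := hS (m + j) (n - j - 2)
  field_simp

/-- The sums of `g⁽⁰⁾` and of `g⁽¹⁾` along an antidiagonal telescope. -/
theorem sum_antidiagonal {ℓ : ℕ} {r G : ℤ → ℤ → ℂ} {a : ℂ} (hr : BiPeriodic ℓ r)
    (hG : ∀ m n, G m n = a + (r m (n - 1) - r (m - 1) n)) (m n : ℤ) :
    ∑ j ∈ Finset.Icc 1 ℓ, G (m + (j : ℤ)) (n - (j : ℤ)) = ℓ * a := by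
  have e := sum_Icc_sub (fun j : ℕ => r (m + j) (n - j - 1)) ℓ
  rw [show n - (ℓ : ℤ) - 1 = n - 1 - ℓ by ring, hr.add_sub, Nat.cast_zero, add_zero, sub_zero,
    sub_self] at e
  have : ∑ j ∈ Finset.Icc 1 ℓ, G (m + (j : ℤ)) (n - (j : ℤ)) = ∑ j ∈ Finset.Icc 1 ℓ, (a +
      (r (m + (j : ℤ)) (n - (j : ℤ) - 1) - r (m + ((j - 1 : ℕ) : ℤ)) (n - ((j - 1 : ℕ) : ℤ) - 1))) :=
    Finset.sum_congr rfl fun j hj => by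
      rw [hG, Nat.cast_sub (Finset.mem_Icc.1 hj).1, Nat.cast_one,
        show m + ((j : ℤ) - 1) = m + j - 1 by ring, show n - ((j : ℤ) - 1) - 1 = n - j by ring]
  rw [this, Finset.sum_add_distrib, e]
  simp

/-- The `P_VI`-chain as a consequence of bilinear equations.  The functions `S`, `P₀`, `P₁`, `N₀`,
`N₁`, `M₀₁`, `M₁₀`, `P₀₁` are the values of the tau functions at `(a, b)`, `(a + 1, b)`,
`(a, b + 1)`, `(a - 1, b)`, `(a, b - 1)`, `(a - 1, b + 1)`, `(a + 1, b - 1)`, `(a + 1, b + 1)`,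
and a prime denotes the derivative in `t`. -/
theorem pVIChain_of_bilinear {ℓ : ℕ} {σ : ℤ → ℤ → ℂ → ℂ → ℂ → ℂ} {a b t : ℂ} {d : ℤ → ℤ → ℂ}
    {S P₀ P₁ N₀ N₁ M₀₁ M₁₀ P₀₁ S' P₀' P₁' N₀' : ℤ → ℤ → ℂ} (ht : t ≠ 0) (htℓ : t ^ ℓ ≠ 1)
    (hS : S = fun m n => σ m n a b t) (hP₀ : P₀ = fun m n => σ m n (a + 1) b t)
    (hP₁ : P₁ = fun m n => σ m n a (b + 1) t) (hN₀ : N₀ = fun m n => σ m n (a - 1) b t)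
    (hN₁ : N₁ = fun m n => σ m n a (b - 1) t)
    (hS' : ∀ m n, HasDerivAt (σ m n a b) (S' m n) t)
    (hP₀' : ∀ m n, HasDerivAt (σ m n (a + 1) b) (P₀' m n) t)
    (hP₁' : ∀ m n, HasDerivAt (σ m n a (b + 1)) (P₁' m n) t)
    (hN₀' : ∀ m n, HasDerivAt (σ m n (a - 1) b) (N₀' m n) t)
    (pS : BiPeriodic ℓ S) (pP₀ : BiPeriodic ℓ P₀) (pP₁ : BiPeriodic ℓ P₁) (pN₀ : BiPeriodic ℓ N₀)
    (pN₁ : BiPeriodic ℓ N₁) (pM₀₁ : BiPeriodic ℓ M₀₁) (pM₁₀ : BiPeriodic ℓ M₁₀)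
    (pS' : BiPeriodic ℓ S') (pd : BiPeriodic ℓ d)
    (zS : ∀ m n, S m n ≠ 0) (zP₀ : ∀ m n, P₀ m n ≠ 0) (zP₁ : ∀ m n, P₁ m n ≠ 0)
    (A₁ : ∀ m n, (1 - t) * (N₀ m n * P₁ (m + 1) (n + 1)) =
      S (m + 1) n * M₀₁ m (n + 1) - t * (M₀₁ (m + 1) n * S m (n + 1)))
    (A₂ : ∀ m n, (1 - t) * (N₁ m n * P₀ (m + 1) (n + 1)) =
      M₁₀ (m + 1) n * S m (n + 1) - t * (S (m + 1) n * M₁₀ m (n + 1)))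
    (A₃ : ∀ m n, (1 - t) * (S m n * P₀₁ (m + 1) (n + 1)) =
      P₀ (m + 1) n * P₁ m (n + 1) - t * (P₁ (m + 1) n * P₀ m (n + 1)))
    (B₀ : ∀ m n, a * (N₀ m n * P₀ (m + 1) (n + 1)) =
      (a + d (m + 1) n - d m (n + 1)) * (S (m + 1) n * S m (n + 1)) -
        t * (S' (m + 1) n * S m (n + 1) - S (m + 1) n * S' m (n + 1)))
    (B₁ : ∀ m n, b * (N₁ m n * P₁ (m + 1) (n + 1)) = b * (S (m + 1) n * S m (n + 1)) +
        t * (S' (m + 1) n * S m (n + 1) - S (m + 1) n * S' m (n + 1)))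
    (B₂ : ∀ m n, a * (M₀₁ m n * P₀₁ (m + 1) (n + 1)) =
      (a + d (m + 1) n - d m (n + 1)) * (P₁ (m + 1) n * P₁ m (n + 1)) -
        t * (P₁' (m + 1) n * P₁ m (n + 1) - P₁ (m + 1) n * P₁' m (n + 1)))
    (B₃ : ∀ m n, b * (M₁₀ m n * P₀₁ (m + 1) (n + 1)) = b * (P₀ (m + 1) n * P₀ m (n + 1)) +
        t * (P₀' (m + 1) n * P₀ m (n + 1) - P₀ (m + 1) n * P₀' m (n + 1)))
    (R₁ : ∀ m n, (t - 1) * (t * (N₀' m n * S (m + 1) n - N₀ m n * S' (m + 1) n)) =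
      b * t * (N₀ m n * S (m + 1) n - N₁ m n * M₀₁ (m + 1) n))
    (R₂ : ∀ m n, (t - 1) * (t * (S' m n * P₀ (m + 1) n - S m n * P₀' (m + 1) n)) =
      b * t * (S m n * P₀ (m + 1) n - M₁₀ m n * P₁ (m + 1) n))
    (hα : ∀ m n, ∀ᶠ y in 𝓝 t, gVI₀ σ a b m n y + gVI₁ σ a b m n y =
      a + b + d m (n - 1) - d (m - 1) n) :
    IsPVIChainAt ℓ a b (fun m n => a + b + d m (n - 1) - d (m - 1) n)
      (fVI₀ σ a b) (fVI₁ σ a b) (gVI₀ σ a b) (gVI₁ σ a b) t := by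
  have ht1 : t - 1 ≠ 0 := fun h => htℓ (by rw [sub_eq_zero.1 h, one_pow])
  have ht2 : 1 - t ≠ 0 := fun h => ht1 (by linear_combination -h)
  have F₀ : ∀ m n, fVI₀ σ a b m n t =
      P₀ m (n - 1) * S (m - 1) (n - 1) / (P₀ (m - 1) n * S m (n - 2)) := fun m n => by
    rw [fVI₀, hS, hP₀]
  have F₁ : ∀ m n, fVI₁ σ a b m n t =
      P₁ m (n - 1) * S (m - 1) (n - 1) / (P₁ (m - 1) n * S m (n - 2)) := fun m n => by
    rw [fVI₁, hS, hP₁]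
  have G₀ : ∀ m n, gVI₀ σ a b m n t =
      a * (N₀ (m - 1) (n - 1) * P₀ m n / (S (m - 1) n * S m (n - 1))) := fun m n => by
    rw [gVI₀, hS, hP₀, hN₀]
  have G₁ : ∀ m n, gVI₁ σ a b m n t =
      b * (N₁ (m - 1) (n - 1) * P₁ m n / (S (m - 1) n * S m (n - 1))) := fun m n => by
    rw [gVI₁, hS, hP₁, hN₁]
  obtain ⟨U₀₁, V₀₁⟩ := coeffU_eq_tau (ℓ := ℓ) (q := 1 / t) (a := a) (k := t / (1 - t)) zS zP₀ zP₁
    pS.sub_add pP₀.sub_add pP₁.sub_add pM₀₁.sub_add F₀ F₁ G₀ (fun m n => by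
      have := A₁ (m - 1) (n - 1)
      rw [sub_add_cancel, sub_add_cancel] at this
      field_simp
      linear_combination this) (by
      rw [one_div, inv_pow]
      exact fun h => htℓ (inv_eq_one.1 h))
  obtain ⟨U₁₀, V₁₀⟩ := coeffU_eq_tau (ℓ := ℓ) (q := t) (a := b) (k := 1 / (t - 1)) zS zP₁ zP₀
    pS.sub_add pP₁.sub_add pP₀.sub_add pM₁₀.sub_add F₁ F₀ G₁ (fun m n => by
      have := A₂ (m - 1) (n - 1)
      rw [sub_add_cancel, sub_add_cancel] at this
      field_simp
      linear_combination -this) htℓ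
  -- `U` and `V` differ by `g`
  have UV₀₁ : ∀ m n, coeffV ℓ (1 / t) (fVI₀ σ a b · · t) (fVI₁ σ a b · · t) (gVI₀ σ a b · · t) m n =
      coeffU ℓ (1 / t) (fVI₀ σ a b · · t) (fVI₁ σ a b · · t) (gVI₀ σ a b · · t) m n +
        gVI₀ σ a b m n t := by
    intro m n
    have := A₁ (m - 1) (n - 1)
    rw [sub_add_cancel, sub_add_cancel] at this
    have z1 := zS (m - 1) n
    have z2 := zS m (n - 1)
    have z3 := zP₁ m n
    rw [U₀₁, V₀₁, G₀]
    field_simp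
    linear_combination (-a * P₀ m n) * this
  have UV₁₀ : ∀ m n, coeffV ℓ t (fVI₁ σ a b · · t) (fVI₀ σ a b · · t) (gVI₁ σ a b · · t) m n =
      coeffU ℓ t (fVI₁ σ a b · · t) (fVI₀ σ a b · · t) (gVI₁ σ a b · · t) m n +
        gVI₁ σ a b m n t := by
    intro m n
    have := A₂ (m - 1) (n - 1)
    rw [sub_add_cancel, sub_add_cancel] at this
    have z1 := zS (m - 1) n
    have z2 := zS m (n - 1)
    have z3 := zP₀ m n
    rw [U₁₀, V₁₀, G₁]
    field_simp
    linear_combination (b * P₁ m n) * this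
  have G₀' : ∀ m n, gVI₀ σ a b m n t = a + ((d m (n - 1) - t * S' m (n - 1) / S m (n - 1)) -
      (d (m - 1) n - t * S' (m - 1) n / S (m - 1) n)) := by
    intro m n
    have := B₀ (m - 1) (n - 1)
    rw [sub_add_cancel, sub_add_cancel] at this
    have z1 := zS (m - 1) n
    have z2 := zS m (n - 1)
    rw [G₀]
    field_simp
    linear_combination this
  have G₁' : ∀ m n, gVI₁ σ a b m n t = b + (t * S' m (n - 1) / S m (n - 1) -
      t * S' (m - 1) n / S (m - 1) n) := by
    intro m n
    have := B₁ (m - 1) (n - 1)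
    rw [sub_add_cancel, sub_add_cancel] at this
    have z1 := zS (m - 1) n
    have z2 := zS m (n - 1)
    rw [G₁]
    field_simp
    linear_combination this
  have plam : BiPeriodic ℓ fun m n => t * S' m n / S m n := fun m n => by
    beta_reduce
    rw [(pS' m n).1, (pS' m n).2, (pS m n).1, (pS m n).2]
    exact ⟨rfl, rfl⟩
  have pmu : BiPeriodic ℓ fun m n => d m n - t * S' m n / S m n := fun m n => by
    beta_reduce
    rw [(pS' m n).1, (pS' m n).2, (pS m n).1, (pS m n).2, (pd m n).1, (pd m n).2]
    exact ⟨rfl, rfl⟩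
  have i1 : ∀ m : ℤ, m + ℓ - 1 = m - 1 + ℓ := fun m => by ring
  have i2 : ∀ m : ℤ, m + ℓ - 2 = m - 2 + ℓ := fun m => by ring
  have g₀_deriv : ∀ m n, ∃ D : ℂ, HasDerivAt (gVI₀ σ a b m n) D t ∧ t * D =
      coeffU ℓ (1 / t) (fVI₀ σ a b · · t) (fVI₁ σ a b · · t) (gVI₀ σ a b · · t) m n *
        gVI₁ σ a b m n t +
      coeffV ℓ t (fVI₁ σ a b · · t) (fVI₀ σ a b · · t) (gVI₁ σ a b · · t) m n *
        gVI₀ σ a b m n t := by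
    intro m n
    refine ⟨_, (hasDerivAt_ratio (hN₀' (m - 1) (n - 1)) (hP₀' m n) (hS' (m - 1) n)
      (hS' m (n - 1)) (by have := zS (m - 1) n; rwa [hS] at this)
      (by have := zS m (n - 1); rwa [hS] at this)).const_mul a, ?_⟩
    have e1 := R₁ (m - 1) (n - 1)
    have e2 := R₂ (m - 1) n
    rw [sub_add_cancel] at e1 e2
    rw [U₀₁, V₁₀, G₀, G₁]
    have v1 : ∀ m n, σ m n a b t = S m n := fun m n => by rw [hS]
    have v2 : ∀ m n, σ m n (a + 1) b t = P₀ m n := fun m n => by rw [hP₀]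
    have v3 : ∀ m n, σ m n (a - 1) b t = N₀ m n := fun m n => by rw [hN₀]
    simp only [v1, v2, v3]
    have z1 := zS (m - 1) n
    have z2 := zS m (n - 1)
    have z3 := zP₀ m n
    have z4 := zP₁ m n
    have eN : N₀' (m - 1) (n - 1) = N₀ (m - 1) (n - 1) * S' m (n - 1) / S m (n - 1) +
        b / (t - 1) * (N₀ (m - 1) (n - 1) - N₁ (m - 1) (n - 1) * M₀₁ m (n - 1) / S m (n - 1)) := by
      field_simp
      refine mul_left_cancel₀ ht ?_
      linear_combination e1
    have eP : P₀' m n = P₀ m n * S' (m - 1) n / S (m - 1) n -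
        b / (t - 1) * (P₀ m n - M₁₀ (m - 1) n * P₁ m n / S (m - 1) n) := by
      field_simp
      refine mul_left_cancel₀ ht ?_
      linear_combination -e2
    have ht3 : t / (1 - t) = -(t / (t - 1)) := by
      rw [← div_neg, neg_sub]
    rw [eN, eP, ht3]
    field_simp
    ring
  have f_deriv : ∀ {P P' : ℤ → ℤ → ℂ} {s : ℤ → ℤ → ℂ → ℂ} (m n : ℤ), (P = fun m n => s m n t) →
      (∀ m n, P m n ≠ 0) → (∀ m n, HasDerivAt (s m n) (P' m n) t) →
      ∃ D : ℂ, HasDerivAt (fun y => s m (n - 1) y * σ (m - 1) (n - 1) a b y /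
        (s (m - 1) n y * σ m (n - 2) a b y)) D t ∧
      t * D = (t * P' m (n - 1) / P m (n - 1) - t * P' (m - 1) n / P (m - 1) n +
        (b - gVI₁ σ a b m (n - 1) t)) *
        (P m (n - 1) * S (m - 1) (n - 1) / (P (m - 1) n * S m (n - 2))) := by
    intro P P' s m n hP zP hP'
    refine ⟨_, hasDerivAt_ratio (hP' m (n - 1)) (hS' (m - 1) (n - 1)) (hP' (m - 1) n)
      (hS' m (n - 2)) (by have := zP (m - 1) n; rwa [hP] at this)
      (by have := zS m (n - 2); rwa [hS] at this), ?_⟩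
    rw [G₁', show n - 1 - 1 = n - 2 by ring]
    have v1 : ∀ m n, σ m n a b t = S m n := fun m n => by rw [hS]
    have v2 : ∀ m n, s m n t = P m n := fun m n => by rw [hP]
    simp only [v1, v2]
    have z1 := zS (m - 1) (n - 1)
    have z2 := zS m (n - 2)
    have z3 := zP m (n - 1)
    have z4 := zP (m - 1) n
    field_simp
    ring
  have P01 : ∀ m n, P₀₁ m n = (P₀ m (n - 1) * P₁ (m - 1) n - t * (P₁ m (n - 1) * P₀ (m - 1) n)) /
      ((1 - t) * S (m - 1) (n - 1)) := by
    intro m n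
    have := A₃ (m - 1) (n - 1)
    rw [sub_add_cancel, sub_add_cancel] at this
    rw [eq_div_iff (mul_ne_zero ht2 (zS _ _))]
    linear_combination this
  refine ⟨?_, fun m n => ?_, prod_antidiagonal zP₀ zS pP₀ pS F₀, prod_antidiagonal zP₁ zS pP₁ pS F₁,
    sum_antidiagonal (G := fun m n => gVI₀ σ a b m n t) pmu G₀',
    sum_antidiagonal (G := fun m n => gVI₁ σ a b m n t) plam G₁', fun m n => (hα m n).self_of_nhds,
    _, _, _, _, rfl, rfl, rfl, rfl, fun m n => ?_, fun m n => ?_, fun m n => ?_, g₀_deriv⟩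
  · rintro h (rfl | rfl | rfl | rfl) m n
    · simp only [F₀, i1, i2, (pS _ _).1, (pS _ _).2, (pP₀ _ _).1, (pP₀ _ _).2, and_self]
    · simp only [F₁, i1, i2, (pS _ _).1, (pS _ _).2, (pP₁ _ _).1, (pP₁ _ _).2, and_self]
    · simp only [G₀, i1, (pS _ _).1, (pS _ _).2, (pP₀ _ _).1, (pP₀ _ _).2, (pN₀ _ _).1,
        (pN₀ _ _).2, and_self]
    · simp only [G₁, i1, (pS _ _).1, (pS _ _).2, (pP₁ _ _).1, (pP₁ _ _).2, (pN₁ _ _).1,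
        (pN₁ _ _).2, and_self]
  · simp only [i1, (pd _ _).1, (pd _ _).2, and_self]
  · obtain ⟨D, h1, h2⟩ := f_deriv m n hP₁ zP₁ hP₁'
    refine ⟨D, h1, ?_⟩
    rw [h2, F₁]
    congr 1
    have := B₂ (m - 1) (n - 1)
    rw [sub_add_cancel, sub_add_cancel, P01] at this
    rw [U₀₁, V₀₁]
    have z1 := zS (m - 1) (n - 1)
    have z2 := zP₁ m (n - 1)
    have z3 := zP₁ (m - 1) n
    field_simp
    field_simp at this
    linear_combination this
  · obtain ⟨D, h1, h2⟩ := f_deriv m n hP₀ zP₀ hP₀'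
    refine ⟨D, h1, ?_⟩
    rw [h2, F₀]
    congr 1
    have := B₃ (m - 1) (n - 1)
    rw [sub_add_cancel, sub_add_cancel, P01] at this
    rw [U₁₀, V₁₀]
    have z1 := zS (m - 1) (n - 1)
    have z2 := zP₀ m (n - 1)
    have z3 := zP₀ (m - 1) n
    field_simp
    field_simp at this
    linear_combination this
  · obtain ⟨D, h1, h2⟩ := g₀_deriv m n
    refine ⟨-D, ?_, ?_⟩
    · have h3 : gVI₁ σ a b m n =ᶠ[𝓝 t] fun y =>
          (a + b + d m (n - 1) - d (m - 1) n) - gVI₀ σ a b m n y :=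
        (hα m n).mono fun y hy => by linear_combination hy
      exact (h1.const_sub _).congr_of_eventuallyEq h3
    · rw [UV₁₀] at h2
      rw [UV₀₁]
      linear_combination -h2

end

/-! ### The `P_VI`-chain from the modified UC hierarchy -/

section

/-- The tau functions specialized to the times `timesVI a b t`. -/
def sigmaVI (τ : ℤ → ℤ → Times₂ → ℂ) (m n : ℤ) (a b t : ℂ) : ℂ := τ m n (timesVI a b t)

/-- The point with coordinates `timesVI a b t`. -/
def pointVI (R S : ℝ) (a b t : ℂ) : BddSeq₂ := a • bvec₂ R S 1 + b • bvec₂ R S t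

section Point
variable {ℓ : ℕ} {R S : ℝ} {W : Set Times₂} {τ : ℤ → ℤ → Times₂ → ℂ} {d : ℤ → ℤ → ℂ} {a b t : ℂ}

theorem coords₂_pointVI (hR : 1 < R) (hS : 1 < S) (ht1 : ‖t‖ < R) (ht2 : ‖t⁻¹‖ < S) (a b : ℂ) :
    coords₂ R S (pointVI R S a b t) = timesVI a b t := by
  rw [pointVI, coords₂_add, coords₂_smul, coords₂_smul,
    coords₂_bvec₂ (norm_one_lt hR) (norm_one_inv_lt hS), coords₂_bvec₂ ht1 ht2]
  ext n <;> simp [timesVI, bracket₂, bracket] <;> ring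

theorem pointVI_add_one (a b t : ℂ) :
    pointVI R S a b t + bvec₂ R S 1 = pointVI R S (a + 1) b t := by
  simp only [pointVI, add_smul, one_smul]
  abel

theorem pointVI_add (a b t : ℂ) :
    pointVI R S a b t + bvec₂ R S t = pointVI R S a (b + 1) t := by
  simp only [pointVI, add_smul, one_smul]
  abel

theorem continuousAt_pointVI (ht0 : t ≠ 0) (ht1 : ‖t‖ < R) (ht2 : ‖t⁻¹‖ < S) (a b : ℂ) :
    ContinuousAt (pointVI R S a b) t :=
  continuousAt_const.add ((analyticAt_bvec₂ ht0 ht1 ht2).continuousAt.const_smul b)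

theorem growthBelow_timesVI (hR : 1 < R) (hS : 1 < S) (ht1 : ‖t‖ < R) (ht2 : ‖t⁻¹‖ < S)
    (a b : ℂ) : GrowthBelow R (timesVI a b t).1 ∧ GrowthBelow S (timesVI a b t).2 := by
  constructor
  · convert ((growthBelow_bracket (norm_one_lt hR)).smul a).add
      ((growthBelow_bracket ht1).smul b) using 1
    ext n
    simp [timesVI, bracket]
    ring
  · convert ((growthBelow_bracket (norm_one_lt hS)).smul a).add
      ((growthBelow_bracket ht2).smul b) using 1
    ext n
    simp [timesVI, bracket]
    ring

theorem eventually_sigmaVI (hR : 1 < R) (hS : 1 < S) (ht0 : t ≠ 0) (ht1 : ‖t‖ < R)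
    (ht2 : ‖t⁻¹‖ < S) (m n : ℤ) (a b : ℂ) :
    sigmaVI τ m n a b =ᶠ[𝓝 t] fun y => τ m n (coords₂ R S (pointVI R S a b y)) :=
  (eventually_bvec₂_domain ht0 ht1 ht2).mono fun y hy => by
    beta_reduce
    rw [coords₂_pointVI hR hS hy.2.1 hy.2.2, sigmaVI]

theorem eventually_mem_timesVI (hW : IsDomain₂ R S W) (hR : 1 < R) (hS : 1 < S) (ht0 : t ≠ 0)
    (ht1 : ‖t‖ < R) (ht2 : ‖t⁻¹‖ < S) (h : timesVI a b t ∈ W) :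
    ∀ᶠ y in 𝓝 t, timesVI a b y ∈ W := by
  filter_upwards [eventually_bvec₂_domain ht0 ht1 ht2,
    (continuousAt_pointVI ht0 ht1 ht2 a b).eventually (hW.2.mem_nhds
    (x := pointVI R S a b t) (by rwa [Set.mem_preimage, coords₂_pointVI hR hS ht1 ht2]))] with y hy hm
  have : coords₂ R S (pointVI R S a b y) ∈ W := hm
  rwa [coords₂_pointVI hR hS hy.2.1 hy.2.2] at this

theorem IsUCSimilarity.hasDerivAt_sigmaVI (h : IsUCSimilarity ℓ R S W τ d) (hR : 1 < R)
    (hS : 1 < S) (ht0 : t ≠ 0) (ht1 : ‖t‖ < R) (ht2 : ‖t⁻¹‖ < S) (hP : timesVI a b t ∈ W)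
    (m n : ℤ) :
    HasDerivAt (sigmaVI τ m n a b) (b * fderiv ℂ (fun v => τ m n (coords₂ R S v))
      (pointVI R S a b t) (deriv (bvec₂ R S) t)) t := by
  have hc : HasDerivAt (pointVI R S a b) (b • deriv (bvec₂ R S) t) t :=
    ((analyticAt_bvec₂ ht0 ht1 ht2).differentiableAt.hasDerivAt.const_smul b).const_add _
  have := hasDerivAt_comp_curve (h.holomorphic m n (pointVI R S a b t)
    (by rwa [Set.mem_preimage, coords₂_pointVI hR hS ht1 ht2])) hc
  rw [map_smul, smul_eq_mul] at this
  exact this.congr_of_eventuallyEq (eventually_sigmaVI hR hS ht0 ht1 ht2 m n a b)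

/-- Homogeneity at `timesVI a b t`: the Euler vector field is there a combination of the
derivatives of the curve `w ↦ ([w], [w⁻¹])` at `1` and at `t`. -/
theorem IsUCSimilarity.euler_pointVI (h : IsUCSimilarity ℓ R S W τ d) (hR : 1 < R)
    (hS : 1 < S) (ht0 : t ≠ 0) (ht1 : ‖t‖ < R) (ht2 : ‖t⁻¹‖ < S) (hP : timesVI a b t ∈ W)
    (m n : ℤ) :
    a * fderiv ℂ (fun v => τ m n (coords₂ R S v)) (pointVI R S a b t) (deriv (bvec₂ R S) 1) +
      t * deriv (sigmaVI τ m n a b) t = d m n * sigmaVI τ m n a b t := by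
  have e := (h.homogeneous m n).fderiv_apply h.posR h.posS (h.holomorphic m n) hP
    (growthBelow_timesVI hR hS ht1 ht2 a b).1 (growthBelow_timesVI hR hS ht1 ht2 a b).2
    (coords₂_pointVI hR hS ht1 ht2 a b)
    (e := a • deriv (bvec₂ R S) 1 + (b * t) • deriv (bvec₂ R S) t) (by
      rw [coords₂_add, coords₂_smul, coords₂_smul,
        coords₂_deriv_bvec₂ one_ne_zero (norm_one_lt hR) (norm_one_inv_lt hS),
        coords₂_deriv_bvec₂ ht0 ht1 ht2]
      ext n
      · have hn : (n : ℂ) ≠ 0 := by exact_mod_cast n.ne_zero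
        change a * 1 ^ ((n : ℕ) - 1) + b * t * t ^ ((n : ℕ) - 1) =
          n * ((a + b * t ^ (n : ℕ)) / n)
        rw [one_pow, mul_assoc, mul_pow_sub_one n.ne_zero]
        field_simp
      · have hn : (n : ℂ) ≠ 0 := by exact_mod_cast n.ne_zero
        change a * -1⁻¹ ^ ((n : ℕ) + 1) + b * t * -t⁻¹ ^ ((n : ℕ) + 1) =
          -(n * ((a + b * t⁻¹ ^ (n : ℕ)) / n))
        rw [inv_one, one_pow, pow_succ]
        field_simp
        ring)
  rw [(h.hasDerivAt_sigmaVI hR hS ht0 ht1 ht2 hP m n).deriv, sigmaVI,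
    ← coords₂_pointVI hR hS ht1 ht2, ← e]
  simp only [map_add, map_smul, smul_eq_mul]
  ring

end Point

section Bilinear
variable {ℓ : ℕ} {R S : ℝ} {W : Set Times₂} {τ : ℤ → ℤ → Times₂ → ℂ} {d : ℤ → ℤ → ℂ}
  {a b t : ℂ} {ρ₁ ρ₂ : ℝ}

/-- The discrete equation with the parameters `1` and `t`, which shift `a` and `b` by one. -/
theorem IsUCSimilarity.hirotaMiwa_VI (h : IsUCSimilarity ℓ R S W τ d) (hρ₁ : ρ₁ < R)
    (hρ₂ : ρ₂ < S) (h1 : 1 ≤ ρ₁) (h2 : 1 ≤ ρ₂) (ht0 : t ≠ 0) (ht1 : ‖t‖ ≤ ρ₁) (ht2 : ‖t⁻¹‖ ≤ ρ₂)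
    {a' b' : ℂ} (ha : a' = a + 1) (hb : b' = b + 1)
    (hP : PolydiscIn R S W ρ₁ ρ₂ (pointVI R S a' b' t) (pointVI R S a b t)) (m n : ℤ) :
    (1 - t) * (sigmaVI τ m n a b t * sigmaVI τ (m + 1) (n + 1) a' b' t) =
      sigmaVI τ (m + 1) n a' b t * sigmaVI τ m (n + 1) a b' t -
        t * (sigmaVI τ (m + 1) n a b' t * sigmaVI τ m (n + 1) a' b t) := by
  subst ha hb
  have hv : ∀ m n a b, τ m n (coords₂ R S (pointVI R S a b t)) = sigmaVI τ m n a b t :=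
    fun m n a b => by
      rw [coords₂_pointVI (h1.trans_lt hρ₁) (h2.trans_lt hρ₂) (ht1.trans_lt hρ₁)
        (ht2.trans_lt hρ₂), sigmaVI]
  have H := (hirotaMiwa_UC_diagonal_eventually h.domain h.holomorphic h.hierarchy m n hρ₁ hρ₂
    one_ne_zero (by simpa using h1) (by simpa using h2) ht0 ht1 ht2
    (Q := pointVI R S a b t) (by rwa [pointVI_add_one, pointVI_add])).self_of_nhds
  simpa only [pointVI_add_one, pointVI_add, hv, one_mul] using H

/-- The limit of the discrete equation in which both parameters are `1`.  The derivative along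
`∂/∂a` that arises is expressed by the derivative in `t` by means of homogeneity. -/
theorem IsUCSimilarity.bilinear_VI_one (h : IsUCSimilarity ℓ R S W τ d) (hρ₁ : ρ₁ < R)
    (hρ₂ : ρ₂ < S) (h1 : 1 ≤ ρ₁) (h2 : 1 ≤ ρ₂) (ht0 : t ≠ 0) (ht1 : ‖t‖ ≤ ρ₁) (ht2 : ‖t⁻¹‖ ≤ ρ₂)
    (hab : timesVI a b t ∈ W)
    (hP : PolydiscIn R S W ρ₁ ρ₂ (pointVI R S (a + 1) b t) (pointVI R S (a - 1) b t)) (m n : ℤ) :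
    a * (sigmaVI τ m n (a - 1) b t * sigmaVI τ (m + 1) (n + 1) (a + 1) b t) =
      (a + d (m + 1) n - d m (n + 1)) *
        (sigmaVI τ (m + 1) n a b t * sigmaVI τ m (n + 1) a b t) -
        t * (deriv (sigmaVI τ (m + 1) n a b) t * sigmaVI τ m (n + 1) a b t -
          sigmaVI τ (m + 1) n a b t * deriv (sigmaVI τ m (n + 1) a b) t) := by
  have hR := h1.trans_lt hρ₁
  have hS := h2.trans_lt hρ₂
  have hv : ∀ m n a b, τ m n (coords₂ R S (pointVI R S a b t)) = sigmaVI τ m n a b t :=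
    fun m n a b => by
      rw [coords₂_pointVI hR hS (ht1.trans_lt hρ₁) (ht2.trans_lt hρ₂), sigmaVI]
  have e1 : pointVI R S (a - 1) b t + bvec₂ R S 1 = pointVI R S a b t := by
    rw [pointVI_add_one, sub_add_cancel]
  have H := (diagonal_derivative_UC h.domain h.holomorphic h.hierarchy m n hρ₁ hρ₂ one_ne_zero
    (by simpa using h1) (by simpa using h2) (Q := pointVI R S (a - 1) b t)
    (by rwa [e1, pointVI_add_one]) rfl rfl rfl rfl).1.self_of_nhds
  beta_reduce at H
  rw [e1, pointVI_add_one] at H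
  simp only [hv] at H
  have E := h.euler_pointVI hR hS ht0 (ht1.trans_lt hρ₁) (ht2.trans_lt hρ₂) hab
  linear_combination a * H + sigmaVI τ m (n + 1) a b t * E (m + 1) n -
    sigmaVI τ (m + 1) n a b t * E m (n + 1)

/-- The limit of the discrete equation in which both parameters are `t`. -/
theorem IsUCSimilarity.bilinear_VI_t (h : IsUCSimilarity ℓ R S W τ d) (hρ₁ : ρ₁ < R)
    (hρ₂ : ρ₂ < S) (h1 : 1 ≤ ρ₁) (h2 : 1 ≤ ρ₂) (ht0 : t ≠ 0) (ht1 : ‖t‖ ≤ ρ₁) (ht2 : ‖t⁻¹‖ ≤ ρ₂)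
    (hab : timesVI a b t ∈ W)
    (hP : PolydiscIn R S W ρ₁ ρ₂ (pointVI R S a (b + 1) t) (pointVI R S a (b - 1) t)) (m n : ℤ) :
    b * (sigmaVI τ m n a (b - 1) t * sigmaVI τ (m + 1) (n + 1) a (b + 1) t) =
      b * (sigmaVI τ (m + 1) n a b t * sigmaVI τ m (n + 1) a b t) +
        t * (deriv (sigmaVI τ (m + 1) n a b) t * sigmaVI τ m (n + 1) a b t -
          sigmaVI τ (m + 1) n a b t * deriv (sigmaVI τ m (n + 1) a b) t) := by
  have hR := h1.trans_lt hρ₁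
  have hS := h2.trans_lt hρ₂
  have hv : ∀ m n a b, τ m n (coords₂ R S (pointVI R S a b t)) = sigmaVI τ m n a b t :=
    fun m n a b => by
      rw [coords₂_pointVI hR hS (ht1.trans_lt hρ₁) (ht2.trans_lt hρ₂), sigmaVI]
  have e1 : pointVI R S a (b - 1) t + bvec₂ R S t = pointVI R S a b t := by
    rw [pointVI_add, sub_add_cancel]
  have H := (diagonal_derivative_UC h.domain h.holomorphic h.hierarchy m n hρ₁ hρ₂ ht0
    ht1 ht2 (Q := pointVI R S a (b - 1) t)
    (by rwa [e1, pointVI_add]) rfl rfl rfl rfl).1.self_of_nhds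
  beta_reduce at H
  rw [e1, pointVI_add] at H
  simp only [hv] at H
  have D := fun m n => (h.hasDerivAt_sigmaVI hR hS ht0 (ht1.trans_lt hρ₁) (ht2.trans_lt hρ₂)
    hab m n).deriv
  rw [D, D]
  linear_combination b * H

/-- The derivative of the three term equation relating `τₘₙ` and `τₘ₊₁,ₙ` in one of its
parameters. -/
theorem IsUCSimilarity.bilinear_VI_row (h : IsUCSimilarity ℓ R S W τ d) (hρ₁ : ρ₁ < R)
    (hρ₂ : ρ₂ < S) (h1 : 1 ≤ ρ₁) (h2 : 1 ≤ ρ₂) (ht0 : t ≠ 0) (ht1 : ‖t‖ ≤ ρ₁) (ht2 : ‖t⁻¹‖ ≤ ρ₂)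
    {a' : ℂ} (ha : a' = a + 1) (hab : timesVI a b t ∈ W) (hab' : timesVI a' b t ∈ W)
    (hP : PolydiscIn R S W ρ₁ ρ₂ (pointVI R S a' (b + 1) t) (pointVI R S a (b - 1) t)) (m n : ℤ) :
    (t - 1) * (deriv (sigmaVI τ m n a b) t * sigmaVI τ (m + 1) n a' b t -
      sigmaVI τ m n a b t * deriv (sigmaVI τ (m + 1) n a' b) t) =
      b * (sigmaVI τ m n a b t * sigmaVI τ (m + 1) n a' b t -
        sigmaVI τ m n a' (b - 1) t * sigmaVI τ (m + 1) n a (b + 1) t) := by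
  subst ha
  have hR := h1.trans_lt hρ₁
  have hS := h2.trans_lt hρ₂
  have ht1' := ht1.trans_lt hρ₁
  have ht2' := ht2.trans_lt hρ₂
  have hv : ∀ m n a b, τ m n (coords₂ R S (pointVI R S a b t)) = sigmaVI τ m n a b t :=
    fun m n a b => by rw [coords₂_pointVI hR hS ht1' ht2', sigmaVI]
  have e1 : pointVI R S a (b - 1) t + bvec₂ R S t = pointVI R S a b t := by
    rw [pointVI_add, sub_add_cancel]
  have H := hirotaMiwa_UC_row_eventually h.domain h.holomorphic h.hierarchy m n hρ₁ hρ₂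
    ht0 ht1 ht2 ht0 ht1 ht2 one_ne_zero (by simpa using h1) (by simpa using h2)
    (Q := pointVI R S a (b - 1) t) (by rwa [e1, pointVI_add, pointVI_add_one])
  have hT := (analyticAt_bvec₂ ht0 ht1' ht2').differentiableAt.hasDerivAt
  have hid := hasDerivAt_id' t
  have hF : HasDerivAt (fun r => τ m n (coords₂ R S (pointVI R S a (b - 1) t + bvec₂ R S r)))
      (fderiv ℂ (fun v => τ m n (coords₂ R S v)) (pointVI R S a b t) (deriv (bvec₂ R S) t)) t := by
    have := hasDerivAt_comp_curve (c := fun r => pointVI R S a (b - 1) t + bvec₂ R S r) (t := t)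
      (h.holomorphic m n (pointVI R S a (b - 1) t + bvec₂ R S t)
      (by rwa [Set.mem_preimage, e1, coords₂_pointVI hR hS ht1' ht2'])) (hT.const_add _)
    rwa [e1] at this
  have hG : HasDerivAt (fun r => τ (m + 1) n (coords₂ R S
      (pointVI R S a (b - 1) t + bvec₂ R S r + bvec₂ R S 1)))
      (fderiv ℂ (fun v => τ (m + 1) n (coords₂ R S v)) (pointVI R S (a + 1) b t)
        (deriv (bvec₂ R S) t)) t := by
    have := hasDerivAt_comp_curve (t := t)
      (c := fun r => pointVI R S a (b - 1) t + bvec₂ R S r + bvec₂ R S 1)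
      (h.holomorphic (m + 1) n (pointVI R S a (b - 1) t + bvec₂ R S t + bvec₂ R S 1)
      (by rwa [Set.mem_preimage, e1, pointVI_add_one, coords₂_pointVI hR hS ht1' ht2']))
      ((hT.const_add _).add_const _)
    rwa [e1, pointVI_add_one] at this
  have m1 : coords₂ R S (pointVI R S a (b - 1) t + bvec₂ R S t + bvec₂ R S t) ∈ W := by
    have := (hP 1 1 (by simpa using h1) (by simpa using h2)).2
    have e : (bvec R 1, bvec S 1) = bvec₂ R S 1 := by simp [bvec₂]
    rwa [e, ← pointVI_add_one, add_sub_cancel_right, ← pointVI_add, ← e1] at this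
  have hK := hasDerivAt_comp_curve (t := t)
    (c := fun r => pointVI R S a (b - 1) t + bvec₂ R S r + bvec₂ R S t)
    (h.holomorphic (m + 1) n _ m1) ((hT.const_add _).add_const _)
  have E := ((((hF.mul_const (τ (m + 1) n (coords₂ R S (pointVI R S a (b - 1) t +
    bvec₂ R S t + bvec₂ R S 1)))).const_mul (t - 1)).fun_sub ((hid.sub_const 1).fun_mul
    (hG.const_mul (τ m n (coords₂ R S (pointVI R S a (b - 1) t + bvec₂ R S t)))))).fun_add
    ((hid.sub_const t).fun_mul (hK.const_mul (τ m n (coords₂ R S (pointVI R S a (b - 1) t +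
    bvec₂ R S 1)))))).unique ((hasDerivAt_const t (0 : ℂ)).congr_of_eventuallyEq H)
  simp only [e1, pointVI_add_one, pointVI_add, hv] at E
  rw [(h.hasDerivAt_sigmaVI hR hS ht0 ht1' ht2' hab m n).deriv,
    (h.hasDerivAt_sigmaVI hR hS ht0 ht1' ht2' hab' (m + 1) n).deriv]
  linear_combination b * E

end Bilinear

section Chain
variable {ℓ : ℕ} {R S : ℝ} {W : Set Times₂} {τ : ℤ → ℤ → Times₂ → ℂ} {d : ℤ → ℤ → ℂ}
  {a b t : ℂ} {ρ₁ ρ₂ : ℝ}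

theorem IsUCSimilarity.biPeriodic_sigmaVI (h : IsUCSimilarity ℓ R S W τ d)
    (hP : timesVI a b t ∈ W) : BiPeriodic ℓ fun m n => sigmaVI τ m n a b t := fun m n =>
  ⟨h.periodic₁ m n _ hP, h.periodic₂ m n _ hP⟩

/-- The `P_VI`-chain for homogeneous `(ℓ, ℓ)`-periodic solutions of the modified UC hierarchy. -/
theorem IsUCSimilarity.pVIChain (h : IsUCSimilarity ℓ R S W τ d) (hR : 1 < R) (hS : 1 < S)
    (ht0 : t ≠ 0) (htℓ : t ^ ℓ ≠ 1) (ht1 : ‖t‖ < R) (ht2 : ‖t⁻¹‖ < S)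
    (hW : ∀ c ∈ ({a - 1, a, a + 1} : Set ℂ), ∀ e ∈ ({b - 1, b, b + 1} : Set ℂ), ∀ w₁ w₂ : ℂ,
      ‖w₁‖ ≤ max 1 ‖t‖ → ‖w₂‖ ≤ max 1 ‖t⁻¹‖ →
        timesVI c e t + bracket₂ w₁ w₂ ∈ W ∧ timesVI c e t - bracket₂ w₁ w₂ ∈ W)
    (hS0 : ∀ m n, sigmaVI τ m n a b t ≠ 0) (hP0 : ∀ m n, sigmaVI τ m n (a + 1) b t ≠ 0)
    (hP1 : ∀ m n, sigmaVI τ m n a (b + 1) t ≠ 0) :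
    IsPVIChainAt ℓ a b (fun m n => a + b + d m (n - 1) - d (m - 1) n)
      (fVI₀ (sigmaVI τ) a b) (fVI₁ (sigmaVI τ) a b) (gVI₀ (sigmaVI τ) a b)
      (gVI₁ (sigmaVI τ) a b) t := by
  have hρ₁ : max 1 ‖t‖ < R := max_lt hR ht1
  have hρ₂ : max 1 ‖t⁻¹‖ < S := max_lt hS ht2
  have h1 : 1 ≤ max 1 ‖t‖ := le_max_left _ _
  have h2 : 1 ≤ max 1 ‖t⁻¹‖ := le_max_left _ _
  have h3 : ‖t‖ ≤ max 1 ‖t‖ := le_max_right _ _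
  have h4 : ‖t⁻¹‖ ≤ max 1 ‖t⁻¹‖ := le_max_right _ _
  have poly : ∀ c ∈ ({a - 1, a, a + 1} : Set ℂ), ∀ e ∈ ({b - 1, b, b + 1} : Set ℂ),
      ∀ c' ∈ ({a - 1, a, a + 1} : Set ℂ), ∀ e' ∈ ({b - 1, b, b + 1} : Set ℂ),
      PolydiscIn R S W (max 1 ‖t‖) (max 1 ‖t⁻¹‖) (pointVI R S c e t) (pointVI R S c' e' t) :=
    fun c hc e he c' hc' e' he' => polydiscIn_of_bracket₂ hρ₁ hρ₂
      (coords₂_pointVI hR hS ht1 ht2 c e) (coords₂_pointVI hR hS ht1 ht2 c' e')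
      fun w₁ w₂ hw₁ hw₂ => ⟨(hW c' hc' e' he' w₁ w₂ hw₁ hw₂).1, (hW c hc e he w₁ w₂ hw₁ hw₂).2⟩
  have mem : ∀ c ∈ ({a - 1, a, a + 1} : Set ℂ), ∀ e ∈ ({b - 1, b, b + 1} : Set ℂ),
      timesVI c e t ∈ W := fun c hc e he => by
    have := ((poly c hc e he c hc e he).mem (zero_le_one.trans h1) (zero_le_one.trans h2)).1
    rwa [coords₂_pointVI hR hS ht1 ht2] at this
  have am : a - 1 ∈ ({a - 1, a, a + 1} : Set ℂ) := by simp
  have a0 : a ∈ ({a - 1, a, a + 1} : Set ℂ) := by simp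
  have ap : a + 1 ∈ ({a - 1, a, a + 1} : Set ℂ) := by simp
  have bm : b - 1 ∈ ({b - 1, b, b + 1} : Set ℂ) := by simp
  have b0 : b ∈ ({b - 1, b, b + 1} : Set ℂ) := by simp
  have bp : b + 1 ∈ ({b - 1, b, b + 1} : Set ℂ) := by simp
  have hder : ∀ {c e}, timesVI c e t ∈ W → ∀ m n,
      HasDerivAt (sigmaVI τ m n c e) (deriv (sigmaVI τ m n c e) t) t := fun hce m n =>
    (h.hasDerivAt_sigmaVI hR hS ht0 ht1 ht2 hce m n).differentiableAt.hasDerivAt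
  have ea : a = a - 1 + 1 := by ring
  have eb : b = b - 1 + 1 := by ring
  have A₁ := h.hirotaMiwa_VI hρ₁ hρ₂ h1 h2 ht0 h3 h4 ea rfl (poly _ a0 _ bp _ am _ b0)
  have A₂ := h.hirotaMiwa_VI hρ₁ hρ₂ h1 h2 ht0 h3 h4 rfl eb (poly _ ap _ b0 _ a0 _ bm)
  have A₃ := h.hirotaMiwa_VI hρ₁ hρ₂ h1 h2 ht0 h3 h4 rfl rfl (poly _ ap _ bp _ a0 _ b0)
  have B₀ := h.bilinear_VI_one hρ₁ hρ₂ h1 h2 ht0 h3 h4 (mem _ a0 _ b0) (poly _ ap _ b0 _ am _ b0)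
  have B₁ := h.bilinear_VI_t hρ₁ hρ₂ h1 h2 ht0 h3 h4 (mem _ a0 _ b0) (poly _ a0 _ bp _ a0 _ bm)
  have B₂ := h.bilinear_VI_one hρ₁ hρ₂ h1 h2 ht0 h3 h4 (mem _ a0 _ bp) (poly _ ap _ bp _ am _ bp)
  have B₃ := h.bilinear_VI_t hρ₁ hρ₂ h1 h2 ht0 h3 h4 (mem _ ap _ b0) (poly _ ap _ bp _ ap _ bm)
  refine pVIChain_of_bilinear (σ := sigmaVI τ)
    (M₀₁ := fun m n => sigmaVI τ m n (a - 1) (b + 1) t)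
    (M₁₀ := fun m n => sigmaVI τ m n (a + 1) (b - 1) t)
    (P₀₁ := fun m n => sigmaVI τ m n (a + 1) (b + 1) t) ht0 htℓ rfl rfl rfl rfl rfl
    (hder (mem a a0 b b0)) (hder (mem _ ap b b0)) (hder (mem a a0 _ bp)) (hder (mem _ am b b0))
    (h.biPeriodic_sigmaVI (mem _ a0 _ b0)) (h.biPeriodic_sigmaVI (mem _ ap _ b0))
    (h.biPeriodic_sigmaVI (mem _ a0 _ bp)) (h.biPeriodic_sigmaVI (mem _ am _ b0))
    (h.biPeriodic_sigmaVI (mem _ a0 _ bm)) (h.biPeriodic_sigmaVI (mem _ am _ bp))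
    (h.biPeriodic_sigmaVI (mem _ ap _ bm)) (fun m n => ?_) (fun m n => ?_) hS0 hP0 hP1
    A₁ A₂ A₃ B₀ B₁ B₂ B₃
    (fun m n => ?_) (fun m n => ?_) (fun m n => ?_)
  · have E := eventually_mem_timesVI h.domain hR hS ht0 ht1 ht2 (mem _ a0 _ b0)
    exact ⟨Filter.EventuallyEq.deriv_eq (E.mono fun y hy => h.periodic₁ m n _ hy),
      Filter.EventuallyEq.deriv_eq (E.mono fun y hy => h.periodic₂ m n _ hy)⟩
  · have g := growthBelow_timesVI hR hS ht1 ht2 a b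
    exact ⟨h.degree_periodic (mem _ a0 _ b0) g.1 g.2 (h.periodic₁ m n) (hS0 _ _),
      h.degree_periodic (mem _ a0 _ b0) g.1 g.2 (h.periodic₂ m n) (hS0 _ _)⟩
  · have := h.bilinear_VI_row hρ₁ hρ₂ h1 h2 ht0 h3 h4 ea (mem _ am _ b0) (mem _ a0 _ b0)
      (poly _ a0 _ bp _ am _ bm) m n
    linear_combination t * this
  · have := h.bilinear_VI_row hρ₁ hρ₂ h1 h2 ht0 h3 h4 rfl (mem _ a0 _ b0) (mem _ ap _ b0)
      (poly _ ap _ bp _ a0 _ bm) m n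
    linear_combination t * this
  · obtain ⟨r₁, r₂, r1, r1', r2, r2', E⟩ := polydiscIn_eventually (a := t) h.domain
      (continuousAt_pointVI ht0 ht1 ht2 (a + 1) b) (continuousAt_pointVI ht0 ht1 ht2 (a - 1) b)
      (zero_le_one.trans h1) hρ₁ (zero_le_one.trans h2) hρ₂ (poly _ ap _ b0 _ am _ b0)
    obtain ⟨s₁, s₂, s1, s1', s2, s2', E'⟩ := polydiscIn_eventually (a := t) h.domain
      (continuousAt_pointVI ht0 ht1 ht2 a (b + 1)) (continuousAt_pointVI ht0 ht1 ht2 a (b - 1))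
      (zero_le_one.trans h1) hρ₁ (zero_le_one.trans h2) hρ₂ (poly _ a0 _ bp _ a0 _ bm)
    have c := fun m n => (hder (mem _ a0 _ b0) m n).continuousAt.eventually_ne (hS0 m n)
    filter_upwards [E, E', eventually_mem_timesVI h.domain hR hS ht0 ht1 ht2 (mem _ a0 _ b0),
      c (m - 1) n, c m (n - 1), inAnnulus_eventually (f := fun r : ℂ => r) continuousAt_id r1 r2
      ht0 h3 h4, inAnnulus_eventually (f := fun r : ℂ => r) continuousAt_id s1 s2
      ht0 h3 h4] with y y1 y2 y3 y4 y5 y6 y7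
    have B0 := h.bilinear_VI_one r1' r2' (h1.trans r1.le) (h2.trans r2.le) y6.1 y6.2.1.le y6.2.2.le
      y3 y1 (m - 1) (n - 1)
    have B1 := h.bilinear_VI_t s1' s2' (h1.trans s1.le) (h2.trans s2.le) y7.1 y7.2.1.le y7.2.2.le
      y3 y2 (m - 1) (n - 1)
    rw [sub_add_cancel, sub_add_cancel] at B0 B1
    rw [gVI₀, gVI₁]
    field_simp
    linear_combination B0 + B1

end Chain

end

end PainleveReduction

end

open PainleveReduction in
theorem theorem1p1 :
    -- the second Painlevé equation, from period two
    (∀ (R : ℝ) (U : Set Times) (τ : ℤ → Times → ℂ) (d : ℤ → ℂ), IsKPSimilarity 2 R U τ d →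
      ∀ x : ℂ, timesII x ∈ U → (∀ n, τ n (timesII x) ≠ 0) →
        IsSymmetricPIIAt (rootKP d) (qII fun n y => τ n (timesII y))
          (fII fun n y => τ n (timesII y)) x ∧
        IsPIIAt ((rootKP d 0 - 1) / 2) (qII fun n y => τ n (timesII y)) x) ∧
    -- the higher order Painlevé equation of type A, from period ℓ ≥ 3
    (∀ (ℓ : ℕ), 3 ≤ ℓ → ∀ (R : ℝ) (U : Set Times) (τ : ℤ → Times → ℂ) (d : ℤ → ℂ),
      IsKPSimilarity ℓ R U τ d →
      ∀ x : ℂ, timesA x ∈ U → (∀ n, τ n (timesA x) ≠ 0) →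
        IsDarbouxChainAt ℓ (rootKP d) (wKP fun n y => τ n (timesA y)) x ∧
        IsPAAt ℓ (rootKP d)
          (fun n y => wKP (fun n y => τ n (timesA y)) n y +
            wKP (fun n y => τ n (timesA y)) (n - 1) y) x) ∧
    -- the third Painlevé chain, from period ℓ ≥ 2
    (∀ (ℓ : ℕ), 2 ≤ ℓ → ∀ (R : ℝ) (U : Set Times) (τ : ℤ → Times → ℂ) (d : ℤ → ℂ), 1 < R →
      IsKPSimilarity ℓ R U τ d →
      ∀ a s : ℂ,
        (∀ w : ℂ, ‖w‖ ≤ 1 → timesIII (a - 1) s + bracket w ∈ U ∧ timesIII a s + bracket w ∈ U ∧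
          timesIII a s - bracket w ∈ U ∧ timesIII (a + 1) s - bracket w ∈ U) →
        (∀ n, τ n (timesIII a s) ≠ 0 ∧ τ n (timesIII (a - 1) s) ≠ 0) →
        IsPIIIChainAt ℓ a (rootKP d) (fIII (fun n a s => τ n (timesIII a s)) a)
          (gIII (fun n a s => τ n (timesIII a s)) a) s) ∧
    -- the higher order Painlevé equation of type A with 2ℓ nodes, from period (ℓ, ℓ), ℓ ≥ 2
    (∀ (ℓ : ℕ), 2 ≤ ℓ → ∀ (R S : ℝ) (W : Set Times₂) (τ : ℤ → ℤ → Times₂ → ℂ) (d : ℤ → ℤ → ℂ),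
      1 < R → 1 < S → IsUCSimilarity ℓ R S W τ d →
      ∀ a x : ℂ, x ≠ 0 →
        (∀ w₁ w₂ : ℂ, ‖w₁‖ ≤ 1 → ‖w₂‖ ≤ 1 →
          timesV (a - 1) (-x ^ 2 / 2) + bracket₂ w₁ w₂ ∈ W ∧
          timesV a (-x ^ 2 / 2) + bracket₂ w₁ w₂ ∈ W ∧
          timesV (a + 1) (-x ^ 2 / 2) - bracket₂ w₁ w₂ ∈ W ∧
          timesV (a + 2) (-x ^ 2 / 2) - bracket₂ w₁ w₂ ∈ W) →
        (∀ i : ℤ, τ i (-i) (timesV a (-x ^ 2 / 2)) ≠ 0 ∧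
          τ (i + 1) (-i) (timesV (a + 1) (-x ^ 2 / 2)) ≠ 0) →
        IsDarbouxChainAt (2 * ℓ) (rootUC d a) (wUC (fun m n a s => τ m n (timesV a s)) a) x ∧
        IsPAAt (2 * ℓ) (rootUC d a)
          (fun k y => wUC (fun m n a s => τ m n (timesV a s)) a k y +
            wUC (fun m n a s => τ m n (timesV a s)) a (k - 1) y) x) ∧
    -- the sixth Painlevé chain, from period (ℓ, ℓ), ℓ ≥ 2
    (∀ (ℓ : ℕ), 2 ≤ ℓ → ∀ (R S : ℝ) (W : Set Times₂) (τ : ℤ → ℤ → Times₂ → ℂ) (d : ℤ → ℤ → ℂ),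
      1 < R → 1 < S → IsUCSimilarity ℓ R S W τ d →
      ∀ a b t : ℂ, t ≠ 0 → t ^ ℓ ≠ 1 → ‖t‖ < R → ‖t⁻¹‖ < S →
        (∀ i ∈ Set.Icc (-1 : ℤ) 1, ∀ j ∈ Set.Icc (-1 : ℤ) 1, ∀ w₁ w₂ : ℂ,
          ‖w₁‖ ≤ max 1 ‖t‖ → ‖w₂‖ ≤ max 1 ‖t⁻¹‖ →
            timesVI (a + i) (b + j) t + bracket₂ w₁ w₂ ∈ W ∧
            timesVI (a + i) (b + j) t - bracket₂ w₁ w₂ ∈ W) →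
        (∀ m n, τ m n (timesVI a b t) ≠ 0 ∧ τ m n (timesVI (a + 1) b t) ≠ 0 ∧
          τ m n (timesVI a (b + 1) t) ≠ 0) →
        IsPVIChainAt ℓ a b (fun m n => a + b + d m (n - 1) - d (m - 1) n)
          (fVI₀ (fun m n a b t => τ m n (timesVI a b t)) a b)
          (fVI₁ (fun m n a b t => τ m n (timesVI a b t)) a b)
          (gVI₀ (fun m n a b t => τ m n (timesVI a b t)) a b)
          (gVI₁ (fun m n a b t => τ m n (timesVI a b t)) a b) t) := by
  refine ⟨fun R U τ d h x hx h0 => ⟨h.symmetricPII hx h0, h.isPIIAt hx h0⟩,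
    fun ℓ hℓ R U τ d h x hx h0 => ⟨h.darbouxChain hx h0, h.isPAAt (by omega) hx h0⟩,
    fun ℓ hℓ R U τ d hR h a s hU h0 => h.pIIIChain hR hU h0,
    fun ℓ hℓ R S W τ d hR hS h a x hx hW h0 => ?_,
    fun ℓ hℓ R S W τ d hR hS h a b t ht0 htℓ ht1 ht2 hW h0 => ?_⟩
  · have hP : PolydiscIn R S W 1 1 (pointV R S (a + 1) (-x ^ 2 / 2))
        (pointV R S (a - 1) (-x ^ 2 / 2)) :=
      polydiscIn_of_bracket₂ hR hS (coords₂_pointV hR hS _ _) (coords₂_pointV hR hS _ _)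
        fun w₁ w₂ hw₁ hw₂ => ⟨(hW w₁ w₂ hw₁ hw₂).1, (hW w₁ w₂ hw₁ hw₂).2.2.1⟩
    have hP' : PolydiscIn R S W 1 1 (pointV R S (a + 1 + 1) (-x ^ 2 / 2))
        (pointV R S a (-x ^ 2 / 2)) :=
      polydiscIn_of_bracket₂ hR hS (coords₂_pointV hR hS _ _) (coords₂_pointV hR hS _ _)
        fun w₁ w₂ hw₁ hw₂ => ⟨(hW w₁ w₂ hw₁ hw₂).2.1, by
          rw [show a + 1 + 1 = a + 2 by ring]
          exact (hW w₁ w₂ hw₁ hw₂).2.2.2⟩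
    exact ⟨h.darbouxChain hR hS hx rfl hP hP' (fun i => (h0 i).1) fun i => (h0 i).2,
      h.isPAAt (by omega) hR hS hx rfl hP hP' (fun i => (h0 i).1) fun i => (h0 i).2⟩
  · refine h.pVIChain hR hS ht0 htℓ ht1 ht2 (fun c hc e he => ?_) (fun m n => (h0 m n).1)
      (fun m n => (h0 m n).2.1) fun m n => (h0 m n).2.2
    have shift : ∀ {a c : ℂ}, c ∈ ({a - 1, a, a + 1} : Set ℂ) →
        ∃ i ∈ Set.Icc (-1 : ℤ) 1, c = a + i := by
      rintro a c (rfl | rfl | rfl)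
      · exact ⟨-1, by simp, by push_cast; ring⟩
      · exact ⟨0, by simp, by simp⟩
      · exact ⟨1, by simp, by simp⟩
    obtain ⟨i, hi, rfl⟩ := shift hc
    obtain ⟨j, hj, rfl⟩ := shift he
    exact hW i hi j hj
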